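/- Let $p$ be a prime and let $k$ be an algebraically closed field of characteristic $p$. **The hyperalgebra.** Let $X,Y,H$ be the standard basis of $\mathfrak{sl}_2(\mathbb C)$, put $X^{(m)}=X^m/m!$, $Y^{(m)}=Y^m/m!$ and $\binom{H+c}{m}=\frac{(H+c)(H+c-1)\cdots(H+c-m+1)}{m!}$ for $c\in\mathbb Z$, $m\ge 0$. Let $\mathcal U_{\mathbb Z}$ be the subring of the universal enveloping algebra of $\mathfrak{sl}_2(\mathbb C)$ generated by all $X^{(m)},Y^{(m)}$, and $\mathcal U=\mathcal U_{\mathbb Z}\otimes_{\mathbb Z}k$. The elements $Y^{(m)}\binom{H}{n}X^{(m')}$ $(m,n,m'\ge 0)$ form a $k$-basis of $\mathcal U$; let $\mathrm{Fr}':\mathcal U\to\mathcal U$ be the $k$-linear map with $Y^{(m)}\binom{H}{n}X^{(m')}\mapsto Y^{(mp)}\binom{H}{np}X^{(m'p)}$. For $a\in\mathbb Z$ let $\mu_a=\binom{H-a-1}{p-1}\in\mathcal U$. **The elements $B^{(\varepsilon)}(a,j)$.** Let $\varepsilon\in\{0,1\}$. If $p$ is odd, let $\mathcal P=\{0,\dots,p-1\}\times\{0,\dots,(p-1)/2\}$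 and, in $\mathbb F_p[x]$, let $\psi=\prod_{i\in\mathbb F_p}(x-i^2)$, $\psi^{(1)}_j=\psi/(x-j^2)$, $\psi^{(0)}_0=\prod_{i\ne 0}(x-i^2)$, and $\psi^{(0)}_j=2x(x+j^2)\prod_{i\ne 0,\pm j}(x-i^2)$ for $j\neq 0$; put $$B^{(\varepsilon)}(a,j)=\psi^{(\varepsilon)}_j\Big(\mu_aYX+\big(\tfrac{a+1}{2}\big)^2\Big)\mu_a ,$$ and let $n^{(\varepsilon)}(a,j)$ be the largest $n\ge 0$ such that $\prod_{i=0}^{n-1}(x-i(i+a+1))$ divides $\psi_j^{(\varepsilon)}\big(x+(\frac{a+1}2)^2\big)$. If $p=2$, let $\mathcal P=\{(0,\frac12),(1,0),(1,1)\}$ and $B^{(0)}(0,\frac12)=\mu_0$, $B^{(1)}(0,\frac12)=\mu_0YX$, $B^{(\varepsilon)}(1,0)=\mu_1YX$, $B^{(\varepsilon)}(1,1)=\mu_1YX+\mu_1$, with $n^{(0)}(0,\frac12)=0$, $n^{(1)}(0,\frac12)=1$, $n^{(\varepsilon)}(1,0)=1$, $n^{(\varepsilon)}(1,1)=0$. In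 all cases there are unique $c_m^{(\varepsilon)}\in\mathbb F_p$ (depending on $(a,j)$) with $B^{(\varepsilon)}(a,j)=\mu_a\sum_{m=n^{(\varepsilon)}(a,j)}^{p-1}c^{(\varepsilon)}_mY^mX^m$. **The maps $Z^{(\varepsilon)}$.** Let $(a,j)\in\mathcal P$, $z\in\mathcal U$. If either $a$ is even and $\frac{p-a+1}2\le j\le\frac{p-1}2$, or $a$ is odd and $0\le j\le\frac{a-1}2$, put $$Z^{(\varepsilon)}(z;(a,j))=\mu_a\sum_{m=n^{(\varepsilon)}(a,j)}^{p-1}c_m^{(\varepsilon)}\,Y^mX^{m-s(a,j)}\,\mathrm{Fr}'(z)\,X^{s(a,j)},$$ where $s(a,j)=1$ if $p=2$, and for $p$ odd $s(a,j)=\frac{p-a+1}{2}$ if $a$ is even, $s(a,j)=\frac{p-a}{2}$ if $a$ is odd. For all other $(a,j)\in\mathcal P$ put $Z^{(\varepsilon)}(z;(a,j))=\mathrm{Fr}'(z)B^{(\varepsilon)}(a,j)$. **The elements $B^{(\boldsymbol\varepsilon)}(\mathbf a,\mathbf j)$.** For $r\ge 1$, $\boldsymbol\varepsilon=(\varepsilon_0,\dots,\varepsilon_{r-1})\in\{0,1\}^r$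 and $(\mathbf a,\mathbf j)=((a_i,j_i))_{i=0}^{r-1}\in\mathcal P^r$, define recursively $B^{(\boldsymbol\varepsilon)}(\mathbf a,\mathbf j)=B^{(\varepsilon_0)}(a_0,j_0)$ if $r=1$, and $$B^{(\boldsymbol\varepsilon)}(\mathbf a,\mathbf j)=Z^{(\varepsilon_0)}\Big(B^{(\varepsilon_1,\dots,\varepsilon_{r-1})}\big((a_1,\dots,a_{r-1}),(j_1,\dots,j_{r-1})\big);(a_0,j_0)\Big)$$ if $r\ge 2$. Let $\mathbf e_{s+1}\in\mathbb Z^r$ be the tuple with $1$ in the position of $\varepsilon_s$ and $0$ elsewhere. **Proposition 3.7.** Let $r\ge 1$, $\boldsymbol\varepsilon\in\{0,1\}^r$, $(\mathbf a,\mathbf j)\in\mathcal P^r$ and $0\le s\le r-1$. If $\varepsilon_s=0$, then $$Y^{(p^s)}X^{(p^s)}B^{(\boldsymbol\varepsilon)}(\mathbf a,\mathbf j)=\Big(j_s^2-\big(\tfrac{a_s+1}{2}\big)^2\Big)B^{(\boldsymbol\varepsilon)}(\mathbf a,\mathbf j)+4j_s^2\,B^{(\boldsymbol\varepsilon+\mathbf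 e_{s+1})}(\mathbf a,\mathbf j),$$ and if $\varepsilon_s=1$, then $$Y^{(p^s)}X^{(p^s)}B^{(\boldsymbol\varepsilon)}(\mathbf a,\mathbf j)=\Big(j_s^2-\big(\tfrac{a_s+1}{2}\big)^2\Big)B^{(\boldsymbol\varepsilon)}(\mathbf a,\mathbf j).$$ Here the coefficients are read in $\mathbb F_p\subseteq k$ (for $p=2$ they are integers). -/

import Mathlib

open scoped Nat TensorProduct Polynomial

noncomputable section

namespace Hyperalgebra

/-! ### The divided power form of the enveloping algebra of `sl₂(ℂ)` -/

/-- The universal enveloping algebra of `sl₂(ℂ)`. -/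
abbrev UC : Type := UniversalEnvelopingAlgebra ℂ (LieAlgebra.SpecialLinear.sl (Fin 2) ℂ)

/-- The standard basis element `X` of `sl₂(ℂ)`. -/
def slX : LieAlgebra.SpecialLinear.sl (Fin 2) ℂ :=
  ⟨!![0, 1; 0, 0], by
    simp [LieAlgebra.SpecialLinear.sl, Matrix.trace_fin_two]⟩

/-- The standard basis element `Y` of `sl₂(ℂ)`. -/
def slY : LieAlgebra.SpecialLinear.sl (Fin 2) ℂ :=
  ⟨!![0, 0; 1, 0], by
    simp [LieAlgebra.SpecialLinear.sl, Matrix.trace_fin_two]⟩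

/-- The standard basis element `H` of `sl₂(ℂ)`. -/
def slH : LieAlgebra.SpecialLinear.sl (Fin 2) ℂ :=
  ⟨!![1, 0; 0, -1], by
    simp [LieAlgebra.SpecialLinear.sl, Matrix.trace_fin_two]⟩

/-- `X` in the enveloping algebra. -/
def XC : UC := UniversalEnvelopingAlgebra.ι ℂ slX

/-- `Y` in the enveloping algebra. -/
def YC : UC := UniversalEnvelopingAlgebra.ι ℂ slY

/-- `H` in the enveloping algebra. -/
def HC : UC := UniversalEnvelopingAlgebra.ι ℂ slH

/-- The divided power `x ^ m / m!`. -/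
def dividedPower (x : UC) (m : ℕ) : UC := ((m ! : ℂ)⁻¹) • x ^ m

/-- The element `(H + c)(H + c - 1) ⋯ (H + c - m + 1) / m!`. -/
def hBinom (c : ℤ) (m : ℕ) : UC :=
  ((m ! : ℂ)⁻¹) • Polynomial.aeval (HC + (c : UC)) (descPochhammer ℂ m)

/-- The subring generated by all divided powers of `X` and of `Y`. -/
def UZ : Subring UC :=
  Subring.closure (Set.range (dividedPower XC) ∪ Set.range (dividedPower YC))

/-! Commutation rules. -/

theorem lie_slX_slY : ⁅slX, slY⁆ = slH := by
  apply Subtype.ext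
  rw [LieAlgebra.SpecialLinear.sl_bracket]
  simp [slX, slY, slH]

theorem lie_slH_slX : ⁅slH, slX⁆ = (2 : ℂ) • slX := by
  apply Subtype.ext
  rw [LieAlgebra.SpecialLinear.sl_bracket]
  simp [slX, slH]
  norm_num

theorem lie_slH_slY : ⁅slH, slY⁆ = (-2 : ℂ) • slY := by
  apply Subtype.ext
  rw [LieAlgebra.SpecialLinear.sl_bracket]
  ext i j
  fin_cases i <;> fin_cases j <;> norm_num [slY, slH]

section

attribute [local instance] LieRing.ofAssociativeRing

theorem ι_lie (a b : LieAlgebra.SpecialLinear.sl (Fin 2) ℂ) :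
    UniversalEnvelopingAlgebra.ι ℂ ⁅a, b⁆ =
      UniversalEnvelopingAlgebra.ι ℂ a * UniversalEnvelopingAlgebra.ι ℂ b -
        UniversalEnvelopingAlgebra.ι ℂ b * UniversalEnvelopingAlgebra.ι ℂ a := by
  rw [LieHom.map_lie, LieRing.of_associative_ring_bracket]

end

theorem XC_mul_YC : XC * YC = YC * XC + HC := by
  have h := ι_lie slX slY
  rw [lie_slX_slY] at h
  change HC = XC * YC - YC * XC at h
  rw [h]; abel

theorem XC_mul_HC : XC * HC = (HC - 2) * XC := by
  have h := ι_lie slH slX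
  rw [lie_slH_slX, map_smul] at h
  change (2 : ℂ) • XC = HC * XC - XC * HC at h
  rw [two_smul] at h
  rw [sub_mul, two_mul, h]; abel

theorem HC_mul_YC : HC * YC = YC * (HC - 2) := by
  have h := ι_lie slH slY
  rw [lie_slH_slY, map_smul] at h
  change (-2 : ℂ) • YC = HC * YC - YC * HC at h
  rw [neg_smul, two_smul] at h
  rw [mul_sub, mul_two]
  have : HC * YC = -(YC + YC) + YC * HC := by rw [h]; abel
  rw [this]; abel

/-- Polynomials in `H`. -/
def hp (q : ℂ[X]) : UC := Polynomial.aeval HC q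

theorem hp_mul (q r : ℂ[X]) : hp (q * r) = hp q * hp r := map_mul _ _ _
theorem hp_add (q r : ℂ[X]) : hp (q + r) = hp q + hp r := map_add _ _ _

theorem XC_mul_hp (q : ℂ[X]) : XC * hp q = hp (q.comp (Polynomial.X - 2)) * XC := by
  induction q using Polynomial.induction_on' with
  | add a b ha hb => simp only [hp_add, mul_add, ha, hb, Polynomial.add_comp, add_mul]
  | monomial n c =>
    induction n generalizing c with
    | zero =>
      simp only [hp, Polynomial.monomial_zero_left, Polynomial.aeval_C, Polynomial.C_comp]
      exact (Algebra.commutes c XC).symm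
    | succ n ih =>
      rw [← Polynomial.monomial_mul_X, hp_mul, ← mul_assoc, ih, Polynomial.mul_comp, hp_mul,
        mul_assoc, mul_assoc]
      congr 1
      simp only [hp, Polynomial.aeval_X, Polynomial.X_comp, map_sub, map_ofNat, XC_mul_HC]

theorem hp_mul_YC (q : ℂ[X]) : hp q * YC = YC * hp (q.comp (Polynomial.X - 2)) := by
  induction q using Polynomial.induction_on' with
  | add a b ha hb => simp only [hp_add, mul_add, ha, hb, Polynomial.add_comp, add_mul]
  | monomial n c =>
    induction n generalizing c with
    | zero =>
      simp only [hp, Polynomial.monomial_zero_left, Polynomial.aeval_C, Polynomial.C_comp]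
      exact (Algebra.commutes c YC)
    | succ n ih =>
      rw [← Polynomial.X_mul_monomial, hp_mul, mul_assoc, ih, Polynomial.mul_comp, hp_mul,
        ← mul_assoc, ← mul_assoc]
      congr 1
      simp only [hp, Polynomial.aeval_X, Polynomial.X_comp, map_sub, map_ofNat, HC_mul_YC]

theorem hBinom_eq (c : ℤ) (m : ℕ) :
    hBinom c m = hp (Ring.choose (Polynomial.X + (c : ℂ[X])) m) := by
  have h : Ring.choose (Polynomial.X + (c : ℂ[X])) m =
      ((m ! : ℂ)⁻¹) • (descPochhammer ℂ m).comp (Polynomial.X + (c : ℂ[X])) := by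
    have h2 := Ring.descPochhammer_eq_factorial_smul_choose (Polynomial.X + (c : ℂ[X])) m
    rw [← Polynomial.aeval_eq_smeval, ← Nat.cast_smul_eq_nsmul ℂ] at h2
    rw [eq_inv_smul_iff₀ (Nat.cast_ne_zero.mpr (Nat.factorial_ne_zero m)), ← h2,
      ← descPochhammer_map (Int.castRingHom ℂ), Polynomial.comp, Polynomial.eval₂_map,
      Polynomial.aeval_def]
    congr 1
  rw [h, hp, map_smul, Polynomial.aeval_comp, hBinom]
  simp

/-- Divided powers with integer exponent, zero for negative exponents. -/
def dpz (x : UC) (n : ℤ) : UC := if 0 ≤ n then dividedPower x n.toNat else 0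

theorem dpz_natCast (x : UC) (n : ℕ) : dpz x n = dividedPower x n := by simp [dpz]

theorem dpz_neg (x : UC) {n : ℤ} (h : n < 0) : dpz x n = 0 := by
  simp [dpz, not_le.mpr h]

theorem mul_dividedPower (x : UC) (n : ℕ) :
    x * dividedPower x n = ((n : ℂ) + 1) • dividedPower x (n + 1) := by
  have h : ((n : ℂ) + 1) ≠ 0 := by exact_mod_cast Nat.succ_ne_zero n
  rw [dividedPower, dividedPower, mul_smul_comm, smul_smul, ← pow_succ']
  congr 1
  rw [Nat.factorial_succ]
  push_cast
  field_simp

theorem mul_dpz (x : UC) (n : ℤ) : x * dpz x n = ((n : ℂ) + 1) • dpz x (n + 1) := by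
  rcases lt_trichotomy n (-1) with h | h | h
  · rw [dpz_neg x (by omega), dpz_neg x (by omega)]; simp
  · subst h; simp [dpz]
  · obtain ⟨m, rfl⟩ := Int.eq_ofNat_of_zero_le (show 0 ≤ n by omega)
    have : ((m : ℤ) + 1) = ((m + 1 : ℕ) : ℤ) := by push_cast; rfl
    rw [this, dpz_natCast, dpz_natCast, mul_dividedPower]
    simp

theorem dividedPower_mul (x : UC) (a b : ℕ) :
    dividedPower x a * dividedPower x b = ((a + b).choose a : ℤ) • dividedPower x (a + b) := by
  rw [dividedPower, dividedPower, dividedPower, smul_mul_smul_comm, ← pow_add,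
    ← Int.cast_smul_eq_zsmul ℂ, smul_smul]
  congr 1
  have h1 : ((a + b).choose a : ℂ) * (a ! : ℂ) * (b ! : ℂ) = ((a + b)! : ℂ) := by
    exact_mod_cast (Nat.choose_symm_add (a := a) (b := b)) ▸
      Nat.add_choose_mul_factorial_mul_factorial a b
  have ha : (a ! : ℂ) ≠ 0 := Nat.cast_ne_zero.mpr (Nat.factorial_ne_zero a)
  have hb : (b ! : ℂ) ≠ 0 := Nat.cast_ne_zero.mpr (Nat.factorial_ne_zero b)
  have hab : ((a + b)! : ℂ) ≠ 0 := Nat.cast_ne_zero.mpr (Nat.factorial_ne_zero _)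
  push_cast
  field_simp
  rw [← h1]; ring

theorem XC_mul_dpz_YC (n : ℤ) :
    XC * dpz YC n = dpz YC n * XC + dpz YC (n - 1) * hp (Polynomial.X - (n : ℂ[X]) + 1) := by
  rcases lt_or_ge n 0 with h | h
  · rw [dpz_neg _ h, dpz_neg _ (by omega)]; simp
  obtain ⟨m, rfl⟩ := Int.eq_ofNat_of_zero_le h
  clear h
  induction m with
  | zero => simp [dpz, dividedPower]
  | succ m ih =>
    have e : ((m + 1 : ℕ) : ℤ) = (m : ℤ) + 1 := by push_cast; rfl
    have hm : ((m : ℂ) + 1) ≠ 0 := by exact_mod_cast Nat.succ_ne_zero m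
    have key : YC * dpz YC m = ((m : ℂ) + 1) • dpz YC (m + 1) := by
      have := mul_dpz YC m; simpa using this
    have key2 : YC * dpz YC ((m : ℤ) - 1) = (m : ℂ) • dpz YC m := by
      have := mul_dpz YC ((m : ℤ) - 1); simpa using this
    have comm : HC * dpz YC m = dpz YC m * hp (Polynomial.X - 2 * (m : ℂ[X])) := by
      rw [dpz_natCast, dividedPower, mul_smul_comm, smul_mul_assoc]
      congr 1
      clear ih key key2 hm e
      have : HC = hp Polynomial.X := by simp [hp]
      rw [this]
      induction m with
      | zero => simp
      | succ m ih =>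
        rw [pow_succ, ← mul_assoc, ih, mul_assoc, mul_assoc, hp_mul_YC]
        congr 3
        simp; ring
    rw [e]
    have h1 : ((m : ℂ) + 1) • (XC * dpz YC (m + 1)) =
        ((m : ℂ) + 1) • (dpz YC (m + 1) * XC + dpz YC ((m : ℤ) + 1 - 1) *
          hp (Polynomial.X - (((m : ℤ) + 1 : ℤ) : ℂ[X]) + 1)) := by
      rw [← mul_smul_comm, ← key, ← mul_assoc, XC_mul_YC, add_mul, mul_assoc, ih, mul_add,
        ← mul_assoc, key, ← mul_assoc, key2, comm, add_sub_cancel_right, smul_add,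
        smul_mul_assoc, smul_mul_assoc, add_assoc]
      congr 1
      rw [← mul_smul_comm, ← mul_add, ← mul_smul_comm]
      congr 1
      rw [hp, hp, hp, ← map_smul, ← map_smul, ← map_add]
      congr 1
      simp only [Polynomial.smul_eq_C_mul, map_add, map_natCast, map_one]
      push_cast
      ring
    exact (smul_right_injective UC hm) h1

/-- Integer valued binomial polynomials. -/
def bp (c : ℤ) (m : ℕ) : ℂ[X] := Ring.choose (Polynomial.X + (c : ℂ[X])) m

theorem hp_bp (c : ℤ) (m : ℕ) : hp (bp c m) = hBinom c m := (hBinom_eq c m).symm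

theorem bp_comp (c d : ℤ) (m : ℕ) : (bp c m).comp (Polynomial.X + (d : ℂ[X])) = bp (c + d) m := by
  have := Ring.map_choose (Polynomial.compRingHom (Polynomial.X + (d : ℂ[X])) : ℂ[X] →+* ℂ[X])
    (Polynomial.X + (c : ℂ[X])) m
  rw [Polynomial.coe_compRingHom_apply] at this
  rw [bp, this, bp]
  congr 1
  simp
  ring

theorem choose_rec (q : ℂ[X]) (m : ℕ) :
    (m + 1 : ℂ[X]) * Ring.choose q (m + 1) = (q - m) * Ring.choose q m := by
  have h := Ring.choose_smul_choose q (Nat.le_succ m)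
  simp at h
  rw [mul_comm (q - m)]
  simpa using h

theorem XC_mul_dividedPower_mul (a : ℕ) (b : ℤ) :
    dividedPower XC a * dpz YC b = ∑ i ∈ Finset.range (a + 1),
      dpz YC (b - i) * hp (bp (2 * i - a - b) i) * dpz XC (a - i) := by
  induction a with
  | zero => simp [dpz, dividedPower, bp, hp]
  | succ a ih =>
    have ha : ((a : ℂ) + 1) ≠ 0 := by exact_mod_cast Nat.succ_ne_zero a
    apply smul_right_injective UC ha
    simp only
    rw [← smul_mul_assoc, ← mul_dividedPower, mul_assoc, ih, Finset.mul_sum]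
    have step : ∀ i ∈ Finset.range (a + 1),
        XC * (dpz YC (b - i) * hp (bp (2 * i - a - b) i) * dpz XC (a - i)) =
        dpz YC (b - i) * hp (((a : ℂ[X]) + 1 - i) * bp (2 * i - a - b - 2) i) * dpz XC (a + 1 - i) +
        dpz YC (b - (i + 1 : ℕ)) * hp ((Polynomial.X - (b : ℂ[X]) + (i : ℂ[X]) + 1) *
          bp (2 * i - a - b) i) * dpz XC (((a + 1 : ℕ) : ℤ) - (i + 1 : ℕ)) := by
      intro i _
      rw [← mul_assoc, ← mul_assoc, XC_mul_dpz_YC, add_mul, add_mul]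
      congr 1
      · rw [mul_assoc (dpz YC _) XC, XC_mul_hp, mul_assoc, mul_assoc, mul_dpz, mul_assoc]
        congr 1
        rw [mul_smul_comm, ← smul_mul_assoc]
        have e1 : (a : ℤ) - i + 1 = a + 1 - i := by ring
        rw [e1]
        congr 1
        rw [hp, hp, ← map_smul]
        congr 1
        have := bp_comp (2 * i - a - b) (-2) i
        push_cast at this
        rw [sub_eq_add_neg Polynomial.X, this, Polynomial.smul_eq_C_mul]
        simp only [← sub_eq_add_neg]
        congr 1
        simp
        ring
      · rw [hp_mul, ← mul_assoc]
        have e1 : b - i - 1 = b - (i + 1 : ℕ) := by push_cast; ring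
        have e2 : (a : ℤ) - i = (a + 1 : ℕ) - (i + 1 : ℕ) := by push_cast; ring
        have e3 : (Polynomial.X - ((b - i : ℤ) : ℂ[X]) + 1) =
          (Polynomial.X - (b : ℂ[X]) + (i : ℂ[X]) + 1) := by push_cast; ring
        rw [e1, e2, e3]
    rw [Finset.sum_congr rfl step, Finset.sum_add_distrib]
    have first : ∑ i ∈ Finset.range (a + 1), dpz YC (b - i) *
        hp (((a : ℂ[X]) + 1 - i) * bp (2 * i - a - b - 2) i) * dpz XC (a + 1 - i) =
      ∑ i ∈ Finset.range (a + 1 + 1), dpz YC (b - i) *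
        hp (((a : ℂ[X]) + 1 - i) * bp (2 * i - a - b - 2) i) * dpz XC (a + 1 - i) := by
      rw [Finset.sum_range_succ _ (a + 1)]
      simp [hp]
    rw [first, Finset.sum_range_succ', add_right_comm, ← Finset.sum_add_distrib]
    conv_rhs => rw [Finset.sum_range_succ']
    rw [smul_add, Finset.smul_sum]
    congr 1
    · apply Finset.sum_congr rfl
      intro i _
      have e2 : (a : ℤ) + 1 - (i + 1 : ℕ) = (a + 1 : ℕ) - (i + 1 : ℕ) := by push_cast; ring
      rw [e2, ← add_mul, ← mul_add, ← smul_mul_assoc, ← mul_smul_comm]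
      congr 2
      rw [hp, hp, hp, ← map_add, ← map_smul]
      congr 1
      rw [Polynomial.smul_eq_C_mul]
      set q : ℂ[X] := Polynomial.X + ((2 * i - a - b : ℤ) : ℂ[X]) with hq
      have b1 : bp (2 * (i + 1 : ℕ) - a - b - 2) (i + 1) = Ring.choose q (i + 1) := by
        rw [bp, hq]; congr 2; push_cast; ring
      have b2 : bp (2 * i - a - b) i = Ring.choose q i := rfl
      have b3 : bp (2 * (i + 1 : ℕ) - (a + 1 : ℕ) - b) (i + 1) =
          Ring.choose q i + Ring.choose q (i + 1) := by
        rw [← Ring.choose_succ_succ, bp, hq]; congr 1; push_cast; ring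
      rw [b1, b2, b3]
      have r := choose_rec q i
      have e4 : (Polynomial.X : ℂ[X]) - b + i + 1 = q - i + a + 1 := by
        rw [hq]; push_cast; ring
      rw [e4]
      simp only [map_add, map_natCast, map_one]
      push_cast
      linear_combination -r
    · simp only [Nat.cast_zero, bp, Ring.choose_zero_right, mul_one]
      rw [← smul_mul_assoc, ← mul_smul_comm]
      congr 2
      simp [hp, Algebra.smul_def]

theorem bp_eq_sum (c d : ℤ) (n : ℕ) :
    bp (c + d) n = ∑ ij ∈ Finset.HasAntidiagonal.antidiagonal n, Ring.choose d ij.2 • bp c ij.1 := by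
  have h : Polynomial.X + ((c + d : ℤ) : ℂ[X]) = (Polynomial.X + (c : ℂ[X])) + (d : ℂ[X]) := by
    push_cast; ring
  rw [bp, h, Ring.add_choose_eq n (Commute.all _ _)]
  apply Finset.sum_congr rfl
  intro ij _
  have := Ring.map_choose (Int.castRingHom ℂ[X]) d ij.2
  simp only [eq_intCast] at this
  rw [← this, zsmul_eq_mul, mul_comm, bp]

theorem bp_mul (m n : ℕ) :
    bp 0 m * bp 0 n = ∑ ij ∈ Finset.HasAntidiagonal.antidiagonal n,
      (Ring.choose (m : ℤ) ij.2 * ((m + ij.1).choose m : ℤ)) • bp 0 (m + ij.1) := by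
  have h : bp 0 n = bp (-m + m) n := by simp
  rw [h, bp_eq_sum, Finset.mul_sum]
  apply Finset.sum_congr rfl
  intro ij _
  rw [mul_smul_comm, mul_smul]
  congr 1
  have := Ring.choose_smul_choose (Polynomial.X : ℂ[X]) (Nat.le_add_right m ij.1)
  rw [Nat.add_sub_cancel_left] at this
  simp only [bp, Int.cast_zero, add_zero, Int.cast_neg, Int.cast_natCast, ← sub_eq_add_neg]
  rw [← this, natCast_zsmul]

theorem dividedPower_XC_mem (m : ℕ) : dividedPower XC m ∈ UZ :=
  Subring.subset_closure (Or.inl ⟨m, rfl⟩)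

theorem dividedPower_YC_mem (m : ℕ) : dividedPower YC m ∈ UZ :=
  Subring.subset_closure (Or.inr ⟨m, rfl⟩)

theorem dpz_XC_mem (m : ℤ) : dpz XC m ∈ UZ := by
  unfold dpz; split_ifs
  exacts [dividedPower_XC_mem _, zero_mem _]

theorem dpz_YC_mem (m : ℤ) : dpz YC m ∈ UZ := by
  unfold dpz; split_ifs
  exacts [dividedPower_YC_mem _, zero_mem _]

theorem hp_bp_mem_of_le (n : ℕ) (h : ∀ k ≤ n, hp (bp 0 k) ∈ UZ) (c : ℤ) : hp (bp c n) ∈ UZ := by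
  rw [← zero_add c, bp_eq_sum, hp, map_sum]
  refine sum_mem fun ij hij => ?_
  rw [map_zsmul]
  exact zsmul_mem (h _ (Finset.HasAntidiagonal.antidiagonal.fst_le hij)) _

theorem hp_bp_zero_mem (n : ℕ) : hp (bp 0 n) ∈ UZ := by
  induction n using Nat.strong_induction_on with
  | _ n ih =>
    have h := XC_mul_dividedPower_mul n n
    rw [Finset.sum_range_succ] at h
    have e : (2 * n - n - n : ℤ) = 0 := by ring
    have d0 (x : UC) : dpz x 0 = 1 := by simp [dpz, dividedPower]
    rw [sub_self, d0, d0, e, one_mul, mul_one] at h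
    rw [← sub_eq_iff_eq_add'] at h
    rw [← h]
    refine sub_mem (mul_mem (dividedPower_XC_mem _) (dpz_YC_mem _)) (sum_mem fun i hi => ?_)
    refine mul_mem (mul_mem (dpz_YC_mem _) (hp_bp_mem_of_le i (fun k hk => ih k ?_) _))
      (dpz_XC_mem _)
    exact lt_of_le_of_lt hk (Finset.mem_range.mp hi)

theorem hBinom_mem (c : ℤ) (n : ℕ) : hBinom c n ∈ UZ := by
  rw [hBinom_eq]
  exact hp_bp_mem_of_le n (fun k _ => hp_bp_zero_mem k) c

/-- The element `Y^(m) (H choose n) X^(m')` of the enveloping algebra, for `i = (m, n, m')`. -/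
def pbwC (i : ℕ × ℕ × ℕ) : UC := dividedPower YC i.1 * hBinom 0 i.2.1 * dividedPower XC i.2.2

/-- The integral span of the elements `Y^(m) (H choose n) X^(m')`. -/
def pbwSpan : Submodule ℤ UC := Submodule.span ℤ (Set.range pbwC)

/-- The integral span of the binomial polynomials. -/
def bpSpan : Submodule ℤ ℂ[X] := Submodule.span ℤ (Set.range (bp 0))

theorem bp_mem_bpSpan (c : ℤ) (n : ℕ) : bp c n ∈ bpSpan := by
  rw [← zero_add c, bp_eq_sum]
  exact sum_mem fun ij _ => Submodule.smul_mem _ _ (Submodule.subset_span ⟨_, rfl⟩)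

theorem bpSpan_mul {q r : ℂ[X]} (hq : q ∈ bpSpan) (hr : r ∈ bpSpan) : q * r ∈ bpSpan := by
  induction hq, hr using Submodule.span_induction₂ with
  | mem_mem x y hx hy =>
    obtain ⟨m, rfl⟩ := hx
    obtain ⟨n, rfl⟩ := hy
    rw [bp_mul]
    exact sum_mem fun ij _ => Submodule.smul_mem _ _ (Submodule.subset_span ⟨_, rfl⟩)
  | zero_left y _ => simp
  | zero_right y _ => simp
  | add_left x y z _ _ _ h1 h2 => rw [add_mul]; exact add_mem h1 h2
  | add_right x y z _ _ _ h1 h2 => rw [mul_add]; exact add_mem h1 h2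
  | smul_left r x y _ _ h => rw [smul_mul_assoc]; exact Submodule.smul_mem _ _ h
  | smul_right r x y _ _ h => rw [mul_smul_comm]; exact Submodule.smul_mem _ _ h

theorem mem_pbwSpan_of_bpSpan {q : ℂ[X]} (hq : q ∈ bpSpan) (m l : ℕ) :
    dividedPower YC m * hp q * dividedPower XC l ∈ pbwSpan := by
  induction hq using Submodule.span_induction with
  | mem x hx =>
    obtain ⟨n, rfl⟩ := hx
    rw [hp_bp]
    exact Submodule.subset_span ⟨(m, n, l), rfl⟩
  | zero => simp [hp]
  | add x y _ _ h1 h2 => rw [hp_add, mul_add, add_mul]; exact add_mem h1 h2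
  | smul a x _ h =>
    rw [hp, map_zsmul, mul_smul_comm, smul_mul_assoc]; exact Submodule.smul_mem _ _ h

theorem XC_pow_mul_hp (a : ℕ) (q : ℂ[X]) :
    XC ^ a * hp q = hp (q.comp (Polynomial.X + ((-2 * a : ℤ) : ℂ[X]))) * XC ^ a := by
  induction a with
  | zero => simp
  | succ a ih =>
    rw [pow_succ', mul_assoc, ih, ← mul_assoc, XC_mul_hp, mul_assoc, Polynomial.comp_assoc]
    congr 3
    simp
    ring

theorem dividedPower_XC_mul_hp (a : ℕ) (q : ℂ[X]) :
    dividedPower XC a * hp q =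
      hp (q.comp (Polynomial.X + ((-2 * a : ℤ) : ℂ[X]))) * dividedPower XC a := by
  rw [dividedPower, smul_mul_assoc, XC_pow_mul_hp, mul_smul_comm]

theorem dividedPower_XC_mul_mem (a : ℕ) (i : ℕ × ℕ × ℕ) :
    dividedPower XC a * pbwC i ∈ pbwSpan := by
  obtain ⟨m, n, l⟩ := i
  simp only [pbwC]
  rw [← mul_assoc, ← mul_assoc, ← dpz_natCast YC, XC_mul_dividedPower_mul, Finset.sum_mul,
    Finset.sum_mul]
  refine sum_mem fun i hi => ?_
  have hi' : i ≤ a := Nat.lt_succ_iff.mp (Finset.mem_range.mp hi)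
  by_cases him : (m : ℤ) - i < 0
  · simp [dpz_neg _ him]
  have e1 : (m : ℤ) - i = (m - i : ℕ) := by omega
  have e2 : (a : ℤ) - i = (a - i : ℕ) := by omega
  rw [e1, e2, dpz_natCast, dpz_natCast, mul_assoc (dividedPower YC _ * _), ← hp_bp,
    dividedPower_XC_mul_hp, bp_comp, mul_assoc, mul_assoc, mul_assoc (hp _), dividedPower_mul,
    mul_smul_comm, mul_smul_comm, mul_smul_comm, ← mul_assoc (hp _), ← hp_mul, ← mul_assoc]
  exact Submodule.smul_mem _ _
    (mem_pbwSpan_of_bpSpan (bpSpan_mul (bp_mem_bpSpan _ _) (bp_mem_bpSpan _ _)) _ _)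

theorem dividedPower_YC_mul_mem (a : ℕ) (i : ℕ × ℕ × ℕ) :
    dividedPower YC a * pbwC i ∈ pbwSpan := by
  obtain ⟨m, n, l⟩ := i
  simp only [pbwC]
  rw [← mul_assoc, ← mul_assoc, dividedPower_mul, smul_mul_assoc, smul_mul_assoc]
  exact Submodule.smul_mem _ _ (Submodule.subset_span ⟨(a + m, n, l), rfl⟩)

theorem mul_mem_pbwSpan {x : UC} (hx : x ∈ UZ) : ∀ y ∈ pbwSpan, x * y ∈ pbwSpan := by
  induction hx using Subring.closure_induction with
  | mem x hx =>
    intro y hy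
    induction hy using Submodule.span_induction with
    | mem y hy =>
      obtain ⟨i, rfl⟩ := hy
      rcases hx with ⟨a, rfl⟩ | ⟨a, rfl⟩
      · exact dividedPower_XC_mul_mem a i
      · exact dividedPower_YC_mul_mem a i
    | zero => simp
    | add y z _ _ h1 h2 => rw [mul_add]; exact add_mem h1 h2
    | smul c y _ h => rw [mul_smul_comm]; exact Submodule.smul_mem _ _ h
  | zero => intro y _; simp
  | one => intro y hy; simpa using hy
  | add x z _ _ h1 h2 => intro y hy; rw [add_mul]; exact add_mem (h1 y hy) (h2 y hy)
  | neg x _ h => intro y hy; rw [neg_mul]; exact neg_mem (h y hy)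
  | mul x z _ _ h1 h2 => intro y hy; rw [mul_assoc]; exact h1 _ (h2 y hy)

theorem UZ_le_pbwSpan {x : UC} (hx : x ∈ UZ) : x ∈ pbwSpan := by
  have h1 : (1 : UC) ∈ pbwSpan := by
    refine Submodule.subset_span ⟨(0, 0, 0), ?_⟩
    simp [pbwC, dividedPower, hBinom]
  simpa using mul_mem_pbwSpan hx 1 h1

/-! ### Linear independence of the elements `Y^(m) (H choose n) X^(m')`

They are separated by the action on the universal Verma module `ℂ[t][y]`. -/

/-- `Y` acts by multiplication by `y`. -/
def vermaY : Module.End ℂ ℂ[X][X] := LinearMap.mulLeft ℂ Polynomial.X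

/-- The derivative with respect to `y`. -/
def vermaD : Module.End ℂ ℂ[X][X] := (Polynomial.derivative (R := ℂ[X])).restrictScalars ℂ

/-- `H` acts by `t - 2 y ∂`. -/
def vermaH : Module.End ℂ ℂ[X][X] :=
  LinearMap.mulLeft ℂ (Polynomial.C Polynomial.X) - (2 : ℂ) • (vermaY * vermaD)

/-- `X` acts by `t ∂ - y ∂ ^ 2`. -/
def vermaX : Module.End ℂ ℂ[X][X] :=
  LinearMap.mulLeft ℂ (Polynomial.C Polynomial.X) * vermaD - vermaY * vermaD * vermaD

theorem vermaY_apply (f : ℂ[X][X]) : vermaY f = Polynomial.X * f := rfl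
theorem vermaH_apply (f : ℂ[X][X]) : vermaH f =
    Polynomial.C Polynomial.X * f - 2 * (Polynomial.X * Polynomial.derivative f) := by
  change Polynomial.C Polynomial.X * f - (2 : ℂ) • (Polynomial.X * Polynomial.derivative f) = _
  rw [two_smul, two_mul]
theorem vermaX_apply (f : ℂ[X][X]) : vermaX f =
    Polynomial.C Polynomial.X * Polynomial.derivative f -
      Polynomial.X * Polynomial.derivative (Polynomial.derivative f) := rfl

theorem verma_XY : vermaX * vermaY - vermaY * vermaX = vermaH := by
  ext1 f
  simp only [LinearMap.sub_apply, Module.End.mul_apply, vermaX_apply, vermaY_apply, vermaH_apply,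
    Polynomial.derivative_mul, Polynomial.derivative_X, Polynomial.derivative_add, one_mul]
  ring

theorem verma_HX : vermaH * vermaX - vermaX * vermaH = (2 : ℂ) • vermaX := by
  rw [two_smul]
  ext1 f
  simp only [LinearMap.sub_apply, LinearMap.add_apply, Module.End.mul_apply, vermaX_apply,
    vermaH_apply, Polynomial.derivative_mul, Polynomial.derivative_X, Polynomial.derivative_add,
    Polynomial.derivative_sub, Polynomial.derivative_C, Polynomial.derivative_ofNat,
    one_mul, zero_mul, zero_add]
  ring

theorem verma_HY : vermaH * vermaY - vermaY * vermaH = (-2 : ℂ) • vermaY := by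
  ext1 f
  simp only [LinearMap.sub_apply, LinearMap.smul_apply, Module.End.mul_apply, vermaY_apply,
    vermaH_apply, Polynomial.derivative_mul, Polynomial.derivative_X, neg_smul, two_smul, one_mul]
  ring

section

attribute [local instance] LieRing.ofAssociativeRing

/-- The representation of `sl₂(ℂ)` on the universal Verma module. -/
def vermaLie : LieAlgebra.SpecialLinear.sl (Fin 2) ℂ →ₗ⁅ℂ⁆ Module.End ℂ ℂ[X][X] where
  toFun A := A.1 0 1 • vermaX + A.1 1 0 • vermaY + A.1 0 0 • vermaH
  map_add' A B := by simp [add_smul]; abel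
  map_smul' c A := by simp [mul_smul]
  map_lie' := by
    intro A B
    have hA : A.1 1 1 = - A.1 0 0 := by
      have h : Matrix.trace A.1 = 0 := A.2
      rw [Matrix.trace_fin_two] at h
      linear_combination h
    have hB : B.1 1 1 = - B.1 0 0 := by
      have h : Matrix.trace B.1 = 0 := B.2
      rw [Matrix.trace_fin_two] at h
      linear_combination h
    have h1 : vermaX * vermaY = vermaY * vermaX + vermaH := by rw [← verma_XY]; abel
    have h2 : vermaH * vermaX = vermaX * vermaH + (2 : ℂ) • vermaX := by rw [← verma_HX]; abel
    have h3 : vermaH * vermaY = vermaY * vermaH + (-2 : ℂ) • vermaY := by rw [← verma_HY]; abel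
    simp only [LieAlgebra.SpecialLinear.sl_bracket, LieRing.of_associative_ring_bracket,
      Matrix.sub_apply, Matrix.mul_apply, Fin.sum_univ_two, hA, hB, add_mul, mul_add,
      smul_mul_smul_comm, h1, h2, h3, smul_add, smul_smul]
    module

/-- The action of the enveloping algebra on the universal Verma module. -/
def verma : UC →ₐ[ℂ] Module.End ℂ ℂ[X][X] := UniversalEnvelopingAlgebra.lift ℂ vermaLie

theorem verma_XC : verma XC = vermaX := by
  rw [verma, XC, UniversalEnvelopingAlgebra.lift_ι_apply]
  change slX.1 0 1 • vermaX + slX.1 1 0 • vermaY + slX.1 0 0 • vermaH = _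
  simp [slX]

theorem verma_YC : verma YC = vermaY := by
  rw [verma, YC, UniversalEnvelopingAlgebra.lift_ι_apply]
  change slY.1 0 1 • vermaX + slY.1 1 0 • vermaY + slY.1 0 0 • vermaH = _
  simp [slY]

theorem verma_HC : verma HC = vermaH := by
  rw [verma, HC, UniversalEnvelopingAlgebra.lift_ι_apply]
  change slH.1 0 1 • vermaX + slH.1 1 0 • vermaY + slH.1 0 0 • vermaH = _
  simp [slH]

end

theorem vermaX_C_mul_X_pow (g : ℂ[X]) (l : ℕ) :
    vermaX (Polynomial.C g * Polynomial.X ^ (l + 1)) =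
      Polynomial.C ((l + 1 : ℂ[X]) * (Polynomial.X - (l : ℂ[X])) * g) * Polynomial.X ^ l := by
  rw [vermaX_apply]
  cases l with
  | zero => simp [Polynomial.derivative_mul]
  | succ l =>
    simp only [Polynomial.derivative_mul, Polynomial.derivative_X_pow, Polynomial.derivative_C,
      zero_mul, zero_add, Polynomial.C_mul, Polynomial.C_sub, Polynomial.C_add,
      Polynomial.derivative_natCast, map_natCast, map_one, Nat.add_sub_cancel, Nat.cast_add,
      Nat.cast_one, Polynomial.derivative_add, Polynomial.derivative_one, add_zero]
    ring

theorem vermaX_pow_of_lt (g : ℂ[X]) {i l : ℕ} (h : i < l) :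
    (vermaX ^ l) (Polynomial.C g * Polynomial.X ^ i) = 0 := by
  induction i generalizing l g with
  | zero =>
    obtain ⟨l, rfl⟩ := Nat.exists_eq_succ_of_ne_zero h.ne'
    rw [pow_succ, Module.End.mul_apply, vermaX_apply]
    simp
  | succ i ih =>
    obtain ⟨l, rfl⟩ := Nat.exists_eq_succ_of_ne_zero (Nat.ne_zero_of_lt h)
    rw [pow_succ, Module.End.mul_apply, vermaX_C_mul_X_pow]
    exact ih _ (by omega)

theorem vermaX_pow_self (l : ℕ) : ∃ κ : ℂ[X], κ ≠ 0 ∧ ∀ g : ℂ[X],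
    (vermaX ^ l) (Polynomial.C g * Polynomial.X ^ l) = Polynomial.C (κ * g) := by
  induction l with
  | zero => exact ⟨1, one_ne_zero, fun g => by simp⟩
  | succ l ih =>
    obtain ⟨κ, hκ, h⟩ := ih
    refine ⟨κ * ((l + 1 : ℂ[X]) * (Polynomial.X - (l : ℂ[X]))), ?_, fun g => ?_⟩
    · refine mul_ne_zero hκ (mul_ne_zero ?_ ?_)
      · exact_mod_cast Nat.succ_ne_zero l
      · rw [← Polynomial.C_eq_natCast]; exact Polynomial.X_sub_C_ne_zero _
    · rw [pow_succ, Module.End.mul_apply, vermaX_C_mul_X_pow, h]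
      congr 1
      ring

theorem verma_hp (q g : ℂ[X]) : verma (hp q) (Polynomial.C g) = Polynomial.C (q * g) := by
  rw [hp, ← Polynomial.aeval_algHom_apply, verma_HC]
  induction q using Polynomial.induction_on' generalizing g with
  | add a b ha hb => rw [map_add, LinearMap.add_apply, ha, hb, ← Polynomial.C_add, add_mul]
  | monomial n c =>
    induction n generalizing g with
    | zero =>
      rw [Polynomial.monomial_zero_left, Polynomial.aeval_C, Module.algebraMap_end_apply,
        Polynomial.smul_C, Polynomial.smul_eq_C_mul]
    | succ n ih =>
      rw [← Polynomial.monomial_mul_X, map_mul, Polynomial.aeval_X, Module.End.mul_apply,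
        vermaH_apply]
      simp only [Polynomial.derivative_C, mul_zero, sub_zero]
      rw [← Polynomial.C_mul, ih, mul_assoc]

theorem verma_pbwC (m n l i : ℕ) : verma (pbwC (m, n, l)) (Polynomial.X ^ i) =
    ((l ! : ℂ)⁻¹ * (m ! : ℂ)⁻¹) • (Polynomial.X ^ m *
      verma (hp (bp 0 n)) ((vermaX ^ l) (Polynomial.X ^ i))) := by
  have hY : ∀ f, (vermaY ^ m) f = Polynomial.X ^ m * f := by
    induction m with
    | zero => simp
    | succ m ih =>
      intro f
      rw [pow_succ', Module.End.mul_apply, ih, vermaY_apply, pow_succ', mul_assoc]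
  rw [pbwC, ← hp_bp]
  simp only [map_mul, dividedPower, map_smul, map_pow, verma_XC, verma_YC, Module.End.mul_apply,
    LinearMap.smul_apply, hY, mul_smul_comm, smul_smul]

theorem linearIndependent_pbwC : LinearIndependent ℤ pbwC := by
  rw [linearIndependent_iff]
  intro f hf
  have main : ∀ l m n, f (m, n, l) = 0 := by
    intro l
    induction l using Nat.strong_induction_on with
    | _ l ih =>
      intro m
      obtain ⟨κ, hκ, hκl⟩ := vermaX_pow_self l
      -- the identity of polynomials obtained from the action on `y ^ l`
      have h1 : ∑ i ∈ f.support, (if i.1 = m ∧ i.2.2 = l then (f i : ℂ[X]) * bp 0 i.2.1 else 0)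
          = 0 := by
        have h0 := congrArg (fun u => (verma u (Polynomial.X ^ l)).coeff m) hf
        simp only [Finsupp.linearCombination_apply, Finsupp.sum, map_sum, map_zsmul,
          LinearMap.sum_apply, LinearMap.smul_apply, Polynomial.finsetSum_coeff, map_zero,
          LinearMap.zero_apply, Polynomial.coeff_zero] at h0
        have hc : Polynomial.C (((l ! : ℂ)⁻¹ * (m ! : ℂ)⁻¹)) * κ ≠ 0 := by
          refine mul_ne_zero (Polynomial.C_ne_zero.mpr (mul_ne_zero ?_ ?_)) hκ <;>
            exact inv_ne_zero (Nat.cast_ne_zero.mpr (Nat.factorial_ne_zero _))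
        refine (mul_eq_zero.mp ?_).resolve_left hc
        rw [Finset.mul_sum]
        refine Eq.trans (Finset.sum_congr rfl ?_) h0
        rintro ⟨m', n', l'⟩ _
        rw [verma_pbwC]
        rcases lt_trichotomy l' l with hl | hl | hl
        · rw [ih l' hl]; simp
        · subst hl
          have := hκl 1
          rw [Polynomial.C_1, one_mul, mul_one] at this
          rw [this, verma_hp, Polynomial.coeff_smul, Polynomial.coeff_smul,
            Polynomial.coeff_X_pow_mul', Polynomial.coeff_C]
          by_cases hm : m' = m
          · subst hm
            simp only [and_self, if_true, le_refl, Nat.sub_self]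
            rw [Polynomial.smul_eq_C_mul, zsmul_eq_mul]
            ring
          · rw [if_neg (by simp [hm])]
            split_ifs with h2 h3
            · omega
            · simp
            · simp
        · have := vermaX_pow_of_lt 1 hl
          rw [Polynomial.C_1, one_mul] at this
          rw [this, if_neg (by simp; omega)]
          simp
      intro n
      induction n using Nat.strong_induction_on with
      | _ n ihn =>
        have h2 := congrArg (Polynomial.eval (n : ℂ)) h1
        have hev : ∀ k, Polynomial.eval (n : ℂ) (bp 0 k) = (n.choose k : ℂ) := by
          intro k
          have := Ring.map_choose (Polynomial.evalRingHom (n : ℂ)) (Polynomial.X : ℂ[X]) k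
          simp only [Polynomial.coe_evalRingHom, Polynomial.eval_X] at this
          rw [bp, Int.cast_zero, add_zero, this, Ring.choose_natCast]
        rw [Polynomial.eval_finsetSum, Finset.sum_eq_single (m, n, l)] at h2
        · simpa [hev] using h2
        · rintro ⟨m', n', l'⟩ _ hne
          split_ifs with h
          · obtain ⟨h3, h4⟩ := h
            simp only at h3 h4
            subst h3 h4
            rw [Polynomial.eval_mul, hev]
            rcases lt_trichotomy n' n with h5 | h5 | h5
            · rw [ihn n' h5]; simp
            · subst h5; exact absurd rfl hne
            · rw [Nat.choose_eq_zero_of_lt h5]; simp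
          · simp
        · intro h
          rw [Finsupp.notMem_support_iff.mp h]
          simp
  ext ⟨m, n, l⟩
  exact main l m n

/-! ### The hyperalgebra -/

/-- The divided power `X^(m)` in the integral form. -/
def XZ (m : ℕ) : UZ := ⟨dividedPower XC m, dividedPower_XC_mem m⟩

/-- The divided power `Y^(m)` in the integral form. -/
def YZ (m : ℕ) : UZ := ⟨dividedPower YC m, dividedPower_YC_mem m⟩

/-- The binomial coefficient `(H + c choose m)` in the integral form. -/
def HZ (c : ℤ) (m : ℕ) : UZ := ⟨hBinom c m, hBinom_mem c m⟩

/-- The basis of the integral form, indexed by triples `(m, n, m')`. -/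
def basisUZ : Module.Basis (ℕ × ℕ × ℕ) ℤ UZ :=
  Module.Basis.mk (v := fun i => YZ i.1 * HZ 0 i.2.1 * XZ i.2.2)
    (LinearIndependent.of_comp UZ.subtype.toIntAlgHom.toLinearMap linearIndependent_pbwC) (by
      rintro ⟨x, hx⟩ -
      have h := UZ_le_pbwSpan hx
      have e : Set.range pbwC = UZ.subtype.toIntAlgHom.toLinearMap ''
          Set.range (fun i : ℕ × ℕ × ℕ => YZ i.1 * HZ 0 i.2.1 * XZ i.2.2) := by
        rw [← Set.range_comp]; rfl
      rw [pbwSpan, e, Submodule.span_image] at h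
      obtain ⟨y, hy, hxy⟩ := h
      have : y = ⟨x, hx⟩ := Subtype.ext hxy
      rwa [← this])

theorem basisUZ_apply (m n m' : ℕ) : basisUZ (m, n, m') = YZ m * HZ 0 n * XZ m' := by
  simp [basisUZ]

/-- The hyperalgebra of `SL₂` over `k`: base change to `k` of the divided power form. -/
abbrev U (k : Type*) [Field k] : Type _ := k ⊗[ℤ] UZ

/-- The element `X^(m)` of the hyperalgebra. -/
def Xd (k : Type*) [Field k] (m : ℕ) : U k := 1 ⊗ₜ[ℤ] XZ m

/-- The element `Y^(m)` of the hyperalgebra. -/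
def Yd (k : Type*) [Field k] (m : ℕ) : U k := 1 ⊗ₜ[ℤ] YZ m

/-- The element `(H + c choose m)` of the hyperalgebra. -/
def Hd (k : Type*) [Field k] (c : ℤ) (m : ℕ) : U k := 1 ⊗ₜ[ℤ] HZ c m

/-- The basis of the hyperalgebra formed by the elements `Y^(m) (H choose n) X^(m')`. -/
def basisU (k : Type*) [Field k] : Module.Basis (ℕ × ℕ × ℕ) k (U k) :=
  Algebra.TensorProduct.basis k basisUZ

theorem basisU_apply (k : Type*) [Field k] (m n m' : ℕ) :
    basisU k (m, n, m') = Yd k m * Hd k 0 n * Xd k m' := by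
  rw [basisU, Algebra.TensorProduct.basis_apply, basisUZ_apply, Yd, Hd, Xd,
    Algebra.TensorProduct.tmul_mul_tmul, Algebra.TensorProduct.tmul_mul_tmul, one_mul, one_mul]

/-- The `k`-linear map `Fr'` sending `Y^(m) (H choose n) X^(m')` to
`Y^(mp) (H choose np) X^(m'p)`. -/
def frPrime (p : ℕ) (k : Type*) [Field k] : U k →ₗ[k] U k :=
  (basisU k).constr k fun i => Yd k (i.1 * p) * Hd k 0 (i.2.1 * p) * Xd k (i.2.2 * p)

theorem frPrime_apply (p : ℕ) (k : Type*) [Field k] (m n m' : ℕ) :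
    frPrime p k (Yd k m * Hd k 0 n * Xd k m') =
      Yd k (m * p) * Hd k 0 (n * p) * Xd k (m' * p) := by
  rw [← basisU_apply, frPrime, Module.Basis.constr_basis]

/-- The idempotent `μ_a = (H - a - 1 choose p - 1)`. -/
def mu (p : ℕ) (k : Type*) [Field k] (a : ℤ) : U k := Hd k (-a - 1) (p - 1)

/-! ### The elements `B^(ε)(a, j)` -/

/-- The set `𝒫`. For odd `p` it is `{0, …, p - 1} × {0, …, (p - 1) / 2}`. -/
def pairs (p : ℕ) : Set (ℤ × ℚ) :=
  if p = 2 then {(0, 1 / 2), (1, 0), (1, 1)}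
  else {x | (0 ≤ x.1 ∧ x.1 < p) ∧ ∃ n : ℕ, n ≤ (p - 1) / 2 ∧ x.2 = n}

/-- The polynomial `φ_{a,m}(x) = ∏_{i < m} (x - i (i + a + 1))`. -/
def phi (p : ℕ) (a : ℤ) (m : ℕ) : (ZMod p)[X] :=
  ∏ i ∈ Finset.range m, (Polynomial.X - Polynomial.C ((i : ZMod p) * (i + a + 1)))

/-- The polynomial `ψ(x) = ∏_{i ∈ 𝔽_p} (x - i²)`. -/
def psi (p : ℕ) [Fact p.Prime] : (ZMod p)[X] :=
  ∏ i : ZMod p, (Polynomial.X - Polynomial.C (i ^ 2))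

/-- The polynomial `ψ_j^(ε)(x)` (used for odd `p`):
`ψ_j^(1) = ψ / (x - j²)`, `ψ_0^(0) = ∏_{i ≠ 0} (x - i²)`, and
`ψ_j^(0) = 2 x (x + j²) ∏_{i ≠ 0, j, -j} (x - i²)` for `j ≠ 0`. -/
def psiEps (p : ℕ) [Fact p.Prime] (ε : Fin 2) (j : ZMod p) : (ZMod p)[X] :=
  if ε = 1 then psi p /ₘ (Polynomial.X - Polynomial.C (j ^ 2))
  else if j = 0 then
    ∏ i : ZMod p with i ≠ 0, (Polynomial.X - Polynomial.C (i ^ 2))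
  else
    2 * Polynomial.X * (Polynomial.X + Polynomial.C (j ^ 2)) *
      ∏ i : ZMod p with i ≠ 0 ∧ i ≠ j ∧ i ≠ -j, (Polynomial.X - Polynomial.C (i ^ 2))

/-- The element `B^(ε)(a, j)` attached to a single pair `(a, j) ∈ 𝒫`. -/
def B₁ (p : ℕ) [Fact p.Prime] (k : Type*) [Field k] [CharP k p] (ε : Fin 2) (a : ℤ) (j : ℚ) :
    U k :=
  if p = 2 then
    if a = 0 ∧ j = 1 / 2 then (if ε = 0 then mu p k 0 else mu p k 0 * Yd k 1 * Xd k 1)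
    else if a = 1 ∧ j = 0 then mu p k 1 * Yd k 1 * Xd k 1
    else if a = 1 ∧ j = 1 then mu p k 1 * Yd k 1 * Xd k 1 + mu p k 1
    else 0
  else
    Polynomial.aeval (mu p k a * Yd k 1 * Xd k 1 + algebraMap k (U k) ((((a : k) + 1) / 2) ^ 2))
      ((psiEps p ε (j : ZMod p)).map (ZMod.castHom (dvd_refl p) k)) * mu p k a

/-- The integer `n^(ε)(a, j)`. For odd `p` it is the largest `n` such that `φ_{a,n}(x)` divides
`ψ_j^(ε)(x + ((a + 1) / 2)²)`. -/
def nIdx (p : ℕ) [Fact p.Prime] (ε : Fin 2) (a : ℤ) (j : ℚ) : ℕ :=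
  if p = 2 then
    if a = 0 ∧ j = 1 / 2 then (if ε = 0 then 0 else 1)
    else if a = 1 ∧ j = 0 then 1
    else 0
  else
    sSup {n : ℕ | phi p a n ∣ (psiEps p ε (j : ZMod p)).comp
      (Polynomial.X + Polynomial.C ((((a : ZMod p) + 1) / 2) ^ 2))}

/-- The coefficients `c_m^(ε) ∈ 𝔽_p`, `n^(ε)(a, j) ≤ m ≤ p - 1`, in the (unique) expansion
`B^(ε)(a, j) = μ_a ∑_m c_m^(ε) Y^m X^m`. -/
def coeffB (p : ℕ) [Fact p.Prime] (k : Type*) [Field k] [CharP k p] (ε : Fin 2) (a : ℤ) (j : ℚ) :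
    ℕ → ZMod p :=
  Classical.epsilon fun c : ℕ → ZMod p =>
    B₁ p k ε a j = mu p k a * ∑ m ∈ Finset.Icc (nIdx p ε a j) (p - 1),
      ZMod.castHom (dvd_refl p) k (c m) • (Yd k 1 ^ m * Xd k 1 ^ m)

/-- The conditions (A): `a` is even and `(p - a + 1) / 2 ≤ j ≤ (p - 1) / 2`, or
(C): `a` is odd and `0 ≤ j ≤ (a - 1) / 2`. The other elements of `𝒫` are those of
types (B) and (D). -/
def IsAC (p : ℕ) (a : ℤ) (j : ℚ) : Prop :=
  (Even a ∧ ((p : ℚ) - a + 1) / 2 ≤ j ∧ j ≤ ((p : ℚ) - 1) / 2) ∨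
    (Odd a ∧ 0 ≤ j ∧ j ≤ ((a : ℚ) - 1) / 2)

/-- The integer `s(a, j)` (used for the pairs of types (A) and (C)). -/
def sShift (p : ℕ) (a : ℤ) : ℕ :=
  if p = 2 then 1
  else if Even a then (((p : ℤ) - a + 1) / 2).toNat
  else (((p : ℤ) - a) / 2).toNat

open Classical in
/-- The element `Z^(ε)(z; (a, j))`. -/
def Z (p : ℕ) [Fact p.Prime] (k : Type*) [Field k] [CharP k p] (ε : Fin 2) (z : U k) (a : ℤ)
    (j : ℚ) : U k :=
  if IsAC p a j then
    mu p k a * ∑ m ∈ Finset.Icc (nIdx p ε a j) (p - 1),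
      ZMod.castHom (dvd_refl p) k (coeffB p k ε a j m) •
        (Yd k 1 ^ m * Xd k 1 ^ (m - sShift p a) * frPrime p k z * Xd k 1 ^ sShift p a)
  else frPrime p k z * B₁ p k ε a j

/-- The element `B^(ε)(𝐚, 𝐣)` for `r`-tuples, `r ≥ 1` (the value for `r = 0` is irrelevant). -/
def B (p : ℕ) [Fact p.Prime] (k : Type*) [Field k] [CharP k p] :
    (r : ℕ) → (Fin r → Fin 2) → (Fin r → ℤ) → (Fin r → ℚ) → U k
  | 0, _, _, _ => 1
  | 1, ε, a, j => B₁ p k (ε 0) (a 0) (j 0)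
  | r + 2, ε, a, j =>
    Z p k (ε 0) (B p k (r + 1) (fun i => ε i.succ) (fun i => a i.succ) (fun i => j i.succ))
      (a 0) (j 0)

end Hyperalgebra

end

/-!
For odd `p` the element `B^(ε)(a, j)` is `f(YX) μ_a` with `f = ψ_j^(ε)(x + ((a + 1) / 2)²)`, and for
`p = 2` it also has this form. On the image of `μ_a` a polynomial in `YX` only matters modulo
`φ_{a,p}`, so the case `s = 0`, `r = 1` is a divisibility of polynomials over `𝔽_p`.

For longer tuples the point is that `Z^(ε)(z; (a, j)) = F(z) B^(ε)(a, j)` for a single `k`-linear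
map `F`: for the types (B) and (D) it is `Fr'`, and for the types (A) and (C) moving `X^s` to the
left raises the weights by `2s`, which on the image of `μ_a` turns `Fr'` into its variant with
`H + p` in place of `H`. Elements of the image of `F` commute with `YX`, which gives `s = 0`. For
`s > 0`, `Y^(pq)` and `X^(pq)` pass through `F` as `Y^(q)` and `X^(q)`: in the commutation formula
for `X^(p)` and `Y^(p)` the mixed terms, acting on `B^(ε)(a, j)`, add up to `0` for the types (B)
and (D) and to `1` for the types (A) and (C), which is precisely the shift of the weights in `F`.
The proposition follows by induction on `r`.
-/

noncomputable section

namespace Hyperalgebra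

/-- The ring of complex polynomials taking integer values at all integers. -/
def intValued : Subring ℂ[X] :=
  ⨅ n : ℤ, (Int.castRingHom ℂ).range.comap (Polynomial.evalRingHom (n : ℂ))

theorem mem_intValued {q : ℂ[X]} : q ∈ intValued ↔ ∀ n : ℤ, ∃ z : ℤ, (z : ℂ) = q.eval (n : ℂ) := by
  simp [intValued, Subring.mem_iInf]

/-- Evaluation of integer-valued polynomials at an integer, as a map into `ℤ`. -/
def evalInt (n : ℤ) : intValued →+* ℤ :=
  (RingEquiv.ofLeftInverse (f := Int.castRingHom ℂ)
    (Function.leftInverse_invFun Int.cast_injective)).symm.toRingHom.comp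
  (((Polynomial.evalRingHom (n : ℂ)).comp intValued.subtype).codRestrict _
    fun q => mem_intValued.mp q.2 n)

theorem intCast_evalInt (n : ℤ) (q : intValued) : (evalInt n q : ℂ) = q.1.eval (n : ℂ) := by
  obtain ⟨z, hz⟩ := mem_intValued.mp q.2 n
  exact Function.invFun_eq (f := (Int.cast : ℤ → ℂ)) ⟨z, hz⟩

theorem evalInt_eq_iff {n : ℤ} {q : intValued} {z : ℤ} :
    evalInt n q = z ↔ q.1.eval (n : ℂ) = z := by
  rw [← intCast_evalInt, Int.cast_inj]

theorem eval_bp (c n : ℤ) (m : ℕ) :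
    (bp c m).eval (n : ℂ) = (Ring.choose (n + c) m : ℤ) := by
  have h_poly := Ring.map_choose (Polynomial.evalRingHom (n : ℂ)) (Polynomial.X + (c : ℂ[X])) m
  have h_cast := Ring.map_choose (Int.castRingHom ℂ) (n + c) m
  simp only [Polynomial.coe_evalRingHom, Polynomial.eval_add, Polynomial.eval_X,
    Polynomial.eval_intCast, eq_intCast, Int.cast_add] at h_poly h_cast
  rw [bp, h_poly, ← h_cast]

/-- The binomial coefficient `(t + c choose m)` as an integer-valued polynomial in `t`. -/
def binom (c : ℤ) (m : ℕ) : intValued :=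
  ⟨bp c m, mem_intValued.mpr fun n => ⟨_, (eval_bp c n m).symm⟩⟩

theorem evalInt_binom (n c : ℤ) (m : ℕ) : evalInt n (binom c m) = Ring.choose (n + c) m :=
  evalInt_eq_iff.mpr (eval_bp c n m)

theorem binom_zero_right (c : ℤ) : binom c 0 = 1 :=
  Subtype.ext (Ring.choose_zero_right _)

/-- Substitution of `u t + v` for the variable `t` of an integer-valued polynomial. -/
def affineComp (u v : ℤ) : intValued →+* intValued :=
  ((Polynomial.compRingHom ((u : ℂ[X]) * Polynomial.X + (v : ℂ[X]))).comp
    intValued.subtype).codRestrict intValued fun q => mem_intValued.mpr fun n =>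
      ⟨evalInt (u * n + v) q, by simp [intCast_evalInt, Polynomial.eval_comp]⟩

theorem coe_affineComp (u v : ℤ) (q : intValued) :
    (affineComp u v q : ℂ[X]) = q.1.comp ((u : ℂ[X]) * Polynomial.X + (v : ℂ[X])) := rfl

theorem evalInt_affineComp (n u v : ℤ) (q : intValued) :
    evalInt n (affineComp u v q) = evalInt (u * n + v) q := by
  rw [evalInt_eq_iff, intCast_evalInt, coe_affineComp]
  simp [Polynomial.eval_comp]

theorem affineComp_affineComp (u v u' v' : ℤ) (q : intValued) :
    affineComp u v (affineComp u' v' q) = affineComp (u' * u) (u' * v + v') q := by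
  refine Subtype.ext ?_
  rw [coe_affineComp, coe_affineComp, coe_affineComp, Polynomial.comp_assoc]
  congr 1
  simp
  ring

theorem affineComp_one_zero (q : intValued) : affineComp 1 0 q = q :=
  Subtype.ext (by simp [coe_affineComp])

theorem affineComp_one_binom (v c : ℤ) (m : ℕ) : affineComp 1 v (binom c m) = binom (c + v) m :=
  Subtype.ext <| by
    rw [coe_affineComp, Int.cast_one, one_mul]
    exact bp_comp c v m

theorem bpSpan_le_intValued {q : ℂ[X]} (hq : q ∈ bpSpan) : q ∈ intValued := by
  have h_le : bpSpan ≤ AddSubgroup.toIntSubmodule intValued.toAddSubgroup := by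
    rw [bpSpan, Submodule.span_le]
    rintro _ ⟨m, rfl⟩
    exact (binom 0 m).2
  exact h_le hq

theorem eq_sum_fwdDiff_smul_bp (q : ℂ[X]) :
    q = ∑ i ∈ Finset.range (q.natDegree + 1), (fwdDiff 1)^[i] q.eval 0 • bp 0 i := by
  refine Polynomial.eq_of_infinite_eval_eq _ _
    ((Set.infinite_range_of_injective (Nat.cast_injective (R := ℂ))).mono ?_)
  rintro _ ⟨n, rfl⟩
  have h_bp (i : ℕ) : (bp 0 i).eval (n : ℂ) = (n.choose i : ℂ) := by
    simpa [Ring.choose_natCast] using eval_bp 0 n i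
  have h_newton := shift_eq_sum_fwdDiff_iter (1 : ℂ) q.eval n 0
  rw [zero_add, nsmul_one] at h_newton
  simp only [Set.mem_ofPred_eq, Polynomial.eval_finsetSum, Polynomial.eval_smul, h_bp, h_newton,
    nsmul_eq_mul, smul_eq_mul]
  rw [Finset.sum_subset (Finset.range_mono (le_max_left (n + 1) (q.natDegree + 1))),
    Finset.sum_subset (Finset.range_mono (le_max_right (n + 1) (q.natDegree + 1)))]
  · exact Finset.sum_congr rfl fun i _ => mul_comm _ _
  · intro i _ hi
    rw [Polynomial.fwdDiff_iter_eq_zero_of_degree_lt (by simpa using hi), Pi.zero_apply, zero_mul]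
  · intro i _ hi
    rw [Nat.choose_eq_zero_of_lt (by simpa using hi), Nat.cast_zero, zero_mul]

theorem mem_bpSpan_of_forall_nat {q : ℂ[X]} (hq : ∀ n : ℕ, ∃ z : ℤ, (z : ℂ) = q.eval (n : ℂ)) :
    q ∈ bpSpan := by
  choose f hf using hq
  rw [eq_sum_fwdDiff_smul_bp q]
  refine Submodule.sum_mem _ fun i _ => ?_
  have h_int : (fwdDiff 1)^[i] q.eval 0 =
      ((∑ l ∈ Finset.range (i + 1), (-1) ^ (i - l) * i.choose l * f l : ℤ) : ℂ) := by
    simp [fwdDiff_iter_eq_sum_shift, hf]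
  rw [h_int, Int.cast_smul_eq_zsmul]
  exact Submodule.smul_mem _ _ (Submodule.subset_span ⟨i, rfl⟩)

theorem mem_bpSpan_of_intValued (q : intValued) : q.1 ∈ bpSpan :=
  mem_bpSpan_of_forall_nat fun n => by exact_mod_cast mem_intValued.mp q.2 n

theorem exists_eq_add_nsmul_of_modEq {p : ℕ} (hp : p ≠ 0) {q r : intValued}
    (h : ∀ n : ℕ, evalInt n q ≡ evalInt n r [ZMOD p]) : ∃ t : intValued, q = r + p • t := by
  have hp' : (p : ℂ) ≠ 0 := Nat.cast_ne_zero.mpr hp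
  have h_mem : (p : ℂ)⁻¹ • (q - r).1 ∈ bpSpan := by
    refine mem_bpSpan_of_forall_nat fun n => ?_
    obtain ⟨z, hz⟩ := (h n).symm.dvd
    refine ⟨z, ?_⟩
    have h_eval := intCast_evalInt n (q - r)
    rw [map_sub, hz, Int.cast_mul, Int.cast_natCast, Int.cast_natCast] at h_eval
    rw [Polynomial.eval_smul, ← h_eval, smul_eq_mul, inv_mul_cancel_left₀ hp']
  refine ⟨⟨_, bpSpan_le_intValued h_mem⟩, sub_eq_iff_eq_add'.mp (Subtype.ext ?_)⟩
  change (q - r).1 = p • ((p : ℂ)⁻¹ • (q - r).1)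
  rw [← Nat.cast_smul_eq_nsmul ℂ, smul_inv_smul₀ hp']

theorem evalInt_modEq_of_forall_nat {p : ℕ} (hp : p ≠ 0) {q r : intValued}
    (h : ∀ n : ℕ, evalInt n q ≡ evalInt n r [ZMOD p]) (n : ℤ) :
    evalInt n q ≡ evalInt n r [ZMOD p] := by
  obtain ⟨t, rfl⟩ := exists_eq_add_nsmul_of_modEq hp h
  simp [nsmul_eq_mul, Int.ModEq]

theorem choose_modEq_choose_mul_choose {p : ℕ} [hp : Fact p.Prime] (N : ℤ) {a b : ℕ} (ha : a < p)
    (hb : b < p) (i : ℕ) :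
    Ring.choose ((p : ℤ) * N + a) (p * i + b) ≡ Ring.choose N i * (a.choose b : ℤ) [ZMOD p] := by
  have h_nat (n : ℕ) : evalInt n (affineComp p a (binom 0 (p * i + b))) ≡
      evalInt n (binom 0 i * (a.choose b : ℤ)) [ZMOD p] := by
    have h_lucas := Choose.choose_modEq_choose_mod_mul_choose_div (p := p) (n := p * n + a)
      (k := p * i + b)
    rw [Nat.mul_add_mod, Nat.mul_add_mod, Nat.mod_eq_of_lt ha, Nat.mod_eq_of_lt hb,
      Nat.mul_add_div hp.out.pos, Nat.mul_add_div hp.out.pos, Nat.div_eq_of_lt ha,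
      Nat.div_eq_of_lt hb, add_zero, add_zero] at h_lucas
    have h_cast : (p : ℤ) * n + a = ((p * n + a : ℕ) : ℤ) := by push_cast; ring
    simpa only [map_mul, evalInt_affineComp, evalInt_binom, map_intCast, Int.cast_id, add_zero,
      h_cast, Ring.choose_natCast, mul_comm] using h_lucas
  simpa only [map_mul, evalInt_affineComp, evalInt_binom, map_intCast, Int.cast_id, add_zero] using
    evalInt_modEq_of_forall_nat hp.out.ne_zero h_nat N

/-! ### Divided power triples -/

/-- A system of divided powers `X^(m)`, `Y^(m)` and integer-valued polynomials in `H` of a ring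
which satisfies the commutation rules of the hyperalgebra of `SL₂`. Here `h q` stands for `q(H)`.
Both rules relating `X` and `Y` are included so that `X` and `Y` can be exchanged. -/
structure DividedPowerTriple (A : Type*) [Ring A] where
  /-- The divided powers of `X`. -/
  X : ℕ → A
  /-- The divided powers of `Y`. -/
  Y : ℕ → A
  /-- The integer-valued polynomials in `H`. -/
  h : intValued →+* A
  X_zero : X 0 = 1
  Y_zero : Y 0 = 1
  X_mul_X : ∀ a b, X a * X b = (a + b).choose a • X (a + b)
  Y_mul_Y : ∀ a b, Y a * Y b = (a + b).choose a • Y (a + b)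
  X_mul_h : ∀ a q, X a * h q = h (affineComp 1 (-2 * a) q) * X a
  Y_mul_h : ∀ a q, Y a * h q = h (affineComp 1 (2 * a) q) * Y a
  X_mul_Y : ∀ a b, X a * Y b = ∑ i ∈ Finset.range (min a b + 1),
    Y (b - i) * h (binom (2 * i - a - b) i) * X (a - i)
  Y_mul_X : ∀ a b, Y a * X b = ∑ i ∈ Finset.range (min a b + 1),
    X (b - i) * h (affineComp (-1) 0 (binom (2 * i - a - b) i)) * Y (a - i)

namespace DividedPowerTriple

variable {A B : Type*} [Ring A] [Ring B]

/-- The triple with the roles of `X` and `Y` exchanged and `H` replaced by `-H`. -/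
def swap (T : DividedPowerTriple A) : DividedPowerTriple A where
  X := T.Y
  Y := T.X
  h := T.h.comp (affineComp (-1) 0)
  X_zero := T.Y_zero
  Y_zero := T.X_zero
  X_mul_X := T.Y_mul_Y
  Y_mul_Y := T.X_mul_X
  X_mul_h a q := by simp [T.Y_mul_h, affineComp_affineComp]
  Y_mul_h a q := by simp [T.X_mul_h, affineComp_affineComp]
  X_mul_Y := T.Y_mul_X
  Y_mul_X a b := by
    simp [T.X_mul_Y, affineComp_affineComp, affineComp_one_zero]

/-- The image of a triple under a ring homomorphism. -/
def map (T : DividedPowerTriple A) (f : A →+* B) : DividedPowerTriple B where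
  X m := f (T.X m)
  Y m := f (T.Y m)
  h := f.comp T.h
  X_zero := by rw [T.X_zero, map_one]
  Y_zero := by rw [T.Y_zero, map_one]
  X_mul_X a b := by rw [← map_mul, T.X_mul_X, map_nsmul]
  Y_mul_Y a b := by rw [← map_mul, T.Y_mul_Y, map_nsmul]
  X_mul_h a q := by simp only [RingHom.comp_apply, ← map_mul, T.X_mul_h]
  Y_mul_h a q := by simp only [RingHom.comp_apply, ← map_mul, T.Y_mul_h]
  X_mul_Y a b := by simp only [RingHom.comp_apply, ← map_mul, T.X_mul_Y, map_sum]
  Y_mul_X a b := by simp only [RingHom.comp_apply, ← map_mul, T.Y_mul_X, map_sum]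

/-- A triple contained in a subring, as a triple of that subring. -/
def codRestrict (T : DividedPowerTriple A) (S : Subring A) (hX : ∀ m, T.X m ∈ S)
    (hY : ∀ m, T.Y m ∈ S) (hh : ∀ q, T.h q ∈ S) : DividedPowerTriple S where
  X m := ⟨T.X m, hX m⟩
  Y m := ⟨T.Y m, hY m⟩
  h := T.h.codRestrict S hh
  X_zero := Subtype.ext T.X_zero
  Y_zero := Subtype.ext T.Y_zero
  X_mul_X a b := Subtype.ext (T.X_mul_X a b)
  Y_mul_Y a b := Subtype.ext (T.Y_mul_Y a b)
  X_mul_h a q := Subtype.ext (T.X_mul_h a q)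
  Y_mul_h a q := Subtype.ext (T.Y_mul_h a q)
  X_mul_Y a b := Subtype.ext <| by
    rw [AddSubmonoidClass.coe_finsetSum]
    exact T.X_mul_Y a b
  Y_mul_X a b := Subtype.ext <| by
    rw [AddSubmonoidClass.coe_finsetSum]
    exact T.Y_mul_X a b

end DividedPowerTriple

/-! ### The triple of the hyperalgebra -/

theorem hp_mul_YC_pow (a : ℕ) (q : ℂ[X]) :
    hp q * YC ^ a = YC ^ a * hp (q.comp (Polynomial.X + ((-2 * a : ℤ) : ℂ[X]))) := by
  induction a with
  | zero => simp
  | succ a ih =>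
    rw [pow_succ, ← mul_assoc, ih, mul_assoc, hp_mul_YC, mul_assoc, Polynomial.comp_assoc]
    rw [Polynomial.add_comp, Polynomial.X_comp, Polynomial.intCast_comp]
    congr 4
    push_cast
    ring

theorem dividedPower_YC_mul_hp (a : ℕ) (q : ℂ[X]) :
    dividedPower YC a * hp q =
      hp (q.comp (Polynomial.X + ((2 * a : ℤ) : ℂ[X]))) * dividedPower YC a := by
  rw [dividedPower, mul_smul_comm, hp_mul_YC_pow, smul_mul_assoc, Polynomial.comp_assoc]
  congr 3
  simp

theorem dividedPower_XC_mul_dividedPower_YC (a b : ℕ) :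
    dividedPower XC a * dividedPower YC b = ∑ i ∈ Finset.range (min a b + 1),
      dividedPower YC (b - i) * hp (bp (2 * i - a - b) i) * dividedPower XC (a - i) := by
  rw [← dpz_natCast YC, XC_mul_dividedPower_mul,
    ← Finset.sum_subset (Finset.range_mono (by omega : min a b + 1 ≤ a + 1))]
  · refine Finset.sum_congr rfl fun i hi => ?_
    have hi' : i ≤ a ∧ i ≤ b := by simp only [Finset.mem_range] at hi; omega
    rw [← dpz_natCast, ← dpz_natCast, Nat.cast_sub hi'.1, Nat.cast_sub hi'.2]
  · intro i hi hi'
    simp only [Finset.mem_range] at hi hi'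
    rw [dpz_neg _ (by omega : (b : ℤ) - i < 0), zero_mul, zero_mul]

section Swap

attribute [local instance] LieRing.ofAssociativeRing

/-- The Lie algebra homomorphism `X ↦ Y`, `Y ↦ X`, `H ↦ -H`. -/
def swapLie : LieAlgebra.SpecialLinear.sl (Fin 2) ℂ →ₗ⁅ℂ⁆ UC where
  toFun A := A.1 0 1 • YC + A.1 1 0 • XC - A.1 0 0 • HC
  map_add' A B := by
    change (A.1 0 1 + B.1 0 1) • YC + (A.1 1 0 + B.1 1 0) • XC - (A.1 0 0 + B.1 0 0) • HC = _
    module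
  map_smul' c A := by simp [mul_smul, smul_sub]
  map_lie' := by
    intro A B
    have trace_eq_zero (A : LieAlgebra.SpecialLinear.sl (Fin 2) ℂ) : A.1 1 1 = -A.1 0 0 := by
      have h : Matrix.trace A.1 = 0 := A.2
      rw [Matrix.trace_fin_two] at h
      linear_combination h
    have hHX : HC * XC = XC * HC + (2 : ℂ) • XC := by
      rw [XC_mul_HC, sub_mul, two_smul, two_mul]; abel
    have hHY : HC * YC = YC * HC + (-2 : ℂ) • YC := by
      rw [HC_mul_YC, mul_sub, neg_smul, two_smul, mul_two]; abel
    simp only [LieAlgebra.SpecialLinear.sl_bracket, LieRing.of_associative_ring_bracket,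
      Matrix.sub_apply, Matrix.mul_apply, Fin.sum_univ_two, trace_eq_zero, add_mul, mul_add,
      sub_mul, mul_sub, smul_mul_smul_comm, XC_mul_YC, hHX, hHY, smul_add, smul_smul]
    module

/-- The involution `X ↦ Y`, `Y ↦ X`, `H ↦ -H` of the enveloping algebra. -/
def swapUC : UC →ₐ[ℂ] UC := UniversalEnvelopingAlgebra.lift ℂ swapLie

theorem swapUC_ι (A : LieAlgebra.SpecialLinear.sl (Fin 2) ℂ) :
    swapUC (UniversalEnvelopingAlgebra.ι ℂ A) = A.1 0 1 • YC + A.1 1 0 • XC - A.1 0 0 • HC :=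
  UniversalEnvelopingAlgebra.lift_ι_apply ..

end Swap

theorem swapUC_XC : swapUC XC = YC := (swapUC_ι slX).trans (by simp [slX])

theorem swapUC_YC : swapUC YC = XC := (swapUC_ι slY).trans (by simp [slY])

theorem swapUC_HC : swapUC HC = -HC := (swapUC_ι slH).trans (by simp [slH])

theorem swapUC_dividedPower_XC (n : ℕ) : swapUC (dividedPower XC n) = dividedPower YC n := by
  simp [dividedPower, swapUC_XC]

theorem swapUC_dividedPower_YC (n : ℕ) : swapUC (dividedPower YC n) = dividedPower XC n := by
  simp [dividedPower, swapUC_YC]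

theorem swapUC_hp (q : ℂ[X]) : swapUC (hp q) = hp (q.comp (-Polynomial.X)) := by
  rw [hp, hp, ← Polynomial.aeval_algHom_apply, swapUC_HC, Polynomial.aeval_comp, map_neg,
    Polynomial.aeval_X]

/-- The divided power triple of the enveloping algebra of `𝔰𝔩₂(ℂ)`. -/
def tripleUC : DividedPowerTriple UC where
  X := dividedPower XC
  Y := dividedPower YC
  h := (Polynomial.aeval HC : ℂ[X] →ₐ[ℂ] UC).toRingHom.comp intValued.subtype
  X_zero := by simp [dividedPower]
  Y_zero := by simp [dividedPower]
  X_mul_X a b := by rw [dividedPower_mul, Nat.cast_smul_eq_nsmul]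
  Y_mul_Y a b := by rw [dividedPower_mul, Nat.cast_smul_eq_nsmul]
  X_mul_h a q := by
    refine (dividedPower_XC_mul_hp a q.1).trans ?_
    simp [coe_affineComp, hp]
  Y_mul_h a q := by
    refine (dividedPower_YC_mul_hp a q.1).trans ?_
    simp [coe_affineComp, hp]
  X_mul_Y := dividedPower_XC_mul_dividedPower_YC
  Y_mul_X a b := by
    have h := congrArg swapUC (dividedPower_XC_mul_dividedPower_YC a b)
    simp only [map_sum, map_mul, swapUC_dividedPower_XC, swapUC_dividedPower_YC, swapUC_hp] at h
    rw [h]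
    simp [coe_affineComp, hp, binom]

theorem hp_mem_UZ (q : intValued) : hp q.1 ∈ UZ := by
  have h_le : bpSpan.map (Polynomial.aeval HC : ℂ[X] →ₐ[ℂ] UC).toRingHom.toIntAlgHom.toLinearMap ≤
      AddSubgroup.toIntSubmodule UZ.toAddSubgroup := by
    rw [bpSpan, Submodule.map_span_le]
    rintro _ ⟨m, rfl⟩
    exact hp_bp_zero_mem m
  exact h_le (Submodule.mem_map_of_mem (mem_bpSpan_of_intValued q))

/-- The divided power triple of the hyperalgebra. -/
def tripleU (k : Type*) [Field k] : DividedPowerTriple (U k) :=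
  (tripleUC.codRestrict UZ dividedPower_XC_mem dividedPower_YC_mem hp_mem_UZ).map
    (Algebra.TensorProduct.includeRight : UZ →ₐ[ℤ] U k).toRingHom

theorem Hd_eq_tripleU_h (k : Type*) [Field k] (c : ℤ) (m : ℕ) :
    Hd k c m = (tripleU k).h (binom c m) :=
  congrArg (fun x => (1 : k) ⊗ₜ[ℤ] x)
    (Subtype.ext (hp_bp c m).symm : HZ c m = ⟨hp (binom c m).1, hp_mem_UZ _⟩)

/-! ### Weights modulo `p` and Frobenius multiples -/

theorem exists_eq_mul_add_natCast {p : ℕ} (hp : 0 < p) (n : ℤ) :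
    ∃ (N : ℤ) (r : ℕ), r < p ∧ n = p * N + r := by
  have hp' : (0 : ℤ) < p := mod_cast hp
  obtain ⟨r, hr⟩ := Int.eq_ofNat_of_zero_le (Int.emod_nonneg n hp'.ne')
  have h_lt := Int.emod_lt_of_pos n hp'
  exact ⟨n / p, r, by omega, by rw [← hr, Int.mul_ediv_add_emod]⟩

theorem sum_range_mul_add_one {M : Type*} [AddCommMonoid M] (f : ℕ → M) {p : ℕ} (hp : 0 < p)
    (n : ℕ) : ∑ i ∈ Finset.range (p * n + 1), f i = ∑ i ∈ Finset.range (n + 1), f (p * i) +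
      ∑ i ∈ Finset.range n, ∑ j ∈ Finset.Ico 1 p, f (p * i + j) := by
  induction n with
  | zero => simp
  | succ n ih =>
    have h_block : ∑ j ∈ Finset.range p, f (p * n + 1 + j) =
        ∑ j ∈ Finset.Ico 1 p, f (p * n + j) + f (p * (n + 1)) := by
      rw [mul_add_one, ← Finset.sum_Ico_succ_top hp, Finset.sum_Ico_eq_sum_range,
        Nat.add_sub_cancel]
      simp only [add_assoc]
    rw [mul_add_one, add_right_comm, Finset.sum_range_add, ih, h_block,
      Finset.sum_range_succ _ (n + 1),
      Finset.sum_range_succ (fun i => ∑ j ∈ Finset.Ico 1 p, f (p * i + j)) n]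
    abel

section Weights

variable (p : ℕ)

/-- The integer-valued polynomial which is modulo `p` the indicator function of `a + pℤ`. -/
def weightPoly (a : ℤ) : intValued := binom (-a - 1) (p - 1)

theorem evalInt_weightPoly [hp : Fact p.Prime] (n a : ℤ) :
    evalInt n (weightPoly p a) ≡ if (p : ℤ) ∣ n - a then 1 else 0 [ZMOD p] := by
  have hp_pos := hp.out.pos
  obtain ⟨N, r, hr, h_eq⟩ := exists_eq_mul_add_natCast hp_pos (n + (-a - 1))
  have h_dvd : (p : ℤ) ∣ n - a ↔ r = p - 1 := by
    rw [show n - a = p * N + (r + 1 : ℕ) by push_cast; linear_combination h_eq,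
      dvd_add_right (dvd_mul_right _ _), Int.natCast_dvd_natCast]
    exact ⟨fun h => by have := Nat.le_of_dvd r.succ_pos h; omega, fun h => by
      rw [h, Nat.sub_add_cancel hp_pos]⟩
  have h_choose : r.choose (p - 1) = if r = p - 1 then 1 else 0 := by
    split_ifs with h
    · rw [h, Nat.choose_self]
    · exact Nat.choose_eq_zero_of_lt (by omega)
  have h_lucas := choose_modEq_choose_mul_choose N hr (Nat.sub_one_lt hp_pos.ne') 0
  rw [weightPoly, evalInt_binom, h_eq]
  simpa [h_choose, h_dvd] using h_lucas

end Weights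

theorem nsmul_eq_nsmul_of_modEq {A : Type*} [Ring A] {p : ℕ} [Algebra (ZMod p) A] {m n : ℕ}
    (h : m ≡ n [MOD p]) (x : A) : m • x = n • x := by
  rw [← Nat.cast_smul_eq_nsmul (ZMod p), (ZMod.natCast_eq_natCast_iff _ _ _).mpr h,
    Nat.cast_smul_eq_nsmul]

theorem choose_mul_add_modEq {p : ℕ} [Fact p.Prime] (N : ℕ) {a b : ℕ} (ha : a < p)
    (hb : b < p) (i : ℕ) :
    (p * N + a).choose (p * i + b) ≡ N.choose i * a.choose b [MOD p] := by
  have h_lucas := choose_modEq_choose_mul_choose N ha hb i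
  rw [← Int.natCast_modEq_iff]
  have h_cast : (p : ℤ) * N + a = ((p * N + a : ℕ) : ℤ) := by push_cast; rfl
  rwa [h_cast, Ring.choose_natCast, Ring.choose_natCast, ← Nat.cast_mul] at h_lucas

namespace DividedPowerTriple

section CharFree

variable {A : Type*} [Ring A] (T : DividedPowerTriple A)

theorem X_commute (a b : ℕ) : Commute (T.X a) (T.X b) := by
  rw [commute_iff_eq, T.X_mul_X, T.X_mul_X, add_comm b a, Nat.choose_symm_add]

theorem Y_commute (a b : ℕ) : Commute (T.Y a) (T.Y b) := T.swap.X_commute a b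

theorem X_one_pow (m : ℕ) : T.X 1 ^ m = m ! • T.X m := by
  induction m with
  | zero => simp [T.X_zero]
  | succ m ih =>
    rw [pow_succ, ih, smul_mul_assoc, T.X_mul_X, smul_smul, Nat.factorial_succ,
      Nat.choose_succ_self_right, mul_comm]

theorem Y_one_pow (m : ℕ) : T.Y 1 ^ m = m ! • T.Y m := T.swap.X_one_pow m

theorem YX_commute_h (m : ℕ) (q : intValued) : Commute (T.Y m * T.X m) (T.h q) := by
  rw [commute_iff_eq, mul_assoc, T.X_mul_h, ← mul_assoc, T.Y_mul_h, affineComp_affineComp,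
    show (1 * (2 * m) + -2 * m : ℤ) = 0 by ring, mul_one, affineComp_one_zero, mul_assoc]

theorem X_one_mul_Y_one : T.X 1 * T.Y 1 = T.Y 1 * T.X 1 + T.h (binom 0 1) := by
  rw [T.X_mul_Y]
  simp [Finset.sum_range_succ, T.X_zero, T.Y_zero, binom_zero_right]

theorem X_mul_YX_one (m : ℕ) : T.X m * (T.Y 1 * T.X 1) =
    T.Y 1 * T.X 1 * T.X m + m • (T.h (binom (1 - m) 1) * T.X m) := by
  cases m with
  | zero => simp [T.X_zero]
  | succ m =>
    have h_comm : T.X (m + 1) * T.Y 1 = T.Y 1 * T.X (m + 1) + T.h (binom (-m) 1) * T.X m := by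
      rw [T.X_mul_Y]
      simp [Finset.sum_range_succ, T.Y_zero, binom_zero_right,
        show (2 - (m + 1) - 1 : ℤ) = -m by ring]
    rw [← mul_assoc, h_comm, add_mul, mul_assoc, (T.X_commute _ 1).eq, ← mul_assoc,
      mul_assoc (T.h _), T.X_mul_X, Nat.choose_succ_self_right, mul_smul_comm]
    simp

theorem Y_mul_X_mul_YX_one (m : ℕ) : T.Y m * T.X m * (T.Y 1 * T.X 1) =
    ((m + 1) ^ 2) • (T.Y (m + 1) * T.X (m + 1)) +
      m • (T.h (binom (m + 1) 1) * (T.Y m * T.X m)) := by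
  calc T.Y m * T.X m * (T.Y 1 * T.X 1)
      = T.Y m * T.Y 1 * (T.X m * T.X 1) + m • (T.Y m * T.h (binom (1 - m) 1) * T.X m) := by
        rw [mul_assoc, T.X_mul_YX_one, mul_add, mul_smul_comm, (T.X_commute m 1).eq]
        simp only [mul_assoc]
    _ = _ := by
      rw [T.Y_mul_Y, T.X_mul_X, Nat.choose_succ_self_right, smul_mul_smul_comm, ← sq, T.Y_mul_h,
        affineComp_one_binom, mul_assoc, show (1 - m + 2 * m : ℤ) = m + 1 by ring]

theorem Y_pow_mul_X_pow_succ (m : ℕ) : T.Y 1 ^ (m + 1) * T.X 1 ^ (m + 1) =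
    T.Y 1 ^ m * T.X 1 ^ m * (T.Y 1 * T.X 1 - m • T.h (binom (m + 1) 1)) := by
  have h_split : (m ! * m !) • (((m + 1) ^ 2) • (T.Y (m + 1) * T.X (m + 1))) =
      (m ! * m !) • (T.Y m * T.X m * (T.Y 1 * T.X 1 - m • T.h (binom (m + 1) 1))) := by
    rw [mul_sub, T.Y_mul_X_mul_YX_one, mul_smul_comm, (T.YX_commute_h m _).eq,
      add_sub_cancel_right]
  rw [T.Y_one_pow, T.X_one_pow, T.Y_one_pow, T.X_one_pow, smul_mul_smul_comm, smul_mul_smul_comm,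
    smul_mul_assoc, ← h_split, smul_smul, Nat.factorial_succ]
  congr 1
  ring

theorem commute_YX_pow {z : A} (h_YX : Commute (T.Y 1 * T.X 1) z)
    (h_h : ∀ c, Commute (T.h (binom c 1)) z) (m : ℕ) : Commute (T.Y 1 ^ m * T.X 1 ^ m) z := by
  induction m with
  | zero => simp
  | succ m ih =>
    rw [T.Y_pow_mul_X_pow_succ]
    exact ih.mul_left (h_YX.sub_left ((h_h _).smul_left _))

/-- The idempotent projecting to the weights congruent to `a` modulo `p`. -/
def mu (p : ℕ) (a : ℤ) : A := T.h (weightPoly p a)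

/-- The element `∑_{0 < i < p} (a choose i) Y^(p - i) X^(p - i)` of weight zero. It collects the
terms of `X^(pb) Y^(pc)` with lower indices prime to `p`. -/
def carry (p a : ℕ) : A :=
  ∑ i ∈ Finset.Ico 1 p, a.choose i • (T.Y (p - i) * T.X (p - i))

theorem X_mul_mu (p m : ℕ) (a : ℤ) : T.X m * T.mu p a = T.mu p (a + 2 * m) * T.X m := by
  rw [mu, T.X_mul_h, weightPoly, affineComp_one_binom, mu, weightPoly]
  congr 3
  ring

theorem Y_mul_mu (p m : ℕ) (a : ℤ) : T.Y m * T.mu p a = T.mu p (a - 2 * m) * T.Y m := by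
  rw [mu, T.Y_mul_h, weightPoly, affineComp_one_binom, mu, weightPoly]
  congr 3
  ring

theorem h_commute_mu (p : ℕ) (q : intValued) (a : ℤ) : Commute (T.h q) (T.mu p a) :=
  (Commute.all q (weightPoly p a)).map T.h

theorem YX_commute_mu (m p : ℕ) (a : ℤ) : Commute (T.Y m * T.X m) (T.mu p a) :=
  T.YX_commute_h m _

end CharFree

section CharP

variable {A : Type*} [Ring A] (T : DividedPowerTriple A)
variable (p : ℕ) [Algebra (ZMod p) A]

theorem YX_one_commute_X_mul (b : ℕ) : Commute (T.Y 1 * T.X 1) (T.X (p * b)) := by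
  have h_zero : p * b ≡ 0 [MOD p] := (Nat.modEq_zero_iff_dvd).mpr (dvd_mul_right p b)
  rw [commute_iff_eq, T.X_mul_YX_one, nsmul_eq_nsmul_of_modEq h_zero, zero_smul, add_zero]

variable [hp : Fact p.Prime]

theorem h_congr {q r : intValued} (h : ∀ n : ℤ, evalInt n q ≡ evalInt n r [ZMOD p]) :
    T.h q = T.h r := by
  obtain ⟨t, rfl⟩ := exists_eq_add_nsmul_of_modEq hp.out.ne_zero fun n => h n
  have h_zero : p • T.h t = 0 := by
    rw [← Nat.cast_smul_eq_nsmul (ZMod p), CharP.cast_eq_zero, zero_smul]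
  rw [map_add, map_nsmul, h_zero, add_zero]

theorem h_mul_mu_congr {a : ℤ} {q r : intValued}
    (h : ∀ n : ℤ, (p : ℤ) ∣ n - a → evalInt n q ≡ evalInt n r [ZMOD p]) :
    T.h q * T.mu p a = T.h r * T.mu p a := by
  rw [mu, ← map_mul, ← map_mul]
  refine T.h_congr p fun n => ?_
  have h_weight := evalInt_weightPoly p n a
  rw [map_mul, map_mul]
  refine (h_weight.mul_left _).trans (Int.ModEq.trans ?_ (h_weight.mul_left _).symm)
  split_ifs with hn
  · exact (h n hn).mul_right _
  · simp only [mul_zero, Int.ModEq.refl]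

theorem mu_congr {a b : ℤ} (h : (p : ℤ) ∣ a - b) : T.mu p a = T.mu p b := by
  refine T.h_congr p fun n => ?_
  have h_iff : (p : ℤ) ∣ n - a ↔ (p : ℤ) ∣ n - b := by
    rw [← sub_add_sub_cancel n a b, dvd_add_left h]
  refine (evalInt_weightPoly p n a).trans ?_
  simp only [h_iff]
  exact (evalInt_weightPoly p n b).symm

theorem mu_mul_mu (a : ℤ) : T.mu p a * T.mu p a = T.mu p a := by
  have h_one := T.h_mul_mu_congr p (a := a) (q := weightPoly p a) (r := 1) fun n hn => by
    simpa [hn] using evalInt_weightPoly p n a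
  rwa [map_one, one_mul] at h_one

theorem X_mul_mu_commute (b : ℕ) (a : ℤ) : Commute (T.X (p * b)) (T.mu p a) := by
  rw [commute_iff_eq, T.X_mul_mu, T.mu_congr p (b := a) ⟨2 * b, by push_cast; ring⟩]

theorem Y_mul_mu_commute (b : ℕ) (a : ℤ) : Commute (T.Y (p * b)) (T.mu p a) := by
  rw [commute_iff_eq, T.Y_mul_mu, T.mu_congr p (b := a) ⟨-(2 * b), by push_cast; ring⟩]

theorem X_mul_add (b : ℕ) {m : ℕ} (hm : m < p) : T.X (p * b + m) = T.X m * T.X (p * b) := by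
  have h_one : (p * b + m).choose m ≡ 1 [MOD p] := by
    simpa using choose_mul_add_modEq b hm hm 0
  rw [T.X_mul_X, add_comm m, nsmul_eq_nsmul_of_modEq h_one, one_smul]

theorem Y_mul_add (b : ℕ) {m : ℕ} (hm : m < p) : T.Y (p * b + m) = T.Y m * T.Y (p * b) :=
  T.swap.X_mul_add p b hm

theorem X_mul_mul_X_mul (a b : ℕ) :
    T.X (p * a) * T.X (p * b) = (a + b).choose a • T.X (p * (a + b)) := by
  have h_lucas : (p * (a + b)).choose (p * a) ≡ (a + b).choose a [MOD p] := by
    simpa using choose_mul_add_modEq (a + b) hp.out.pos hp.out.pos a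
  rw [T.X_mul_X, ← mul_add, nsmul_eq_nsmul_of_modEq h_lucas]

theorem Y_mul_mul_Y_mul (a b : ℕ) :
    T.Y (p * a) * T.Y (p * b) = (a + b).choose a • T.Y (p * (a + b)) :=
  T.swap.X_mul_mul_X_mul p a b

theorem h_one_commute_X_mul (c : ℤ) (b : ℕ) : Commute (T.h (binom c 1)) (T.X (p * b)) := by
  rw [commute_iff_eq, T.X_mul_h, affineComp_one_binom]
  congr 1
  refine T.h_congr p fun n => ?_
  simp only [evalInt_binom, Ring.choose_one_right]
  exact Int.modEq_iff_dvd.mpr ⟨-2 * b, by push_cast; ring⟩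

theorem h_one_commute_Y_mul (c : ℤ) (b : ℕ) : Commute (T.h (binom c 1)) (T.Y (p * b)) := by
  rw [commute_iff_eq, T.Y_mul_h, affineComp_one_binom]
  congr 1
  refine T.h_congr p fun n => ?_
  simp only [evalInt_binom, Ring.choose_one_right]
  exact Int.modEq_iff_dvd.mpr ⟨2 * b, by push_cast; ring⟩

theorem YX_one_commute_Y_mul (b : ℕ) : Commute (T.Y 1 * T.X 1) (T.Y (p * b)) := by
  have h_swap : Commute (T.X 1 * T.Y 1) (T.Y (p * b)) := T.swap.YX_one_commute_X_mul p b
  rw [eq_sub_of_add_eq T.X_one_mul_Y_one.symm]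
  exact h_swap.sub_left (T.h_one_commute_Y_mul p 0 b)

variable {p}

theorem h_mul_congr {a : ℤ} {q r : intValued} {B : A} (hB : T.mu p a * B = B)
    (h : ∀ n : ℤ, (p : ℤ) ∣ n - a → evalInt n q ≡ evalInt n r [ZMOD p]) :
    T.h q * B = T.h r * B := by
  rw [← hB, ← mul_assoc, T.h_mul_mu_congr p h, mul_assoc]

theorem Y_mul_X_eq_smul_pow {m : ℕ} (hm : m < p) :
    T.Y m * T.X m = ((m ! : ZMod p)⁻¹ ^ 2) • (T.Y 1 ^ m * T.X 1 ^ m) := by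
  have h_ne : (m ! : ZMod p) ≠ 0 := by
    rw [Ne, CharP.cast_eq_zero_iff (ZMod p) p, hp.out.dvd_factorial]
    omega
  rw [T.Y_one_pow, T.X_one_pow, smul_mul_smul_comm, ← Nat.cast_smul_eq_nsmul (ZMod p), smul_smul,
    Nat.cast_mul, ← sq, ← mul_pow, inv_mul_cancel₀ h_ne, one_pow, one_smul]

theorem YX_commute_X_mul {m : ℕ} (hm : m < p) (b : ℕ) :
    Commute (T.Y m * T.X m) (T.X (p * b)) := by
  rw [T.Y_mul_X_eq_smul_pow hm]
  exact (T.commute_YX_pow (T.YX_one_commute_X_mul p b)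
    (fun c => T.h_one_commute_X_mul p c b) m).smul_left _

end CharP

end DividedPowerTriple

/-! ### The commutation formula for Frobenius multiples -/

namespace DividedPowerTriple

variable {A : Type*} [Ring A] (T : DividedPowerTriple A)
variable {p : ℕ} [hp : Fact p.Prime] [Algebra (ZMod p) A]

theorem Y_mul_h_mul_X_mul {a : ℕ} (ha : a < p) {B : A} (hB : T.mu p a * B = B) (D : ℤ) (i : ℕ)
    {j : ℕ} (hj : j < p) :
    T.Y (p - j) * T.h (binom (p * D + 2 * j) (p * i + j)) * (T.X (p - j) * B) =
      a.choose j • (T.h (binom (p * (D + 2)) (p * i)) * (T.Y (p - j) * T.X (p - j) * B)) := by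
  have h_weight : T.mu p a * (T.Y (p - j) * T.X (p - j) * B) = T.Y (p - j) * T.X (p - j) * B := by
    rw [← mul_assoc, ← (T.YX_commute_mu _ p a).eq, mul_assoc, hB]
  have h_lucas := T.h_mul_congr h_weight (q := binom (p * D + 2 * j + 2 * (p - j : ℕ)) (p * i + j))
    (r := a.choose j • binom (p * (D + 2)) (p * i)) fun n hn => by
      obtain ⟨N, hN⟩ := hn
      have h_left : n + (p * D + 2 * j + 2 * (p - j : ℕ)) = p * (N + D + 2) + a := by
        push_cast [hj.le]; linear_combination hN
      have h_right : n + p * (D + 2) = p * (N + D + 2) + a := by linear_combination hN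
      rw [map_nsmul, evalInt_binom, evalInt_binom, h_left, h_right, nsmul_eq_mul,
        mul_comm (a.choose j : ℤ)]
      refine (choose_modEq_choose_mul_choose _ ha hj i).trans (Int.ModEq.mul_right _ ?_)
      simpa using (choose_modEq_choose_mul_choose (N + D + 2) ha hp.out.pos i).symm
  rw [T.Y_mul_h, affineComp_one_binom, mul_assoc, ← mul_assoc (T.Y _), h_lucas, map_nsmul,
    smul_mul_assoc]

theorem commutation_term {a : ℕ} (ha : a < p) {B : A} (hB : T.mu p a * B = B) {b c i j : ℕ}
    (hib : i < b) (hic : i < c) (hj_pos : 0 < j) (hj : j < p) :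
    T.Y (p * c - (p * i + j)) * T.h (binom (2 * (p * i + j : ℕ) - (p * b : ℕ) - (p * c : ℕ))
        (p * i + j)) * T.X (p * b - (p * i + j)) * B =
      T.Y (p * (c - i - 1)) * T.h (binom (p * (2 * i + 2 - b - c)) (p * i)) *
        T.X (p * (b - i - 1)) * (a.choose j • (T.Y (p - j) * T.X (p - j)) * B) := by
  obtain ⟨b', rfl⟩ := Nat.exists_eq_add_of_lt hib
  obtain ⟨c', rfl⟩ := Nat.exists_eq_add_of_lt hic
  have h_sub (n : ℕ) : p * (i + n + 1) - (p * i + j) = p * n + (p - j) := by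
    rw [mul_add_one, mul_add]; omega
  have h_binom : (2 * (p * i + j : ℕ) - (p * (i + b' + 1) : ℕ) - (p * (i + c' + 1) : ℕ) : ℤ) =
      p * (-2 - b' - c') + 2 * j := by push_cast; ring
  have hB' : T.mu p a * (T.X (p * b') * B) = T.X (p * b') * B := by
    rw [← mul_assoc, ← (T.X_mul_mu_commute p b' a).eq, mul_assoc, hB]
  have h_comm : Commute (T.Y (p - j) * T.X (p - j)) (T.X (p * b')) :=
    T.YX_commute_X_mul (by omega) b'
  have hj' : p - j < p := by omega
  rw [h_sub, h_sub, h_binom, T.X_mul_add p b' hj', T.Y_mul_add p c' hj',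
    (T.Y_commute (p - j) (p * c')).eq, add_assoc, add_assoc, Nat.add_sub_cancel_left,
    Nat.add_sub_cancel_left, Nat.add_sub_cancel, Nat.add_sub_cancel]
  calc _ = T.Y (p * c') * (T.Y (p - j) * T.h (binom (p * (-2 - b' - c') + 2 * j) (p * i + j)) *
        (T.X (p - j) * (T.X (p * b') * B))) := by simp only [mul_assoc]
    _ = T.Y (p * c') * T.h (binom (p * (-2 - b' - c' + 2)) (p * i)) * T.X (p * b') *
        (a.choose j • (T.Y (p - j) * T.X (p - j)) * B) := by
      rw [T.Y_mul_h_mul_X_mul ha hB' _ i hj, ← mul_assoc (T.Y (p - j) * T.X (p - j)), h_comm.eq]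
      simp only [mul_assoc, smul_mul_assoc, mul_smul_comm]
    _ = _ := by
      congr 5
      push_cast
      ring

theorem X_mul_mul_Y_mul {a : ℕ} (ha : a < p) {B : A} (hB : T.mu p a * B = B) (b c : ℕ) :
    T.X (p * b) * T.Y (p * c) * B = ∑ i ∈ Finset.range (min b c + 1),
        T.Y (p * (c - i)) * T.h (binom (p * (2 * i - b - c)) (p * i)) * T.X (p * (b - i)) * B +
      ∑ i ∈ Finset.range (min b c), T.Y (p * (c - i - 1)) *
        T.h (binom (p * (2 * i + 2 - b - c)) (p * i)) * T.X (p * (b - i - 1)) *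
          (T.carry p a * B) := by
  rw [T.X_mul_Y, Nat.mul_min_mul_left, sum_range_mul_add_one _ hp.out.pos, add_mul,
    Finset.sum_mul, Finset.sum_mul]
  congr 1
  · refine Finset.sum_congr rfl fun i _ => ?_
    rw [Nat.mul_sub, Nat.mul_sub]
    congr 5
    push_cast
    ring
  · refine Finset.sum_congr rfl fun i hi => ?_
    obtain ⟨hib, hic⟩ := lt_min_iff.mp (Finset.mem_range.mp hi)
    rw [carry, Finset.sum_mul, Finset.sum_mul, Finset.mul_sum]
    refine Finset.sum_congr rfl fun j hj => ?_
    obtain ⟨hj_pos, hj⟩ := Finset.mem_Ico.mp hj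
    exact T.commutation_term ha hB hib hic hj_pos hj

theorem h_binom_mul_add (D : ℤ) (i : ℕ) :
    T.h (binom (p * D) (p * (i + 1))) + T.h (binom (p * D) (p * i)) =
      T.h (binom (p * (D + 1)) (p * (i + 1))) := by
  rw [← map_add]
  refine T.h_congr p fun n => ?_
  obtain ⟨N, r, hr, rfl⟩ := exists_eq_mul_add_natCast hp.out.pos n
  have h_lucas (M : ℤ) (m : ℕ) : Ring.choose (p * M + r) (p * m) ≡ Ring.choose M m [ZMOD p] := by
    simpa using choose_modEq_choose_mul_choose M hr hp.out.pos m
  have h_add (M : ℤ) : (p * N + r + p * M : ℤ) = p * (N + M) + r := by ring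
  simp only [map_add, evalInt_binom, h_add]
  refine ((h_lucas _ _).add (h_lucas _ _)).trans ?_
  rw [add_comm, ← Ring.choose_succ_succ, add_assoc]
  exact (h_lucas _ _).symm

theorem X_mul_mul_Y_mul_of_carry {a : ℕ} (ha : a < p) {B : A} (hB : T.mu p a * B = B) {δ : ℕ}
    (hδ : δ ≤ 1) (h_carry : T.carry p a * B = δ • B) (b c : ℕ) :
    T.X (p * b) * T.Y (p * c) * B = ∑ i ∈ Finset.range (min b c + 1),
      T.Y (p * (c - i)) * T.h (binom (p * (2 * i - b - c + δ)) (p * i)) *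
        T.X (p * (b - i)) * B := by
  rw [T.X_mul_mul_Y_mul ha hB, h_carry]
  obtain rfl | rfl : δ = 0 ∨ δ = 1 := by omega
  · simp
  rw [Finset.sum_range_succ', Finset.sum_range_succ', add_right_comm, ← Finset.sum_add_distrib]
  congr 1
  · refine Finset.sum_congr rfl fun i _ => ?_
    have h_cast : (2 * i + 2 : ℤ) = 2 * (i + 1 : ℕ) := by push_cast; ring
    rw [one_smul, Nat.sub_sub, Nat.sub_sub, ← add_mul, ← add_mul, ← mul_add, Nat.cast_one,
      ← T.h_binom_mul_add, h_cast]
  · simp [binom_zero_right]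

end DividedPowerTriple

/-! ### Polynomials in `YX` on a weight space -/

theorem phi_dvd_phi (p : ℕ) (a : ℤ) {m n : ℕ} (h : m ≤ n) : phi p a m ∣ phi p a n :=
  Finset.prod_dvd_prod_of_subset _ _ _ (Finset.range_mono h)

namespace DividedPowerTriple

variable {A : Type*} [Ring A] (T : DividedPowerTriple A) {p : ℕ}

theorem carry_mul_eq_zero {a : ℕ} {B : A}
    (h : ∀ m, p - a ≤ m → m < p → T.Y m * T.X m * B = 0) : T.carry p a * B = 0 := by
  rw [carry, Finset.sum_mul]
  refine Finset.sum_eq_zero fun j hj => ?_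
  obtain ⟨hj_pos, hj⟩ := Finset.mem_Ico.mp hj
  rcases lt_or_ge a j with haj | hja
  · rw [Nat.choose_eq_zero_of_lt haj, zero_smul, zero_mul]
  · rw [smul_mul_assoc, h _ (by omega) (by omega), smul_zero]

variable [Algebra (ZMod p) A]

variable (p) in
/-- Evaluation of polynomials over `𝔽_p` at `YX`. -/
abbrev aevalYX : (ZMod p)[X] →ₐ[ZMod p] A := Polynomial.aeval (T.Y 1 * T.X 1)

theorem aevalYX_commute {z : A} (hz : Commute (T.Y 1 * T.X 1) z) (f : (ZMod p)[X]) :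
    Commute (T.aevalYX p f) z :=
  (Algebra.commute_of_mem_adjoin_singleton_of_commute
    (Polynomial.aeval_mem_adjoin_singleton (ZMod p) _) hz.symm).symm

theorem aevalYX_commute_mu (f : (ZMod p)[X]) (a : ℤ) : Commute (T.aevalYX p f) (T.mu p a) :=
  T.aevalYX_commute (T.YX_commute_mu 1 p a) f

variable [hp : Fact p.Prime]

theorem mu_mul_aevalYX_mul_mu (f : (ZMod p)[X]) (a : ℤ) :
    T.mu p a * (T.aevalYX p f * T.mu p a) = T.aevalYX p f * T.mu p a := by
  rw [← mul_assoc, ← (T.aevalYX_commute_mu f a).eq, mul_assoc, T.mu_mul_mu]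

theorem h_one_mul_mu (a c : ℤ) :
    T.h (binom c 1) * T.mu p a = ((a + c : ℤ) : A) * T.mu p a := by
  rw [← map_intCast T.h]
  refine T.h_mul_mu_congr p fun n hn => ?_
  rw [evalInt_binom, map_intCast, Ring.choose_one_right]
  exact ((Int.modEq_iff_dvd.mpr hn).add_right c).symm

theorem aevalYX_phi_mul_mu (a : ℤ) (m : ℕ) :
    T.aevalYX p (phi p a m) * T.mu p a = T.Y 1 ^ m * T.X 1 ^ m * T.mu p a := by
  induction m with
  | zero => simp [phi]
  | succ m ih =>
    have h_root : algebraMap (ZMod p) A (m * (m + a + 1)) = m * ((a + (m + 1) : ℤ) : A) := by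
      simp only [map_mul, map_add, map_natCast, map_intCast, map_one]
      push_cast
      congr 1
      abel
    have h_factor : T.aevalYX p (Polynomial.X - Polynomial.C ((m : ZMod p) * (m + a + 1))) *
        T.mu p a = (T.Y 1 * T.X 1 - m • T.h (binom (m + 1) 1)) * T.mu p a := by
      rw [map_sub, Polynomial.aeval_X, Polynomial.aeval_C, h_root, sub_mul, sub_mul,
        smul_mul_assoc, T.h_one_mul_mu, nsmul_eq_mul, mul_assoc (m : A)]
    rw [phi, Finset.prod_range_succ, ← phi, map_mul, mul_assoc, (T.aevalYX_commute_mu _ _).eq,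
      ← mul_assoc, ih, mul_assoc, ← (T.aevalYX_commute_mu _ _).eq, h_factor, ← mul_assoc,
      ← T.Y_pow_mul_X_pow_succ]

theorem aevalYX_mul_mu_eq_zero {a : ℤ} {f : (ZMod p)[X]} (hf : phi p a p ∣ f) :
    T.aevalYX p f * T.mu p a = 0 := by
  obtain ⟨g, rfl⟩ := hf
  have h_factorial : p ! ≡ 0 [MOD p] :=
    Nat.modEq_zero_iff_dvd.mpr (hp.out.dvd_factorial.mpr le_rfl)
  rw [mul_comm, map_mul, mul_assoc, T.aevalYX_phi_mul_mu, T.X_one_pow,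
    nsmul_eq_nsmul_of_modEq h_factorial, zero_smul, mul_zero, zero_mul, mul_zero]

theorem aevalYX_mul_mu_congr {a : ℤ} {f g : (ZMod p)[X]} (h : phi p a p ∣ f - g) :
    T.aevalYX p f * T.mu p a = T.aevalYX p g * T.mu p a := by
  rw [← sub_eq_zero, ← sub_mul, ← map_sub]
  exact T.aevalYX_mul_mu_eq_zero h

theorem Y_mul_X_mul_eq_zero {a : ℤ} {f : (ZMod p)[X]} {n : ℕ} (h : phi p a p ∣ phi p a n * f)
    {m : ℕ} (hnm : n ≤ m) (hm : m < p) :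
    T.Y m * T.X m * (T.aevalYX p f * T.mu p a) = 0 := by
  have h_dvd : phi p a p ∣ phi p a m * f := h.trans (mul_dvd_mul_right (phi_dvd_phi p a hnm) f)
  rw [T.Y_mul_X_eq_smul_pow hm, smul_mul_assoc, (T.aevalYX_commute_mu f a).eq, ← mul_assoc,
    ← T.aevalYX_phi_mul_mu, mul_assoc, ← (T.aevalYX_commute_mu f a).eq, ← mul_assoc, ← map_mul,
    T.aevalYX_mul_mu_eq_zero h_dvd, smul_zero]

theorem carry_mul_aevalYX_eq_zero {a : ℕ} {f : (ZMod p)[X]}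
    (h : phi p a p ∣ phi p a (p - a) * f) : T.carry p a * (T.aevalYX p f * T.mu p a) = 0 :=
  T.carry_mul_eq_zero fun _ hm hmp => T.Y_mul_X_mul_eq_zero h hm hmp

theorem X_p_mul_Y_p_mul {a : ℕ} (ha : a < p) {B : A} (hB : T.mu p a * B = B) :
    T.X p * T.Y p * B = T.Y p * T.X p * B + T.h (binom 0 p) * B + T.carry p a * B := by
  have h_comm := T.X_mul_mul_Y_mul ha hB 1 1
  simpa [Finset.sum_range_succ, binom_zero_right, T.X_zero, T.Y_zero] using h_comm

theorem swap_mu {a b : ℤ} (hab : (p : ℤ) ∣ a + b) : T.swap.mu p b = T.mu p a := by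
  refine T.h_congr p fun n => ?_
  have h_iff : (p : ℤ) ∣ -1 * n + 0 - b ↔ (p : ℤ) ∣ n - a := by
    rw [show -1 * n + 0 - b = -(a + b) - (n - a) by ring, dvd_sub_right hab.neg_right]
  rw [evalInt_affineComp]
  refine (evalInt_weightPoly p _ b).trans ?_
  simp only [h_iff]
  exact (evalInt_weightPoly p n a).symm

theorem h_binom_add_swap_h_binom_mul {a : ℕ} (ha_pos : 0 < a) (ha : a < p) {B : A}
    (hB : T.mu p a * B = B) : T.h (binom 0 p) * B + T.swap.h (binom 0 p) * B = -B := by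
  have h_lucas (N : ℤ) {r : ℕ} (hr : r < p) : Ring.choose (p * N + r) p ≡ N [ZMOD p] := by
    simpa using choose_modEq_choose_mul_choose N hr hp.out.pos 1
  have h_sum := T.h_mul_congr hB (q := binom 0 p + affineComp (-1) 0 (binom 0 p)) (r := -1)
    fun n hn => by
      obtain ⟨N, hN⟩ := hn
      have h_left : n + 0 = p * N + a := by linear_combination hN
      have h_right : -1 * n + 0 + 0 = p * (-N - 1) + (p - a : ℕ) := by
        push_cast [ha.le]; linear_combination -hN
      rw [map_add, evalInt_affineComp, evalInt_binom, evalInt_binom, map_neg, map_one, h_left,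
        h_right]
      refine ((h_lucas N ha).add (h_lucas (-N - 1) (by omega))).trans ?_
      rw [show N + (-N - 1) = -1 by ring]
  rw [map_add, add_mul, map_neg, map_one, neg_mul, one_mul] at h_sum
  exact h_sum

theorem carry_add_swap_carry_mul {a : ℕ} (ha_pos : 0 < a) (ha : a < p) {B : A}
    (hB : T.mu p a * B = B) : T.carry p a * B + T.swap.carry p (p - a) * B = B := by
  have hB' : T.swap.mu p (p - a : ℕ) * B = B := by
    rwa [T.swap_mu (a := a) ⟨1, by push_cast [ha.le]; ring⟩]
  have h_XY := T.X_p_mul_Y_p_mul ha hB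
  have h_YX : T.Y p * T.X p * B = T.X p * T.Y p * B + T.swap.h (binom 0 p) * B +
    T.swap.carry p (p - a) * B := T.swap.X_p_mul_Y_p_mul (by omega) hB'
  have h_binom := T.h_binom_add_swap_h_binom_mul ha_pos ha hB
  rw [h_XY] at h_YX
  linear_combination (norm := abel) -h_YX - h_binom

theorem swap_aevalYX_mul_mu (a : ℤ) (f : (ZMod p)[X]) : T.swap.aevalYX p f * T.mu p a =
    T.aevalYX p (f.comp (Polynomial.X + Polynomial.C (a : ZMod p))) * T.mu p a := by
  have h_X : T.X 1 * T.Y 1 * T.mu p a =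
      T.aevalYX p (Polynomial.X + Polynomial.C (a : ZMod p)) * T.mu p a := by
    rw [T.X_one_mul_Y_one, map_add, Polynomial.aeval_X, Polynomial.aeval_C, map_intCast, add_mul,
      add_mul, T.h_one_mul_mu, add_zero]
  induction f using Polynomial.induction_on' with
  | add f g hf hg => rw [map_add, add_mul, hf, hg, Polynomial.add_comp, map_add, add_mul]
  | monomial n c =>
    induction n with
    | zero => simp
    | succ n ih =>
      rw [← Polynomial.monomial_mul_X, map_mul, Polynomial.mul_comp, map_mul, Polynomial.aeval_X,
        Polynomial.X_comp, mul_assoc]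
      change _ * (T.X 1 * T.Y 1 * T.mu p a) = _
      rw [h_X, mul_assoc, (T.aevalYX_commute_mu _ _).eq, ← mul_assoc, ih, mul_assoc]

theorem carry_mul_aevalYX_eq_self {a : ℕ} (ha_pos : 0 < a) (ha : a < p) {f : (ZMod p)[X]}
    (h : phi p a p ∣ (phi p (-a) a).comp (Polynomial.X + Polynomial.C (a : ZMod p)) * f) :
    T.carry p a * (T.aevalYX p f * T.mu p a) = T.aevalYX p f * T.mu p a := by
  have h_split := T.carry_add_swap_carry_mul ha_pos ha (T.mu_mul_aevalYX_mul_mu f a)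
  suffices h_zero : T.swap.carry p (p - a) * (T.aevalYX p f * T.mu p a) = 0 by
    rwa [h_zero, add_zero] at h_split
  refine T.swap.carry_mul_eq_zero fun m hm hmp => ?_
  rw [Nat.sub_sub_self ha.le] at hm
  obtain ⟨g, hg⟩ := phi_dvd_phi p (-a) hm
  have h_mu : T.swap.mu p (-a) = T.mu p a := T.swap_mu (by simp)
  have h_swap := T.swap_aevalYX_mul_mu a (phi p (-a) a * g)
  rw [Int.cast_natCast, ← hg] at h_swap
  rw [T.swap.Y_mul_X_eq_smul_pow hmp, smul_mul_assoc, (T.aevalYX_commute_mu f a).eq, ← h_mu,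
    ← mul_assoc, ← T.swap.aevalYX_phi_mul_mu, h_mu, h_swap, hg, mul_assoc,
    ← (T.aevalYX_commute_mu f a).eq, ← mul_assoc, ← map_mul, Polynomial.mul_comp,
    mul_right_comm, T.aevalYX_mul_mu_eq_zero (h.mul_right _), smul_zero]

end DividedPowerTriple

/-! ### Frobenius maps -/

/-- `r` is, modulo `p`, the composite of `q` with `n ↦ ⌊n / p⌋ + δ`. -/
def FrobeniusRel (p δ : ℕ) (q r : intValued) : Prop :=
  ∀ n : ℤ, evalInt n r ≡ evalInt (n / p + δ) q [ZMOD p]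

namespace FrobeniusRel

variable {p δ : ℕ} {q r q' r' : intValued}

theorem add (h : FrobeniusRel p δ q r) (h' : FrobeniusRel p δ q' r') :
    FrobeniusRel p δ (q + q') (r + r') := fun n => by
  simpa only [map_add] using (h n).add (h' n)

theorem mul (h : FrobeniusRel p δ q r) (h' : FrobeniusRel p δ q' r') :
    FrobeniusRel p δ (q * q') (r * r') := fun n => by
  simpa only [map_mul] using (h n).mul (h' n)

theorem zsmul (h : FrobeniusRel p δ q r) (c : ℤ) : FrobeniusRel p δ (c • q) (c • r) :=
  fun n => by simpa only [map_zsmul, smul_eq_mul] using (h n).mul_left c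

theorem affineComp (hp : p ≠ 0) (h : FrobeniusRel p δ q r) (d : ℤ) :
    FrobeniusRel p δ (affineComp 1 d q) (Hyperalgebra.affineComp 1 (p * d) r) := fun n => by
  rw [evalInt_affineComp, evalInt_affineComp, one_mul, one_mul, add_right_comm,
    ← Int.add_mul_ediv_left n d (Nat.cast_ne_zero.mpr hp)]
  exact h _

end FrobeniusRel

theorem frobeniusRel_binom {p : ℕ} [hp : Fact p.Prime] (δ : ℕ) (C : ℤ) (i : ℕ) :
    FrobeniusRel p δ (binom C i) (binom (p * (C + δ)) (p * i)) := fun n => by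
  obtain ⟨N, r, hr, rfl⟩ := exists_eq_mul_add_natCast hp.out.pos n
  have h_div : (p * N + r : ℤ) / p = N := by
    rw [Int.mul_add_ediv_left _ _ (by exact_mod_cast hp.out.ne_zero),
      Int.ediv_eq_zero_of_lt (by positivity) (by exact_mod_cast hr), add_zero]
  rw [evalInt_binom, evalInt_binom, h_div,
    show (p * N + r + p * (C + δ) : ℤ) = p * (N + δ + C) + r by ring]
  simpa using choose_modEq_choose_mul_choose (N + δ + C) hr hp.out.pos i

namespace DividedPowerTriple

variable {A : Type*} [Ring A]

theorem Y_mul_h_mul_X_mul_h_mul_X (T : DividedPowerTriple A) (m b l : ℕ) (q q' : intValued) :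
    T.Y m * T.h q' * T.X b * (T.h q * T.X l) =
      (b + l).choose b • (T.Y m * T.h (q' * affineComp 1 (-2 * b) q) * T.X (b + l)) := by
  rw [mul_assoc _ (T.X b), ← mul_assoc (T.X b), T.X_mul_h, mul_assoc (T.h _), T.X_mul_X, map_mul]
  simp only [mul_smul_comm, mul_assoc]

theorem Y_one_pow_mul_h (T : DividedPowerTriple A) (s : ℕ) (q : intValued) :
    T.Y 1 ^ s * T.h q = T.h (affineComp 1 (2 * s) q) * T.Y 1 ^ s := by
  rw [T.Y_one_pow, smul_mul_assoc, T.Y_mul_h, mul_smul_comm]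

/-- The map `F` multiplies the indices of the basis elements `Y^(m) (H choose n) X^(l)` by `p`
and replaces `H` by `H + pδ`. For `δ = 0` this is the map `Fr'`. -/
def IsFrobenius (T : DividedPowerTriple A) (p δ : ℕ) (F : A →+ A) : Prop :=
  ∀ m n l : ℕ, F (T.Y m * T.h (binom 0 n) * T.X l) =
    T.Y (p * m) * T.h (binom (p * δ) (p * n)) * T.X (p * l)

variable {T : DividedPowerTriple A} {p : ℕ} [hp : Fact p.Prime] [Algebra (ZMod p) A]

namespace IsFrobenius

variable {δ : ℕ} {F : A →+ A}

theorem apply (hF : T.IsFrobenius p δ F) {q r : intValued} (h : FrobeniusRel p δ q r)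
    (m l : ℕ) : F (T.Y m * T.h q * T.X l) = T.Y (p * m) * T.h r * T.X (p * l) := by
  have exists_rel : ∀ f ∈ bpSpan, ∃ q r : intValued, q.1 = f ∧ FrobeniusRel p δ q r ∧
      F (T.Y m * T.h q * T.X l) = T.Y (p * m) * T.h r * T.X (p * l) := by
    intro f hf
    induction hf using Submodule.span_induction with
    | mem x hx =>
      obtain ⟨n, rfl⟩ := hx
      exact ⟨binom 0 n, binom (p * δ) (p * n), rfl, by simpa using frobeniusRel_binom δ 0 n,
        hF m n l⟩
    | zero => exact ⟨0, 0, rfl, fun n => by simp, by simp⟩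
    | add x y _ _ hx hy =>
      obtain ⟨q, r, rfl, h, hFq⟩ := hx
      obtain ⟨q', r', rfl, h', hFq'⟩ := hy
      exact ⟨q + q', r + r', rfl, h.add h', by simp only [map_add, mul_add, add_mul, hFq, hFq']⟩
    | smul c x _ hx =>
      obtain ⟨q, r, rfl, h, hFq⟩ := hx
      exact ⟨c • q, c • r, rfl, h.zsmul c, by
        simp only [map_zsmul, mul_smul_comm, smul_mul_assoc, hFq]⟩
  obtain ⟨q', r', hq, h', hFq⟩ := exists_rel q.1 (mem_bpSpan_of_intValued q)
  obtain rfl : q' = q := Subtype.ext hq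
  rw [hFq, T.h_congr p fun n => (h' n).trans (h n).symm]

theorem apply_mul (hF : T.IsFrobenius p δ F) {q r q' r' : intValued} (h : FrobeniusRel p δ q r)
    (h' : FrobeniusRel p δ q' r') (m b l : ℕ) : F (T.Y m * T.h q' * T.X b * (T.h q * T.X l)) =
      T.Y (p * m) * T.h r' * T.X (p * b) * (T.h r * T.X (p * l)) := by
  have h_choose : (p * b + p * l).choose (p * b) ≡ (b + l).choose b [MOD p] := by
    simpa [mul_add] using choose_mul_add_modEq (p := p) (b + l) hp.out.pos hp.out.pos b
  rw [Y_mul_h_mul_X_mul_h_mul_X, Y_mul_h_mul_X_mul_h_mul_X, map_nsmul,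
    hF.apply (h'.mul (h.affineComp hp.out.ne_zero _)), nsmul_eq_nsmul_of_modEq h_choose, mul_add]
  congr 7
  push_cast
  ring

theorem Y_mul (hF : T.IsFrobenius p δ F) (b m n l : ℕ) :
    F (T.Y b * (T.Y m * T.h (binom 0 n) * T.X l)) =
      T.Y (p * b) * F (T.Y m * T.h (binom 0 n) * T.X l) := by
  rw [hF, ← mul_assoc, ← mul_assoc, T.Y_mul_Y, smul_mul_assoc, smul_mul_assoc, map_nsmul, hF,
    ← mul_assoc, ← mul_assoc, T.Y_mul_mul_Y_mul, smul_mul_assoc, smul_mul_assoc]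

theorem YX_commute (hF : T.IsFrobenius p δ F) (m n l : ℕ) :
    Commute (T.Y 1 * T.X 1) (F (T.Y m * T.h (binom 0 n) * T.X l)) := by
  rw [hF]
  exact ((T.YX_one_commute_Y_mul p m).mul_right (T.YX_commute_h 1 _)).mul_right
    (T.YX_one_commute_X_mul p l)

end IsFrobenius

theorem carry_commute_h (T : DividedPowerTriple A) (p a : ℕ) (q : intValued) :
    Commute (T.carry p a) (T.h q) :=
  Commute.sum_left _ _ _ fun _ _ => (T.YX_commute_h _ q).smul_left _

theorem carry_commute_X_mul (T : DividedPowerTriple A) (a b : ℕ) :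
    Commute (T.carry p a) (T.X (p * b)) :=
  Commute.sum_left _ _ _ fun i hi => by
    have h_lt : p - i < p := Nat.sub_lt hp.out.pos (Finset.mem_Ico.mp hi).1
    exact (T.YX_commute_X_mul h_lt b).smul_left _

theorem IsFrobenius.X_mul {δ : ℕ} {F : A →+ A} (hF : T.IsFrobenius p δ F) (hδ : δ ≤ 1) {a : ℕ}
    (ha : a < p) {B : A} (hB : T.mu p a * B = B) (h_carry : T.carry p a * B = δ • B)
    (b c n l : ℕ) : F (T.X b * (T.Y c * T.h (binom 0 n) * T.X l)) * B =
      T.X (p * b) * F (T.Y c * T.h (binom 0 n) * T.X l) * B := by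
  set q := binom 0 n
  set r := binom (p * δ) (p * n)
  have h_rel : FrobeniusRel p δ q r := by simpa using frobeniusRel_binom (p := p) δ 0 n
  have h_mu : T.mu p a * (T.h r * T.X (p * l) * B) = T.h r * T.X (p * l) * B := by
    have h_comm := ((T.h_commute_mu p r a).mul_left (T.X_mul_mu_commute p l a)).eq
    rw [← mul_assoc, ← h_comm, mul_assoc, hB]
  have h_carry' : T.carry p a * (T.h r * T.X (p * l) * B) = δ • (T.h r * T.X (p * l) * B) := by
    have h_comm := ((T.carry_commute_h p a r).mul_right (T.carry_commute_X_mul a l)).eq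
    rw [← mul_assoc, h_comm, mul_assoc, h_carry, mul_smul_comm]
  calc F (T.X b * (T.Y c * T.h q * T.X l)) * B
      = (∑ i ∈ Finset.range (min b c + 1), F (T.Y (c - i) * T.h (binom (2 * i - b - c) i) *
          T.X (b - i) * (T.h q * T.X l))) * B := by
        rw [mul_assoc (T.Y c), ← mul_assoc (T.X b), T.X_mul_Y, Finset.sum_mul, map_sum]
    _ = ∑ i ∈ Finset.range (min b c + 1), T.Y (p * (c - i)) *
          T.h (binom (p * (2 * i - b - c + δ)) (p * i)) * T.X (p * (b - i)) *
            (T.h r * T.X (p * l) * B) := by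
        rw [Finset.sum_mul]
        refine Finset.sum_congr rfl fun i _ => ?_
        rw [hF.apply_mul h_rel (frobeniusRel_binom δ _ i)]
        simp only [mul_assoc]
    _ = T.X (p * b) * T.Y (p * c) * (T.h r * T.X (p * l) * B) :=
        (T.X_mul_mul_Y_mul_of_carry ha h_mu hδ h_carry' b c).symm
    _ = T.X (p * b) * F (T.Y c * T.h q * T.X l) * B := by
        rw [hF.apply h_rel]
        simp only [mul_assoc]

theorem Y_pow_mul_X_pow_mul_X_pow (T : DividedPowerTriple A) {s m : ℕ} (hs : s ≤ m) (b l : ℕ)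
    (q : intValued) : T.Y 1 ^ m * T.X 1 ^ (m - s) * (T.Y (p * b) * T.h q * T.X (p * l)) *
      T.X 1 ^ s = T.Y (p * b) * T.h (affineComp 1 (2 * s) q) * T.X (p * l) *
        (T.Y 1 ^ m * T.X 1 ^ m) := by
  obtain ⟨t, rfl⟩ := Nat.exists_eq_add_of_le hs
  set W := T.Y 1 ^ t * T.X 1 ^ t with hW
  have hX (i : ℕ) : Commute (T.Y 1 ^ i * T.X 1 ^ i) (T.X (p * l)) :=
    T.commute_YX_pow (T.YX_one_commute_X_mul p l) (fun c => T.h_one_commute_X_mul p c l) i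
  have hY : Commute W (T.Y (p * b)) :=
    T.commute_YX_pow (T.YX_one_commute_Y_mul p b) (fun c => T.h_one_commute_Y_mul p c b) t
  have hh : Commute W (T.h q) :=
    T.commute_YX_pow (T.YX_commute_h 1 q) (fun c => (Commute.all (binom c 1) q).map T.h) t
  have hX_pow : Commute (T.X 1 ^ s) (T.X (p * l)) := (T.X_commute _ _).pow_left s
  have hY_pow : Commute (T.Y 1 ^ s) (T.Y (p * b)) := (T.Y_commute _ _).pow_left s
  rw [Nat.add_sub_cancel_left]
  calc T.Y 1 ^ (s + t) * T.X 1 ^ t * (T.Y (p * b) * T.h q * T.X (p * l)) * T.X 1 ^ s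
      = T.Y 1 ^ s * (W * (T.Y (p * b) * T.h q * T.X (p * l))) * T.X 1 ^ s := by
        rw [pow_add, hW]; simp only [mul_assoc]
    _ = (T.Y 1 ^ s * T.Y (p * b)) * T.h q * (T.X (p * l) * W) * T.X 1 ^ s := by
        rw [((hY.mul_right hh).mul_right (hX t)).eq]; simp only [mul_assoc]
    _ = T.Y (p * b) * (T.Y 1 ^ s * T.h q) * W * (T.X (p * l) * T.X 1 ^ s) := by
        rw [hY_pow.eq, ← (hX t).eq, hW]; simp only [mul_assoc]
    _ = T.Y (p * b) * T.h (affineComp 1 (2 * s) q) *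
          (T.Y 1 ^ s * T.Y 1 ^ t * (T.X 1 ^ t * T.X 1 ^ s) * T.X (p * l)) := by
        rw [T.Y_one_pow_mul_h, ← hX_pow.eq, hW]; simp only [mul_assoc]
    _ = T.Y (p * b) * T.h (affineComp 1 (2 * s) q) * T.X (p * l) *
          (T.Y 1 ^ (s + t) * T.X 1 ^ (s + t)) := by
        rw [← pow_add, ← pow_add, add_comm t s, (hX (s + t)).eq]; simp only [mul_assoc]

theorem h_binom_mul_mul_mu (T : DividedPowerTriple A) {a w : ℕ} (ha : a < p) (hw : w < p)
    {u M : ℤ} (h : a + u = p * M + w) (n : ℕ) :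
    T.h (binom u (p * n)) * T.mu p a = T.h (binom (p * M) (p * n)) * T.mu p a := by
  refine T.h_mul_mu_congr p ?_
  rintro _ ⟨N, hN⟩
  obtain rfl := eq_add_of_sub_eq hN
  have h_lucas {i : ℕ} (hi : i < p) :
      Ring.choose (p * (N + M) + i : ℤ) (p * n) ≡ Ring.choose (N + M) n [ZMOD p] := by
    simpa using choose_modEq_choose_mul_choose (N + M) hi hp.out.pos n
  rw [evalInt_binom, evalInt_binom, show (p * N + a + u : ℤ) = p * (N + M) + w by
    linear_combination h, show (p * N + a + p * M : ℤ) = p * (N + M) + a by ring]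
  exact (h_lucas hw).trans (h_lucas ha).symm

/-- Moving `X^s` to the left past an element in the image of `Fr'` raises the weights by `2s`,
which on the image of `μ_a` has the same effect as replacing `H` by `H + p`. -/
theorem mu_mul_sum_pow_mul_frobenius_mul_pow {F G : A →+ A} (hF : T.IsFrobenius p 0 F)
    (hG : T.IsFrobenius p 1 G) {a s n N w : ℕ} (hw : a + 2 * s = p + w) (ha : a < p)
    (hwp : w < p) (hs : s ≤ n) (c : ℕ → ZMod p) (m' n' l' : ℕ) :
    T.mu p a * ∑ m ∈ Finset.Icc n N, c m • (T.Y 1 ^ m * T.X 1 ^ (m - s) *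
        F (T.Y m' * T.h (binom 0 n') * T.X l') * T.X 1 ^ s) =
      G (T.Y m' * T.h (binom 0 n') * T.X l') *
        (T.mu p a * ∑ m ∈ Finset.Icc n N, c m • (T.Y 1 ^ m * T.X 1 ^ m)) := by
  have h_weight := T.h_binom_mul_mul_mu ha hwp (u := 2 * s) (M := 1)
    (by rw [mul_one]; exact_mod_cast hw) n'
  have h_comm : Commute (T.mu p a)
      (T.Y (p * m') * T.h (binom (2 * s) (p * n')) * T.X (p * l')) :=
    ((T.Y_mul_mu_commute p m' a).symm.mul_right (T.h_commute_mu p _ a).symm).mul_right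
      (T.X_mul_mu_commute p l' a).symm
  have h_shift : T.mu p a * (T.Y (p * m') * T.h (binom (2 * s) (p * n')) * T.X (p * l')) =
      G (T.Y m' * T.h (binom 0 n') * T.X l') * T.mu p a := by
    rw [h_comm.eq, hG, Nat.cast_one, mul_assoc _ (T.X _), mul_assoc _ (T.X _),
      (T.X_mul_mu_commute p l' a).eq, ← mul_assoc, ← mul_assoc, mul_assoc _ (T.h _),
      mul_assoc _ (T.h _), h_weight]
  rw [← mul_assoc, ← h_shift, mul_assoc (T.mu p a)]
  congr 1
  rw [Finset.mul_sum]
  refine Finset.sum_congr rfl fun m hm => ?_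
  rw [hF, T.Y_pow_mul_X_pow_mul_X_pow (hs.trans (Finset.mem_Icc.mp hm).1), affineComp_one_binom,
    mul_smul_comm]
  simp only [Nat.cast_zero, mul_zero, zero_add]

end DividedPowerTriple

/-! ### The polynomials `ψ_j^(ε)` -/

section PsiPolynomials

open Polynomial

variable {p : ℕ}

theorem monic_phi (p : ℕ) (a : ℤ) (m : ℕ) : (phi p a m).Monic :=
  monic_prod_of_monic _ _ fun _ _ => monic_X_sub_C _

variable [hp : Fact p.Prime]

theorem natDegree_phi (p : ℕ) [Fact p.Prime] (a : ℤ) (m : ℕ) : (phi p a m).natDegree = m := by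
  rw [phi, natDegree_prod_of_monic _ _ fun _ _ => monic_X_sub_C _]
  simp only [natDegree_X_sub_C, Finset.sum_const, Finset.card_range, smul_eq_mul, mul_one]

theorem exists_eq_sum_C_mul_phi (a : ℤ) {n N : ℕ} (hn : n ≤ N) {f : (ZMod p)[X]}
    (hf : f.degree < N) (hd : phi p a n ∣ f) :
    ∃ c : ℕ → ZMod p, f = ∑ m ∈ Finset.Ico n N, C (c m) * phi p a m := by
  induction N, hn using Nat.le_induction generalizing f with
  | base =>
    refine ⟨0, ?_⟩
    rw [Finset.Ico_self, Finset.sum_empty]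
    refine eq_zero_of_dvd_of_degree_lt hd ?_
    rwa [degree_eq_natDegree (monic_phi p a n).ne_zero, natDegree_phi]
  | succ N hN ih =>
    have h_low : (f - C (f.coeff N) * phi p a N).degree < N := by
      rw [degree_lt_iff_coeff_zero]
      intro m hm
      rw [coeff_sub, coeff_C_mul]
      rcases hm.lt_or_eq with h | rfl
      · rw [coeff_eq_zero_of_degree_lt (hf.trans_le (by exact_mod_cast h)),
          coeff_eq_zero_of_natDegree_lt (p := phi p a N) (by rwa [natDegree_phi]), mul_zero,
          sub_zero]
      · have h_lead := (monic_phi p a N).coeff_natDegree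
        rw [natDegree_phi] at h_lead
        rw [h_lead, mul_one, sub_self]
    obtain ⟨c, hc⟩ := ih h_low (dvd_sub hd ((phi_dvd_phi p a hN).mul_left _))
    refine ⟨Function.update c N (f.coeff N), ?_⟩
    rw [Finset.sum_Ico_succ_top hN, Function.update_self, ← sub_eq_iff_eq_add, hc]
    refine Finset.sum_congr rfl fun m hm => ?_
    rw [Function.update_of_ne (Finset.mem_Ico.mp hm).2.ne]

theorem psi_eq_mul_psiEps_one (j : ZMod p) : psi p = (X - C (j ^ 2)) * psiEps p 1 j := by
  rw [psiEps, if_pos rfl, mul_divByMonic_eq_iff_isRoot.mpr]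
  rw [IsRoot, psi, eval_prod]
  exact Finset.prod_eq_zero (Finset.mem_univ j) (by simp)

theorem psi_eq_X_mul_psiEps_zero : psi p = X * psiEps p 0 0 := by
  rw [psiEps, if_neg (by decide), if_pos rfl, psi, ← Finset.mul_prod_erase _ _ (Finset.mem_univ 0)]
  simp only [ne_eq, OfNat.ofNat_ne_zero, not_false_eq_true, zero_pow, map_zero, sub_zero,
    Finset.filter_ne' _ (0 : ZMod p)]

theorem psiEps_one_zero : psiEps p 1 0 = psiEps p 0 0 := by
  apply mul_left_cancel₀ (X_ne_zero (R := ZMod p))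
  rw [← psi_eq_X_mul_psiEps_zero, psi_eq_mul_psiEps_one 0]
  simp

theorem monic_psi : (psi p).Monic := monic_prod_of_monic _ _ fun _ _ => monic_X_sub_C _

theorem natDegree_psi : (psi p).natDegree = p := by
  rw [psi, natDegree_prod_of_monic _ _ fun _ _ => monic_X_sub_C _]
  simp only [natDegree_X_sub_C, Finset.sum_const, Finset.card_univ, ZMod.card, smul_eq_mul, mul_one]

theorem psi_eval_sq (y : ZMod p) : (psi p).eval (y ^ 2) = 0 := by
  rw [psi, eval_prod]
  exact Finset.prod_eq_zero (Finset.mem_univ y) (by simp)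

theorem two_ne_zero_of_ne_two (hp2 : p ≠ 2) : (2 : ZMod p) ≠ 0 := by
  have h_dvd : ¬ p ∣ 2 := fun h => hp2 ((Nat.prime_dvd_prime_iff_eq hp.out Nat.prime_two).mp h)
  exact_mod_cast (ZMod.natCast_eq_zero_iff 2 p).not.mpr h_dvd

theorem ne_neg_self (hp2 : p ≠ 2) {j : ZMod p} (hj : j ≠ 0) : j ≠ -j := fun h =>
  mul_ne_zero (two_ne_zero_of_ne_two hp2) hj (by linear_combination h)

theorem psi_eq_X_mul_sq_mul (hp2 : p ≠ 2) {j : ZMod p} (hj : j ≠ 0) :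
    psi p = X * (X - C (j ^ 2)) ^ 2 *
      ∏ i : ZMod p with i ≠ 0 ∧ i ≠ j ∧ i ≠ -j, (X - C (i ^ 2)) := by
  have h_univ : (Finset.univ : Finset (ZMod p)) =
      insert 0 (insert j (insert (-j) (Finset.univ.filter fun i => i ≠ 0 ∧ i ≠ j ∧ i ≠ -j))) := by
    ext i
    simp only [Finset.mem_univ, Finset.mem_insert, Finset.mem_filter, true_and]
    tauto
  conv_lhs =>
    rw [psi, h_univ, Finset.prod_insert (by simp [hj.symm, hj]),
      Finset.prod_insert (by simp [ne_neg_self hp2 hj]), Finset.prod_insert (by simp)]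
  simp only [ne_eq, OfNat.ofNat_ne_zero, not_false_eq_true, zero_pow, map_zero, sub_zero, neg_sq]
  ring

theorem psiEps_zero_of_ne_zero {j : ZMod p} (hj : j ≠ 0) :
    psiEps p 0 j = 2 * X * (X + C (j ^ 2)) *
      ∏ i : ZMod p with i ≠ 0 ∧ i ≠ j ∧ i ≠ -j, (X - C (i ^ 2)) := by
  rw [psiEps, if_neg (by decide), if_neg hj]

theorem psiEps_one_of_ne_zero (hp2 : p ≠ 2) {j : ZMod p} (hj : j ≠ 0) :
    psiEps p 1 j = X * (X - C (j ^ 2)) *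
      ∏ i : ZMod p with i ≠ 0 ∧ i ≠ j ∧ i ≠ -j, (X - C (i ^ 2)) := by
  apply mul_left_cancel₀ (X_sub_C_ne_zero (j ^ 2))
  rw [← psi_eq_mul_psiEps_one, psi_eq_X_mul_sq_mul hp2 hj]
  ring

theorem exists_mul_psiEps_zero_eq (hp2 : p ≠ 2) (j : ZMod p) : ∃ u : ZMod p,
    (X - C (j ^ 2)) * psiEps p 0 j = C (4 * j ^ 2) * psiEps p 1 j + C u * psi p := by
  by_cases hj : j = 0
  · subst hj
    refine ⟨1, ?_⟩
    rw [psi_eq_X_mul_psiEps_zero]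
    simp
  · refine ⟨2, ?_⟩
    rw [psiEps_zero_of_ne_zero hj, psiEps_one_of_ne_zero hp2 hj, psi_eq_X_mul_sq_mul hp2 hj]
    simp only [C_mul, C_pow, map_ofNat]
    ring

theorem psiEps_ne_zero (hp2 : p ≠ 2) (ε : Fin 2) (j : ZMod p) : psiEps p ε j ≠ 0 := by
  have h_psi : psi p ≠ 0 := monic_psi.ne_zero
  obtain rfl | rfl : ε = 0 ∨ ε = 1 := by omega
  · by_cases hj : j = 0
    · subst hj
      rw [psi_eq_X_mul_psiEps_zero] at h_psi
      exact right_ne_zero_of_mul h_psi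
    · have h_two : (2 : (ZMod p)[X]) ≠ 0 := by
        rw [← map_ofNat C 2]
        exact C_ne_zero.mpr (two_ne_zero_of_ne_two hp2)
      rw [psi_eq_X_mul_sq_mul hp2 hj] at h_psi
      rw [psiEps_zero_of_ne_zero hj]
      exact mul_ne_zero (mul_ne_zero (mul_ne_zero h_two X_ne_zero) (X_add_C_ne_zero _))
        (right_ne_zero_of_mul h_psi)
  · rw [psi_eq_mul_psiEps_one j] at h_psi
    exact right_ne_zero_of_mul h_psi

theorem natDegree_psiEps_lt (hp2 : p ≠ 2) (ε : Fin 2) (j : ZMod p) :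
    (psiEps p ε j).natDegree < p := by
  have h_one : (psiEps p 1 j).natDegree < p := by
    have h_deg := congrArg natDegree (psi_eq_mul_psiEps_one j)
    rw [natDegree_psi, natDegree_mul (X_sub_C_ne_zero _) (psiEps_ne_zero hp2 1 j),
      natDegree_X_sub_C] at h_deg
    omega
  obtain rfl | rfl : ε = 0 ∨ ε = 1 := by omega
  · obtain ⟨u, hu⟩ := exists_mul_psiEps_zero_eq hp2 j
    have h_deg := congrArg natDegree hu
    rw [natDegree_mul (X_sub_C_ne_zero _) (psiEps_ne_zero hp2 0 j), natDegree_X_sub_C] at h_deg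
    have h_right : (C (4 * j ^ 2) * psiEps p 1 j + C u * psi p).natDegree ≤ p :=
      (natDegree_add_le _ _).trans (max_le ((natDegree_C_mul_le _ _).trans h_one.le)
        ((natDegree_C_mul_le _ _).trans natDegree_psi.le))
    omega
  · exact h_one

theorem psiEps_eval_sq_eq_zero (hp2 : p ≠ 2) (ε : Fin 2) {j y : ZMod p} (h : y ^ 2 ≠ j ^ 2) :
    (psiEps p ε j).eval (y ^ 2) = 0 := by
  have h_ne : (X - C (j ^ 2)).eval (y ^ 2) ≠ 0 := by simpa [sub_eq_zero] using h
  have h_one : (psiEps p 1 j).eval (y ^ 2) = 0 := by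
    have h_psi := psi_eval_sq y
    rw [psi_eq_mul_psiEps_one j, eval_mul] at h_psi
    exact (mul_eq_zero.mp h_psi).resolve_left h_ne
  obtain rfl | rfl : ε = 0 ∨ ε = 1 := by omega
  · obtain ⟨u, hu⟩ := exists_mul_psiEps_zero_eq hp2 j
    have h_eval := congrArg (eval (y ^ 2)) hu
    rw [eval_mul, eval_add, eval_mul, eval_mul, h_one, psi_eval_sq, mul_zero, mul_zero,
      add_zero] at h_eval
    exact (mul_eq_zero.mp h_eval).resolve_left h_ne
  · exact h_one

theorem psi_dvd_sq_mul_psiEps (hp2 : p ≠ 2) (ε : Fin 2) {j : ZMod p} (hj : j ≠ 0) :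
    psi p ∣ (X - C (j ^ 2)) ^ 2 * psiEps p ε j := by
  obtain rfl | rfl : ε = 0 ∨ ε = 1 := by omega
  · rw [psiEps_zero_of_ne_zero hj, psi_eq_X_mul_sq_mul hp2 hj]
    exact ⟨2 * (X + C (j ^ 2)), by ring⟩
  · rw [psi_eq_mul_psiEps_one j]
    exact ⟨X - C (j ^ 2), by ring⟩

theorem psi_dvd_prod_mul_psiEps (hp2 : p ≠ 2) (ε : Fin 2) {j : ZMod p} {m : ℕ} {g : ℕ → ZMod p}
    (h_pos : ∃ i < m, g i = j) (h_neg : ∃ i < m, g i = -j) :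
    psi p ∣ (∏ i ∈ Finset.range m, (X - C (g i ^ 2))) * psiEps p ε j := by
  obtain ⟨i₁, hi₁, rfl⟩ := h_pos
  obtain ⟨i₂, hi₂, h_eq⟩ := h_neg
  by_cases hj : g i₁ = 0
  · have h_psi : psi p = (X - C (g i₁ ^ 2)) * psiEps p ε (g i₁) := by
      rw [hj]
      obtain rfl | rfl : ε = 0 ∨ ε = 1 := by omega
      · rw [← psiEps_one_zero, ← psi_eq_mul_psiEps_one]
      · exact psi_eq_mul_psiEps_one 0
    conv_lhs => rw [h_psi]
    exact mul_dvd_mul_right (Finset.dvd_prod_of_mem (fun i => X - C (g i ^ 2))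
      (Finset.mem_range.mpr hi₁)) _
  · have h_ne : i₁ ≠ i₂ := by
      rintro rfl
      exact ne_neg_self hp2 hj h_eq
    have h_pair : ({i₁, i₂} : Finset ℕ) ⊆ Finset.range m :=
      Finset.insert_subset (Finset.mem_range.mpr hi₁)
        (Finset.singleton_subset_iff.mpr (Finset.mem_range.mpr hi₂))
    have h_dvd := Finset.prod_dvd_prod_of_subset _ _ (fun i => X - C (g i ^ 2)) h_pair
    rw [Finset.prod_pair h_ne, h_eq, neg_sq, ← sq] at h_dvd
    exact (psi_dvd_sq_mul_psiEps hp2 ε hj).trans (mul_dvd_mul_right h_dvd _)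

theorem prod_dvd_psiEps (hp2 : p ≠ 2) (ε : Fin 2) {j : ZMod p} {m : ℕ} {g : ℕ → ZMod p}
    (h_ne : ∀ i < m, g i ^ 2 ≠ j ^ 2) (h_inj : ∀ i < m, ∀ i' < m, g i ^ 2 = g i' ^ 2 → i = i') :
    (∏ i ∈ Finset.range m, (X - C (g i ^ 2))) ∣ psiEps p ε j := by
  refine Finset.prod_dvd_of_coprime (fun i hi i' hi' hne => ?_) fun i hi => ?_
  · refine isCoprime_X_sub_C_of_isUnit_sub (sub_ne_zero.mpr fun h => hne ?_).isUnit
    exact h_inj i (Finset.mem_range.mp hi) i' (Finset.mem_range.mp hi') h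
  · exact dvd_iff_isRoot.mpr (psiEps_eval_sq_eq_zero hp2 ε (h_ne i (Finset.mem_range.mp hi)))

theorem phi_eq_prod_comp (hp2 : p ≠ 2) (a : ℤ) (m : ℕ) : phi p a m =
    (∏ i ∈ Finset.range m, (X - C (((i : ZMod p) + ((a : ZMod p) + 1) / 2) ^ 2))).comp
      (X + C ((((a : ZMod p) + 1) / 2) ^ 2)) := by
  have h_two := two_ne_zero_of_ne_two hp2
  rw [prod_comp, phi]
  refine Finset.prod_congr rfl fun i _ => ?_
  rw [sub_comp, X_comp, C_comp, add_sub_assoc, ← C_sub, sub_eq_add_neg, ← C_neg]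
  congr 2
  field_simp
  ring

theorem phi_neg_comp (hp2 : p ≠ 2) (a : ℤ) (m : ℕ) :
    (phi p (-a) m).comp (X + C (a : ZMod p)) =
    (∏ i ∈ Finset.range m, (X - C (((i : ZMod p) + (1 - (a : ZMod p)) / 2) ^ 2))).comp
      (X + C ((((a : ZMod p) + 1) / 2) ^ 2)) := by
  have h_two := two_ne_zero_of_ne_two hp2
  rw [prod_comp, phi, prod_comp]
  refine Finset.prod_congr rfl fun i _ => ?_
  rw [sub_comp, X_comp, C_comp, sub_comp, X_comp, C_comp, add_sub_assoc, ← C_sub, add_sub_assoc,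
    ← C_sub]
  congr 2
  push_cast
  field_simp
  ring

theorem psi_comp (hp2 : p ≠ 2) (a : ℤ) :
    (psi p).comp (X + C ((((a : ZMod p) + 1) / 2) ^ 2)) = phi p a p := by
  rw [phi_eq_prod_comp hp2, psi, ← Equiv.prod_comp (Equiv.addRight (((a : ZMod p) + 1) / 2))]
  congr 1
  symm
  refine Finset.prod_bij (fun i _ => (i : ZMod p)) (fun _ _ => Finset.mem_univ _) ?_ ?_
    fun _ _ => rfl
  · intro i hi i' hi' h
    rw [Finset.mem_range] at hi hi'
    exact Nat.ModEq.eq_of_lt_of_lt ((ZMod.natCast_eq_natCast_iff i i' p).mp h) hi hi'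
  · intro y _
    exact ⟨y.val, Finset.mem_range.mpr (ZMod.val_lt y), by simp⟩

theorem phi_dvd_comp_of_psi_dvd (hp2 : p ≠ 2) (a : ℤ) {f : (ZMod p)[X]} (hf : psi p ∣ f) :
    phi p a p ∣ f.comp (X + C ((((a : ZMod p) + 1) / 2) ^ 2)) := by
  obtain ⟨g, rfl⟩ := hf
  rw [mul_comp, psi_comp hp2]
  exact dvd_mul_right _ _

end PsiPolynomials

/-! ### The polynomials attached to a pair for odd `p` -/

section ShiftedPsi

open Polynomial

variable {p : ℕ} [hp : Fact p.Prime]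

variable (p) in
/-- The polynomial `ψ_j^(ε)(x + ((a + 1) / 2)²)`, whose value at `YX` times `μ_a` is
`B^(ε)(a, j)` for odd `p`. -/
def shiftedPsi (ε : Fin 2) (a : ℤ) (j : ZMod p) : (ZMod p)[X] :=
  (psiEps p ε j).comp (X + C ((((a : ZMod p) + 1) / 2) ^ 2))

theorem natDegree_shiftedPsi_lt (hp2 : p ≠ 2) (ε : Fin 2) (a : ℤ) (j : ZMod p) :
    (shiftedPsi p ε a j).natDegree < p := by
  rw [shiftedPsi, natDegree_comp, natDegree_X_add_C, mul_one]
  exact natDegree_psiEps_lt hp2 ε j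

theorem shiftedPsi_ne_zero (hp2 : p ≠ 2) (ε : Fin 2) (a : ℤ) (j : ZMod p) :
    shiftedPsi p ε a j ≠ 0 := by
  rw [shiftedPsi, Ne, comp_X_add_C_eq_zero_iff]
  exact psiEps_ne_zero hp2 ε j

theorem le_of_phi_dvd_shiftedPsi (hp2 : p ≠ 2) {ε : Fin 2} {a : ℤ} {j : ZMod p} {n : ℕ}
    (h : phi p a n ∣ shiftedPsi p ε a j) : n ≤ p := by
  rw [← natDegree_phi p a n]
  exact (natDegree_le_of_dvd h (shiftedPsi_ne_zero hp2 ε a j)).trans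
    (natDegree_shiftedPsi_lt hp2 ε a j).le

theorem isGreatest_nIdx (hp2 : p ≠ 2) (ε : Fin 2) (a : ℤ) (j : ℚ) :
    IsGreatest {n | phi p a n ∣ shiftedPsi p ε a j} (nIdx p ε a j) := by
  have h_eq : nIdx p ε a j = sSup {n | phi p a n ∣ shiftedPsi p ε a j} := if_neg hp2
  have h_bdd : BddAbove {n | phi p a n ∣ shiftedPsi p ε a j} :=
    ⟨p, fun _ hn => le_of_phi_dvd_shiftedPsi hp2 hn⟩
  have h_zero : phi p a 0 ∣ shiftedPsi p ε a j := by simp [phi]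
  rw [h_eq]
  exact ⟨Nat.sSup_mem ⟨0, h_zero⟩ h_bdd, fun _ hn => le_csSup h_bdd hn⟩

theorem X_sub_C_mul_shiftedPsi (ε : Fin 2) (a : ℤ) (j : ZMod p) :
    (X - C (j ^ 2 - (((a : ZMod p) + 1) / 2) ^ 2)) * shiftedPsi p ε a j =
      ((X - C (j ^ 2)) * psiEps p ε j).comp (X + C ((((a : ZMod p) + 1) / 2) ^ 2)) := by
  rw [shiftedPsi, mul_comp, sub_comp, X_comp, C_comp, C_sub]
  ring

theorem phi_dvd_X_sub_C_mul_shiftedPsi_zero (hp2 : p ≠ 2) (a : ℤ) (j : ZMod p) :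
    phi p a p ∣ (X - C (j ^ 2 - (((a : ZMod p) + 1) / 2) ^ 2)) * shiftedPsi p 0 a j -
      C (4 * j ^ 2) * shiftedPsi p 1 a j := by
  obtain ⟨u, hu⟩ := exists_mul_psiEps_zero_eq hp2 j
  rw [X_sub_C_mul_shiftedPsi, hu, add_comp, mul_comp, C_comp, shiftedPsi, add_sub_cancel_left]
  exact phi_dvd_comp_of_psi_dvd hp2 a (dvd_mul_left _ _)

theorem phi_dvd_X_sub_C_mul_shiftedPsi_one (hp2 : p ≠ 2) (a : ℤ) (j : ZMod p) :
    phi p a p ∣ (X - C (j ^ 2 - (((a : ZMod p) + 1) / 2) ^ 2)) * shiftedPsi p 1 a j := by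
  rw [X_sub_C_mul_shiftedPsi, ← psi_eq_mul_psiEps_one]
  exact phi_dvd_comp_of_psi_dvd hp2 a dvd_rfl

theorem isAC_natCast_iff {p a n : ℕ} (hn : 2 * n + 1 ≤ p) :
    IsAC p a n ↔ (Even a ∧ p + 1 ≤ 2 * n + a) ∨ (Odd a ∧ 2 * n + 1 ≤ a) := by
  have h_even : ((p : ℚ) - (a : ℤ) + 1) / 2 ≤ n ↔ p + 1 ≤ 2 * n + a := by
    rw [div_le_iff₀ two_pos, ← Nat.cast_le (α := ℚ)]
    push_cast
    constructor <;> intro h <;> linarith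
  have h_le : (n : ℚ) ≤ ((p : ℚ) - 1) / 2 := by
    have h_cast : ((2 * n + 1 : ℕ) : ℚ) ≤ p := Nat.cast_le.mpr hn
    push_cast at h_cast
    linarith
  have h_odd : (n : ℚ) ≤ (((a : ℤ) : ℚ) - 1) / 2 ↔ 2 * n + 1 ≤ a := by
    rw [le_div_iff₀ two_pos, ← Nat.cast_le (α := ℚ)]
    push_cast
    constructor <;> intro h <;> linarith
  rw [IsAC, Int.even_coe_nat, Int.odd_coe_nat, h_even, h_odd]
  simp only [h_le, and_true, Nat.cast_nonneg, true_and]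

theorem exists_natCast_add_div_two_eq (hp2 : p ≠ 2) {b n : ℤ} {m : ℕ} (t : ℤ)
    (h_even : 2 ∣ 2 * n + p * t - b) (h_nonneg : 0 ≤ 2 * n + p * t - b)
    (h_lt : 2 * n + p * t - b < 2 * m) : ∃ i < m, (i : ZMod p) + (b : ZMod p) / 2 = n := by
  obtain ⟨i, hi⟩ := h_even
  lift i to ℕ using by omega
  refine ⟨i, by omega, ?_⟩
  have h_two := two_ne_zero_of_ne_two hp2
  have h_cast := congrArg (Int.cast (R := ZMod p)) hi
  push_cast at h_cast
  rw [CharP.cast_eq_zero] at h_cast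
  field_simp
  linear_combination -h_cast

theorem phi_dvd_phi_mul_shiftedPsi (hp2 : p ≠ 2) {a n : ℕ} (ha : a < p) (hn : 2 * n + 1 ≤ p)
    (h : ¬ IsAC p a n) (ε : Fin 2) :
    phi p a p ∣ phi p a (p - a) * shiftedPsi p ε a n := by
  have hp_odd := hp.out.odd_of_ne_two hp2
  rw [isAC_natCast_iff hn] at h
  rw [phi_eq_prod_comp hp2 a (p - a), shiftedPsi, Int.cast_natCast, ← mul_comp]
  have h_roots : (∃ i < p - a, (i : ZMod p) + ((a + 1 : ℤ) : ZMod p) / 2 = (n : ℤ)) ∧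
      ∃ i < p - a, (i : ZMod p) + ((a + 1 : ℤ) : ZMod p) / 2 = (-n : ℤ) := by
    rcases Nat.even_or_odd a with ha_even | ha_odd
    · exact ⟨exists_natCast_add_div_two_eq hp2 1 (by grind) (by grind) (by grind),
        exists_natCast_add_div_two_eq hp2 1 (by grind) (by grind) (by grind)⟩
    · exact ⟨exists_natCast_add_div_two_eq hp2 0 (by grind) (by grind) (by grind),
        exists_natCast_add_div_two_eq hp2 2 (by grind) (by grind) (by grind)⟩
  push_cast at h_roots
  have h_dvd := phi_dvd_comp_of_psi_dvd hp2 a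
    (psi_dvd_prod_mul_psiEps hp2 ε h_roots.1 h_roots.2)
  rwa [Int.cast_natCast] at h_dvd

theorem phi_dvd_phi_neg_comp_mul_shiftedPsi (hp2 : p ≠ 2) {a n : ℕ} (hn : 2 * n + 1 ≤ p)
    (h : IsAC p a n) (ε : Fin 2) :
    phi p a p ∣ (phi p (-a) a).comp (X + C (a : ZMod p)) * shiftedPsi p ε a n := by
  have hp_odd := hp.out.odd_of_ne_two hp2
  rw [isAC_natCast_iff hn] at h
  have h_comp := phi_neg_comp hp2 a a
  rw [Int.cast_natCast] at h_comp
  rw [h_comp, shiftedPsi, Int.cast_natCast, ← mul_comp]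
  have h_roots : (∃ i < a, (i : ZMod p) + ((1 - a : ℤ) : ZMod p) / 2 = (n : ℤ)) ∧
      ∃ i < a, (i : ZMod p) + ((1 - a : ℤ) : ZMod p) / 2 = (-n : ℤ) := by
    rcases h with ⟨ha_even, h_le⟩ | ⟨ha_odd, h_le⟩
    · exact ⟨exists_natCast_add_div_two_eq hp2 (-1) (by grind) (by grind) (by grind),
        exists_natCast_add_div_two_eq hp2 1 (by grind) (by grind) (by grind)⟩
    · exact ⟨exists_natCast_add_div_two_eq hp2 0 (by grind) (by grind) (by grind),
        exists_natCast_add_div_two_eq hp2 0 (by grind) (by grind) (by grind)⟩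
  push_cast at h_roots
  have h_dvd := phi_dvd_comp_of_psi_dvd hp2 a
    (psi_dvd_prod_mul_psiEps hp2 ε h_roots.1 h_roots.2)
  rwa [Int.cast_natCast] at h_dvd

theorem add_two_mul_sShift (hp2 : p ≠ 2) {a : ℕ} (ha : a < p) :
    a + 2 * sShift p a = p + if Even a then 1 else 0 := by
  have hp_odd := hp.out.odd_of_ne_two hp2
  rw [Nat.odd_iff] at hp_odd
  rw [sShift, if_neg hp2]
  simp only [Int.even_coe_nat, Nat.even_iff]
  split_ifs <;> omega

theorem add_div_two_sq_eq_sq_iff {K : Type*} [Field K] (h2 : (2 : K) ≠ 0) {x b y : K} :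
    (x + b / 2) ^ 2 = y ^ 2 ↔ 2 * x + b - 2 * y = 0 ∨ 2 * x + b + 2 * y = 0 := by
  rw [sq_eq_sq_iff_eq_or_eq_neg]
  refine or_congr ?_ ?_ <;> field_simp <;> constructor <;> intro h <;> linear_combination h

theorem eq_zero_or_eq_of_dvd {m x : ℤ} (h : m ∣ x) (h_lower : -m < x) (h_upper : x < 2 * m) :
    x = 0 ∨ x = m := by
  obtain ⟨t, rfl⟩ := h
  have : 0 < m := by omega
  have ht_lower : -1 < t := by nlinarith
  have ht_upper : t < 2 := by nlinarith
  obtain rfl | rfl : t = 0 ∨ t = 1 := by omega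
  · exact Or.inl (mul_zero m)
  · exact Or.inr (mul_one m)

theorem add_div_two_sq_ne_sq (hp2 : p ≠ 2) {a n i : ℕ} (ha : a < p) (hn : 2 * n + 1 ≤ p)
    (h : IsAC p a n) (hi : i < sShift p a) :
    ((i : ZMod p) + ((a : ZMod p) + 1) / 2) ^ 2 ≠ (n : ZMod p) ^ 2 := by
  have h_shift := add_two_mul_sShift hp2 ha
  have hp_odd := hp.out.odd_of_ne_two hp2
  rw [isAC_natCast_iff hn] at h
  rw [Ne, add_div_two_sq_eq_sq_iff (two_ne_zero_of_ne_two hp2)]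
  have h_sub : ¬ (p : ℤ) ∣ 2 * i + (a + 1) - 2 * n := fun h_dvd => by
    have := eq_zero_or_eq_of_dvd h_dvd (by grind) (by grind)
    grind
  have h_add : ¬ (p : ℤ) ∣ 2 * i + (a + 1) + 2 * n := fun h_dvd => by
    have := eq_zero_or_eq_of_dvd h_dvd (by grind) (by grind)
    grind
  rw [← ZMod.intCast_zmod_eq_zero_iff_dvd] at h_sub h_add
  push_cast at h_sub h_add
  exact not_or.mpr ⟨h_sub, h_add⟩

theorem eq_of_add_div_two_sq_eq_sq (hp2 : p ≠ 2) {a i i' : ℕ} (ha : a < p)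
    (hi : i < sShift p a) (hi' : i' < sShift p a)
    (h : ((i : ZMod p) + ((a : ZMod p) + 1) / 2) ^ 2 =
      ((i' : ZMod p) + ((a : ZMod p) + 1) / 2) ^ 2) : i = i' := by
  have h_two := two_ne_zero_of_ne_two hp2
  have h_shift := add_two_mul_sShift hp2 ha
  have ha_even : (if Even a then 1 else 0) ≤ 1 := by split_ifs <;> omega
  rcases (add_div_two_sq_eq_sq_iff h_two).mp h with h_sub | h_add
  · have h_eq : (i : ZMod p) = i' := by
      refine mul_left_cancel₀ h_two ?_
      field_simp at h_sub
      linear_combination h_sub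
    have : p ≠ 1 := hp.out.ne_one
    exact Nat.ModEq.eq_of_lt_of_lt ((ZMod.natCast_eq_natCast_iff i i' p).mp h_eq) (by grind)
      (by grind)
  · by_contra h_ne
    have h_zero : ((i + i' + a + 1 : ℕ) : ZMod p) = 0 := by
      refine mul_left_cancel₀ h_two ?_
      push_cast
      field_simp at h_add
      linear_combination h_add
    have := Nat.le_of_dvd (by omega) ((ZMod.natCast_eq_zero_iff _ _).mp h_zero)
    omega

theorem sShift_le_nIdx (hp2 : p ≠ 2) {a n : ℕ} (ha : a < p) (hn : 2 * n + 1 ≤ p)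
    (h : IsAC p a n) (ε : Fin 2) : sShift p a ≤ nIdx p ε a n := by
  refine (isGreatest_nIdx hp2 ε a n).2 ?_
  rw [Set.mem_ofPred_eq, phi_eq_prod_comp hp2 a, shiftedPsi, Rat.cast_natCast, Int.cast_natCast]
  obtain ⟨g, hg⟩ := prod_dvd_psiEps hp2 ε (fun i hi => add_div_two_sq_ne_sq hp2 ha hn h hi)
    fun i hi i' hi' => eq_of_add_div_two_sq_eq_sq hp2 ha hi hi'
  rw [hg, mul_comp]
  exact dvd_mul_right _ _

end ShiftedPsi

/-! ### Uniform description of the pairs in `𝒫` -/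

section PairPolynomials

open Polynomial

/-- The polynomials `f ε` represent the elements `B^(ε)(a, j)`, in the sense that
`B^(ε)(a, j) = f ε (YX) μ_a`, and `κ`, `l` are the coefficients of the relations
`YX B^(0) = κ B^(0) + l B^(1)` and `YX B^(1) = κ B^(1)`. On `μ_a` a polynomial in `YX` only
matters modulo `φ_{a,p}`. -/
structure IsPairPolynomials (p : ℕ) [Fact p.Prime] (a : ℕ) (j : ℚ) (f : Fin 2 → (ZMod p)[X])
    (κ l : ZMod p) : Prop where
  lt : a < p
  dvd_zero : phi p a p ∣ (X - C κ) * f 0 - C l * f 1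
  dvd_one : phi p a p ∣ (X - C κ) * f 1
  dvd_of_not_isAC : ¬ IsAC p a j → ∀ ε, phi p a p ∣ phi p a (p - a) * f ε
  pos_of_isAC : IsAC p a j → 0 < a
  exists_weight : IsAC p a j → ∃ w < p, a + 2 * sShift p a = p + w
  dvd_of_isAC : IsAC p a j → ∀ ε, phi p a p ∣ (phi p (-a) a).comp (X + C (a : ZMod p)) * f ε
  sShift_le_nIdx : IsAC p a j → ∀ ε, sShift p a ≤ nIdx p ε a j
  phi_nIdx_dvd : ∀ ε, phi p a (nIdx p ε a j) ∣ f ε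
  natDegree_lt : ∀ ε, (f ε).natDegree < p
  nIdx_le : ∀ ε, nIdx p ε a j ≤ p

theorem isPairPolynomials_shiftedPsi {p : ℕ} [hp : Fact p.Prime] (hp2 : p ≠ 2) {a n : ℕ}
    (ha : a < p) (hn : 2 * n + 1 ≤ p) :
    IsPairPolynomials p a n (fun ε => shiftedPsi p ε a n)
      ((n : ZMod p) ^ 2 - (((a : ZMod p) + 1) / 2) ^ 2) (4 * (n : ZMod p) ^ 2) where
  lt := ha
  dvd_zero := by simpa using phi_dvd_X_sub_C_mul_shiftedPsi_zero hp2 a n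
  dvd_one := by simpa using phi_dvd_X_sub_C_mul_shiftedPsi_one hp2 a n
  dvd_of_not_isAC := phi_dvd_phi_mul_shiftedPsi hp2 ha hn
  pos_of_isAC h := by
    rcases (isAC_natCast_iff hn).mp h with ⟨_, h_le⟩ | ⟨_, h_le⟩ <;> omega
  exists_weight _ := by
    refine ⟨_, ?_, add_two_mul_sShift hp2 ha⟩
    split_ifs
    · exact hp.out.one_lt
    · exact hp.out.pos
  dvd_of_isAC := phi_dvd_phi_neg_comp_mul_shiftedPsi hp2 hn
  sShift_le_nIdx := sShift_le_nIdx hp2 ha hn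
  phi_nIdx_dvd ε := by simpa using (isGreatest_nIdx hp2 ε a n).1
  natDegree_lt ε := natDegree_shiftedPsi_lt hp2 ε a n
  nIdx_le ε := le_of_phi_dvd_shiftedPsi hp2 (isGreatest_nIdx hp2 ε a n).1

theorem phi_one (p : ℕ) (a : ℤ) : phi p a 1 = X := by
  rw [phi, Finset.prod_range_one]; simp

theorem phi_two_zero_two : phi 2 (0 : ℕ) 2 = X * X := by
  have h_root : ((1 : ℕ) : ZMod 2) * ((1 : ℕ) + ((0 : ℕ) : ℤ) + 1) = 0 := by decide
  rw [phi, Finset.prod_range_succ, Finset.prod_range_one, h_root]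
  simp

theorem phi_two_one_two : phi 2 (1 : ℕ) 2 = X * (X + 1) := by
  have h_root : ((1 : ℕ) : ZMod 2) * ((1 : ℕ) + ((1 : ℕ) : ℤ) + 1) = 1 := by decide
  rw [phi, Finset.prod_range_succ, Finset.prod_range_one, h_root]
  simp [CharTwo.sub_eq_add]

theorem isPairPolynomials_two_zero_half :
    IsPairPolynomials 2 0 (1 / 2) (fun ε => if ε = 0 then 1 else X) 0 1 := by
  have h_not_isAC : ¬ IsAC 2 (0 : ℕ) (1 / 2) := by
    rintro (⟨_, h, _⟩ | ⟨h, _⟩)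
    · norm_num at h
    · simp at h
  exact
  { lt := two_pos
    dvd_zero := by simp
    dvd_one := by rw [phi_two_zero_two]; simp
    dvd_of_not_isAC _ _ := dvd_mul_right _ _
    pos_of_isAC h := (h_not_isAC h).elim
    exists_weight h := (h_not_isAC h).elim
    dvd_of_isAC h := (h_not_isAC h).elim
    sShift_le_nIdx h := (h_not_isAC h).elim
    phi_nIdx_dvd := by simp [Fin.forall_fin_two, nIdx, phi]
    natDegree_lt := by simp [Fin.forall_fin_two]
    nIdx_le := by simp [Fin.forall_fin_two, nIdx] }

theorem isPairPolynomials_two_one_zero : IsPairPolynomials 2 1 0 (fun _ => X) (-1) 0 where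
  lt := one_lt_two
  dvd_zero := by rw [phi_two_one_two, mul_comm]; simp [CharTwo.sub_eq_add]
  dvd_one := by rw [phi_two_one_two, mul_comm]; simp [CharTwo.sub_eq_add]
  dvd_of_not_isAC h := (h (Or.inr ⟨by simp, le_rfl, by norm_num⟩)).elim
  pos_of_isAC _ := one_pos
  exists_weight _ := ⟨1, one_lt_two, by simp [sShift]⟩
  dvd_of_isAC _ _ := by rw [phi_two_one_two, mul_comm, phi_one]; simp
  sShift_le_nIdx _ _ := by simp [sShift, nIdx]
  phi_nIdx_dvd _ := by simp [nIdx, phi_one]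
  natDegree_lt _ := by simp
  nIdx_le _ := by simp [nIdx]

theorem isPairPolynomials_two_one_one : IsPairPolynomials 2 1 1 (fun _ => X + 1) 0 0 := by
  have h_not_isAC : ¬ IsAC 2 (1 : ℕ) 1 := by
    rintro (⟨h, _, _⟩ | ⟨_, _, h⟩)
    · simp at h
    · norm_num at h
  exact
  { lt := one_lt_two
    dvd_zero := by rw [phi_two_one_two]; simp
    dvd_one := by rw [phi_two_one_two]; simp
    dvd_of_not_isAC _ _ := by rw [phi_two_one_two, phi_one]
    pos_of_isAC h := (h_not_isAC h).elim
    exists_weight h := (h_not_isAC h).elim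
    dvd_of_isAC h := (h_not_isAC h).elim
    sShift_le_nIdx h := (h_not_isAC h).elim
    phi_nIdx_dvd _ := by simp [nIdx, phi]
    natDegree_lt _ := by rw [← C_1, natDegree_X_add_C]; exact one_lt_two
    nIdx_le _ := by simp [nIdx] }

end PairPolynomials

namespace DividedPowerTriple

variable {A : Type*} [Ring A] (T : DividedPowerTriple A) {p : ℕ} [hp : Fact p.Prime]
  [Algebra (ZMod p) A]

theorem Y_mul_X_mul_aevalYX_mul_mu {a : ℤ} {f g : (ZMod p)[X]} {κ l : ZMod p}
    (h : phi p a p ∣ (Polynomial.X - Polynomial.C κ) * f - Polynomial.C l * g) :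
    T.Y 1 * T.X 1 * (T.aevalYX p f * T.mu p a) =
      κ • (T.aevalYX p f * T.mu p a) + l • (T.aevalYX p g * T.mu p a) := by
  have h_congr := T.aevalYX_mul_mu_congr h
  simp only [map_mul, map_sub, Polynomial.aeval_X, Polynomial.aeval_C, sub_mul,
    ← Algebra.smul_def, smul_mul_assoc] at h_congr
  rw [sub_eq_iff_eq_add'] at h_congr
  rw [← h_congr, mul_assoc (T.Y 1 * T.X 1)]

theorem aeval_mu_mul_YX_mul_mu (a : ℤ) (c : ZMod p) (f : (ZMod p)[X]) :
    Polynomial.aeval (T.mu p a * T.Y 1 * T.X 1 + algebraMap (ZMod p) A c) f * T.mu p a =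
      T.aevalYX p (f.comp (Polynomial.X + Polynomial.C c)) * T.mu p a := by
  have h_comm : Commute (T.mu p a) (T.Y 1 * T.X 1 + algebraMap (ZMod p) A c) :=
    (T.YX_commute_mu 1 p a).symm.add_right (Algebra.commutes c _).symm
  have h_mu : (T.mu p a * T.Y 1 * T.X 1 + algebraMap (ZMod p) A c) * T.mu p a =
      (T.Y 1 * T.X 1 + algebraMap (ZMod p) A c) * T.mu p a := by
    rw [add_mul, add_mul, mul_assoc (T.mu p a), mul_assoc (T.mu p a),
      (T.YX_commute_mu 1 p a).eq, ← mul_assoc, T.mu_mul_mu]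
  rw [Polynomial.aeval_comp, map_add, Polynomial.aeval_X, Polynomial.aeval_C]
  induction f using Polynomial.induction_on' with
  | add f g hf hg => rw [map_add, map_add, add_mul, add_mul, hf, hg]
  | monomial n r =>
    induction n with
    | zero => simp
    | succ n ih =>
      rw [← Polynomial.monomial_mul_X, map_mul, map_mul, Polynomial.aeval_X, Polynomial.aeval_X,
        mul_assoc, h_mu, ← h_comm.eq, ← mul_assoc, ih, mul_assoc, h_comm.eq, mul_assoc]

theorem exists_aevalYX_mul_mu_eq (a : ℤ) {f : (ZMod p)[X]} {n : ℕ} (hn : n ≤ p)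
    (h_dvd : phi p a n ∣ f) (h_deg : f.natDegree < p) : ∃ c : ℕ → ZMod p,
      T.aevalYX p f * T.mu p a =
        T.mu p a * ∑ m ∈ Finset.Icc n (p - 1), c m • (T.Y 1 ^ m * T.X 1 ^ m) := by
  obtain ⟨c, hc⟩ := exists_eq_sum_C_mul_phi a hn
    (Polynomial.degree_le_natDegree.trans_lt (Nat.cast_lt.mpr h_deg)) h_dvd
  refine ⟨c, ?_⟩
  have h_Icc : Finset.Icc n (p - 1) = Finset.Ico n p := by
    ext i
    have := hp.out.pos
    simp only [Finset.mem_Icc, Finset.mem_Ico]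
    omega
  conv_lhs => rw [hc, map_sum, Finset.sum_mul]
  rw [h_Icc, Finset.mul_sum]
  refine Finset.sum_congr rfl fun m _ => ?_
  rw [map_mul, mul_assoc, T.aevalYX_phi_mul_mu, Polynomial.aeval_C, ← Algebra.smul_def,
    mul_smul_comm, (T.commute_YX_pow (T.YX_commute_mu 1 p a) (fun _ => T.h_commute_mu p _ a) m).eq]

end DividedPowerTriple

section PairRepresentation

theorem mu_eq_tripleU_mu (p : ℕ) (k : Type*) [Field k] (a : ℤ) :
    mu p k a = (tripleU k).mu p a := by
  rw [mu, Hd_eq_tripleU_h]; rfl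

variable {p : ℕ} [hp : Fact p.Prime] (k : Type*) [Field k] [CharP k p]

attribute [local instance] ZMod.algebra

theorem ratCast_sq_sub_sq (hp2 : p ≠ 2) (a n : ℕ) :
    (((n : ℚ) ^ 2 - ((((a : ℤ) : ℚ) + 1) / 2) ^ 2 : ℚ) : k) =
      ZMod.castHom (dvd_refl p) k ((n : ZMod p) ^ 2 - (((a : ZMod p) + 1) / 2) ^ 2) := by
  have h_two : (2 : k) ≠ 0 := by
    rw [← map_ofNat (ZMod.castHom (dvd_refl p) k) 2]
    exact (map_ne_zero _).mpr (two_ne_zero_of_ne_two hp2)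
  have h_four : (4 : k) ≠ 0 := by
    rw [show (4 : k) = 2 * 2 by norm_num]
    exact mul_ne_zero h_two h_two
  have h_divInt : ((n : ℚ) ^ 2 - ((((a : ℤ) : ℚ) + 1) / 2) ^ 2 : ℚ) =
      Rat.divInt (4 * (n : ℤ) ^ 2 - (a + 1) ^ 2) 4 := by
    rw [Rat.divInt_eq_div]
    push_cast
    ring
  rw [h_divInt, Rat.cast_divInt_of_ne_zero _ (mod_cast h_four)]
  simp only [map_sub, map_pow, map_div₀, map_add, map_natCast, map_one, map_ofNat]
  push_cast
  field_simp
  ring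

theorem aevalYX_X_mul_mu (a : ℤ) :
    (tripleU k).aevalYX p Polynomial.X * (tripleU k).mu p a = mu p k a * Yd k 1 * Xd k 1 := by
  rw [((tripleU k).aevalYX_commute_mu _ _).eq, Polynomial.aeval_X, ← mu_eq_tripleU_mu, mul_assoc]
  rfl

theorem B₁_eq_aevalYX_shiftedPsi (hp2 : p ≠ 2) (ε : Fin 2) (a n : ℕ) :
    B₁ p k ε a n = (tripleU k).aevalYX p (shiftedPsi p ε a n) * (tripleU k).mu p a := by
  have h_shift : algebraMap k (U k) (((((a : ℤ) : k) + 1) / 2) ^ 2) =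
      algebraMap (ZMod p) (U k) (((((a : ℤ) : ZMod p) + 1) / 2) ^ 2) := by
    rw [IsScalarTower.algebraMap_apply (ZMod p) k (U k)]
    simp only [map_pow, map_div₀, map_add, map_intCast, map_one, map_ofNat]
  rw [B₁, if_neg hp2, h_shift, Rat.cast_natCast, mu_eq_tripleU_mu, shiftedPsi,
    ← DividedPowerTriple.aeval_mu_mul_YX_mul_mu]
  exact congrArg (· * _) (Polynomial.aeval_map_algebraMap k _ _)

variable (p) in
/-- The polynomials `f ε` represent the elements `B^(ε)(a, j)` of the hyperalgebra, `b` being `a` as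
a natural number, and `κ`, `l` are the coefficients in the proposition. -/
structure RepresentsPair (a : ℤ) (j : ℚ) (b : ℕ) (f : Fin 2 → (ZMod p)[X]) (κ l : ZMod p) : Prop
    extends IsPairPolynomials p b j f κ l where
  eq_natCast : a = b
  ratCast_κ : ((j ^ 2 - ((a + 1) / 2) ^ 2 : ℚ) : k) = ZMod.castHom (dvd_refl p) k κ
  ratCast_l : ((4 * j ^ 2 : ℚ) : k) = ZMod.castHom (dvd_refl p) k l
  B₁_eq : ∀ ε, B₁ p k ε a j = (tripleU k).aevalYX p (f ε) * (tripleU k).mu p b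

theorem exists_representsPair_of_ne_two (hp2 : p ≠ 2) {a : ℤ} {j : ℚ}
    (haj : (a, j) ∈ pairs p) : ∃ (b : ℕ) (f : Fin 2 → (ZMod p)[X]) (κ l : ZMod p),
      RepresentsPair p k a j b f κ l := by
  rw [pairs, if_neg hp2] at haj
  obtain ⟨⟨h_nonneg, h_lt⟩, n, hn, hj⟩ := haj
  dsimp only at h_nonneg h_lt hj
  obtain ⟨b, rfl⟩ := Int.eq_ofNat_of_zero_le h_nonneg
  subst hj
  have h_l : ((4 * (n : ℚ) ^ 2 : ℚ) : k) =
      ZMod.castHom (dvd_refl p) k (4 * (n : ZMod p) ^ 2) := by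
    rw [show (4 * (n : ℚ) ^ 2 : ℚ) = ((4 * n ^ 2 : ℕ) : ℚ) by push_cast; rfl, Rat.cast_natCast]
    simp only [Nat.cast_mul, Nat.cast_pow, Nat.cast_ofNat, map_mul, map_pow, map_ofNat, map_natCast]
  have := hp.out.two_le
  exact ⟨b, _, _, _, isPairPolynomials_shiftedPsi hp2 (by omega) (by omega), rfl,
    ratCast_sq_sub_sq k hp2 b n, h_l, fun ε => B₁_eq_aevalYX_shiftedPsi k hp2 ε b n⟩

theorem exists_representsPair_two (k : Type*) [Field k] [CharP k 2] {a : ℤ} {j : ℚ}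
    (haj : (a, j) ∈ pairs 2) : ∃ (b : ℕ) (f : Fin 2 → (ZMod 2)[X]) (κ l : ZMod 2),
      RepresentsPair 2 k a j b f κ l := by
  rw [pairs, if_pos rfl] at haj
  simp only [Set.mem_insert_iff, Set.mem_singleton_iff, Prod.mk.injEq] at haj
  have h_four : (4 : k) = 0 := by
    rw [show (4 : k) = 2 * 2 by norm_num, CharTwo.two_eq_zero, mul_zero]
  rcases haj with ⟨rfl, rfl⟩ | ⟨rfl, rfl⟩ | ⟨rfl, rfl⟩
  · refine ⟨0, _, _, _, isPairPolynomials_two_zero_half, rfl, by norm_num, by norm_num,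
      fun ε => ?_⟩
    rw [B₁, if_pos rfl, if_pos ⟨rfl, rfl⟩, ← aevalYX_X_mul_mu]
    split_ifs
    · rw [map_one, one_mul, ← mu_eq_tripleU_mu]; rfl
    · rfl
  · refine ⟨1, _, _, _, isPairPolynomials_two_one_zero, rfl, by norm_num, by norm_num,
      fun ε => ?_⟩
    rw [B₁, if_pos rfl, if_neg (by norm_num), if_pos ⟨rfl, rfl⟩, ← aevalYX_X_mul_mu]
    rfl
  · refine ⟨1, _, _, _, isPairPolynomials_two_one_one, rfl, by norm_num, by norm_num; exact h_four,
      fun ε => ?_⟩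
    rw [B₁, if_pos rfl, if_neg (by norm_num), if_neg (by norm_num), if_pos ⟨rfl, rfl⟩,
      ← aevalYX_X_mul_mu, map_add, add_mul, map_one, one_mul, mu_eq_tripleU_mu]
    rfl

theorem exists_representsPair {a : ℤ} {j : ℚ} (haj : (a, j) ∈ pairs p) :
    ∃ (b : ℕ) (f : Fin 2 → (ZMod p)[X]) (κ l : ZMod p), RepresentsPair p k a j b f κ l := by
  rcases eq_or_ne p 2 with rfl | hp2
  · exact exists_representsPair_two k haj
  · exact exists_representsPair_of_ne_two k hp2 haj

end PairRepresentation

section FrobeniusShift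

variable (k : Type*) [Field k]

theorem basisU_eq_tripleU (m n l : ℕ) :
    basisU k (m, n, l) = (tripleU k).Y m * (tripleU k).h (binom 0 n) * (tripleU k).X l := by
  rw [basisU_apply, Hd_eq_tripleU_h]; rfl

variable {k} in
theorem U_induction {motive : U k → Prop}
    (basis : ∀ m n l : ℕ,
      motive ((tripleU k).Y m * (tripleU k).h (binom 0 n) * (tripleU k).X l))
    (add : ∀ x y, motive x → motive y → motive (x + y))
    (smul : ∀ (c : k) x, motive x → motive (c • x)) (z : U k) : motive z := by
  have h_zero : motive 0 := by simpa using smul 0 _ (basis 0 0 0)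
  induction (basisU k).mem_span z using Submodule.span_induction with
  | mem x hx =>
    obtain ⟨⟨m, n, l⟩, rfl⟩ := hx
    exact basisU_eq_tripleU k m n l ▸ basis m n l
  | zero => exact h_zero
  | add x y _ _ hx hy => exact add x y hx hy
  | smul c x _ hx => exact smul c x hx

/-- The map `Fr'` with all weights raised by `pδ`: it sends `Y^(m) (H choose n) X^(l)` to
`Y^(pm) (H + pδ choose pn) X^(pl)`. For `δ = 0` it is `Fr'`, while `δ = 1` occurs for the pairs of
types (A) and (C), see `Z_eq_frShift_mul`. -/
def frShift (p δ : ℕ) : U k →ₗ[k] U k :=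
  (basisU k).constr k fun i =>
    (tripleU k).Y (p * i.1) * (tripleU k).h (binom (p * δ) (p * i.2.1)) *
      (tripleU k).X (p * i.2.2)

theorem isFrobenius_frShift (p δ : ℕ) :
    (tripleU k).IsFrobenius p δ (frShift k p δ).toAddMonoidHom := fun m n l => by
  rw [← basisU_eq_tripleU, LinearMap.toAddMonoidHom_coe, frShift, Module.Basis.constr_basis]

theorem frPrime_eq_frShift_zero (p : ℕ) : frPrime p k = frShift k p 0 := by
  refine congrArg ((basisU k).constr k) (funext fun i => ?_)
  rw [Hd_eq_tripleU_h, mul_comm i.1, mul_comm i.2.1, mul_comm i.2.2, Nat.cast_zero, mul_zero]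
  rfl

variable {k} {p : ℕ} [hp : Fact p.Prime] [CharP k p]

attribute [local instance] ZMod.algebra

theorem Y_mul_frShift (δ b : ℕ) (z : U k) :
    (tripleU k).Y (p * b) * frShift k p δ z = frShift k p δ ((tripleU k).Y b * z) := by
  induction z using U_induction with
  | basis m n l => exact ((isFrobenius_frShift k p δ).Y_mul b m n l).symm
  | add x y hx hy => simp only [mul_add, map_add, hx, hy]
  | smul c x hx => simp only [mul_smul_comm, map_smul, hx]

theorem X_mul_frShift_mul {δ : ℕ} (hδ : δ ≤ 1) {a : ℕ} (ha : a < p) {b : U k}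
    (hb : (tripleU k).mu p a * b = b) (h_carry : (tripleU k).carry p a * b = δ • b) (q : ℕ)
    (z : U k) : (tripleU k).X (p * q) * frShift k p δ z * b =
      frShift k p δ ((tripleU k).X q * z) * b := by
  induction z using U_induction with
  | basis m n l => exact ((isFrobenius_frShift k p δ).X_mul hδ ha hb h_carry q m n l).symm
  | add x y hx hy => simp only [mul_add, add_mul, map_add, hx, hy]
  | smul c x hx => simp only [mul_smul_comm, smul_mul_assoc, map_smul, hx]

theorem YX_commute_frShift (δ : ℕ) (z : U k) :
    Commute ((tripleU k).Y 1 * (tripleU k).X 1) (frShift k p δ z) := by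
  induction z using U_induction with
  | basis m n l => exact (isFrobenius_frShift k p δ).YX_commute m n l
  | add x y hx hy => exact map_add (frShift k p δ) x y ▸ hx.add_right hy
  | smul c x hx => exact map_smul (frShift k p δ) c x ▸ hx.smul_right c

theorem mu_mul_sum_pow_mul_frShift_mul_pow {a s n N w : ℕ} (hw : a + 2 * s = p + w) (ha : a < p)
    (hwp : w < p) (hs : s ≤ n) (c : ℕ → ZMod p) (z : U k) :
    (tripleU k).mu p a * ∑ m ∈ Finset.Icc n N, c m • ((tripleU k).Y 1 ^ m *
        (tripleU k).X 1 ^ (m - s) * frShift k p 0 z * (tripleU k).X 1 ^ s) =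
      frShift k p 1 z * ((tripleU k).mu p a *
        ∑ m ∈ Finset.Icc n N, c m • ((tripleU k).Y 1 ^ m * (tripleU k).X 1 ^ m)) := by
  induction z using U_induction with
  | basis m' n' l' =>
    exact DividedPowerTriple.mu_mul_sum_pow_mul_frobenius_mul_pow (isFrobenius_frShift k p 0)
      (isFrobenius_frShift k p 1) hw ha hwp hs c m' n' l'
  | add x y hx hy =>
    simp only [mul_add, add_mul, map_add, smul_add, Finset.sum_add_distrib, hx, hy]
  | smul t x hx =>
    simp only [mul_smul_comm, smul_mul_assoc, map_smul, smul_comm _ t, ← Finset.smul_sum, hx]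

end FrobeniusShift

section Recursion

variable {p : ℕ} [hp : Fact p.Prime] {k : Type*} [Field k] [CharP k p]

attribute [local instance] ZMod.algebra

theorem B₁_eq_mu_mul_sum {a : ℤ} {j : ℚ} (haj : (a, j) ∈ pairs p) (ε : Fin 2) :
    B₁ p k ε a j = mu p k a * ∑ m ∈ Finset.Icc (nIdx p ε a j) (p - 1),
      ZMod.castHom (dvd_refl p) k (coeffB p k ε a j m) • (Yd k 1 ^ m * Xd k 1 ^ m) := by
  obtain ⟨b, f, κ, l, h⟩ := exists_representsPair k haj
  obtain rfl := h.eq_natCast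
  have h_exists : ∃ c : ℕ → ZMod p, B₁ p k ε b j =
      mu p k b * ∑ m ∈ Finset.Icc (nIdx p ε b j) (p - 1),
        ZMod.castHom (dvd_refl p) k (c m) • (Yd k 1 ^ m * Xd k 1 ^ m) := by
    rw [h.B₁_eq, mu_eq_tripleU_mu]
    exact (tripleU k).exists_aevalYX_mul_mu_eq b (h.nIdx_le ε) (h.phi_nIdx_dvd ε)
      (h.natDegree_lt ε)
  exact Classical.epsilon_spec h_exists

open Classical in
theorem Z_eq_frShift_mul {a : ℤ} {j : ℚ} (haj : (a, j) ∈ pairs p) (ε : Fin 2) (z : U k) :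
    Z p k ε z a j = frShift k p (if IsAC p a j then 1 else 0) z * B₁ p k ε a j := by
  obtain ⟨b, f, κ, l, h⟩ := exists_representsPair k haj
  obtain rfl := h.eq_natCast
  by_cases hAC : IsAC p b j
  · obtain ⟨w, hwp, hw⟩ := h.exists_weight hAC
    rw [if_pos hAC, Z, if_pos hAC, B₁_eq_mu_mul_sum haj, mu_eq_tripleU_mu, frPrime_eq_frShift_zero]
    exact mu_mul_sum_pow_mul_frShift_mul_pow hw h.lt hwp (h.sShift_le_nIdx hAC ε)
      (coeffB p k ε b j) z
  · rw [if_neg hAC, Z, if_neg hAC, frPrime_eq_frShift_zero]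

theorem Z_add {a : ℤ} {j : ℚ} (haj : (a, j) ∈ pairs p) (ε : Fin 2) (z w : U k) :
    Z p k ε (z + w) a j = Z p k ε z a j + Z p k ε w a j := by
  simp only [Z_eq_frShift_mul haj, map_add, add_mul]

theorem Z_smul {a : ℤ} {j : ℚ} (haj : (a, j) ∈ pairs p) (ε : Fin 2) (c : k) (z : U k) :
    Z p k ε (c • z) a j = c • Z p k ε z a j := by
  simp only [Z_eq_frShift_mul haj, map_smul, smul_mul_assoc]

theorem Yd_mul_Xd_mul_B₁_zero {a : ℤ} {j : ℚ} (haj : (a, j) ∈ pairs p) :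
    Yd k 1 * Xd k 1 * B₁ p k 0 a j =
      ((j ^ 2 - ((a + 1) / 2) ^ 2 : ℚ) : k) • B₁ p k 0 a j +
        ((4 * j ^ 2 : ℚ) : k) • B₁ p k 1 a j := by
  obtain ⟨b, f, κ, l, h⟩ := exists_representsPair k haj
  rw [h.B₁_eq, h.B₁_eq, h.ratCast_κ, h.ratCast_l]
  exact (tripleU k).Y_mul_X_mul_aevalYX_mul_mu h.dvd_zero

theorem Yd_mul_Xd_mul_B₁_one {a : ℤ} {j : ℚ} (haj : (a, j) ∈ pairs p) :
    Yd k 1 * Xd k 1 * B₁ p k 1 a j = ((j ^ 2 - ((a + 1) / 2) ^ 2 : ℚ) : k) • B₁ p k 1 a j := by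
  obtain ⟨b, f, κ, l, h⟩ := exists_representsPair k haj
  have h_dvd : phi p b p ∣ (Polynomial.X - Polynomial.C κ) * f 1 - Polynomial.C 0 * 0 := by
    simpa using h.dvd_one
  have h_mul := (tripleU k).Y_mul_X_mul_aevalYX_mul_mu h_dvd
  rw [zero_smul, add_zero] at h_mul
  rw [h.B₁_eq, h.ratCast_κ]
  exact h_mul

theorem Yd_mul_Xd_mul_frShift_mul (δ : ℕ) (z b : U k) :
    Yd k 1 * Xd k 1 * (frShift k p δ z * b) = frShift k p δ z * (Yd k 1 * Xd k 1 * b) := by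
  rw [← mul_assoc, ← mul_assoc]
  exact congrArg (· * b) (YX_commute_frShift δ z).eq

theorem Yd_mul_Xd_mul_Z_zero {a : ℤ} {j : ℚ} (haj : (a, j) ∈ pairs p) (z : U k) :
    Yd k 1 * Xd k 1 * Z p k 0 z a j =
      ((j ^ 2 - ((a + 1) / 2) ^ 2 : ℚ) : k) • Z p k 0 z a j +
        ((4 * j ^ 2 : ℚ) : k) • Z p k 1 z a j := by
  simp only [Z_eq_frShift_mul haj, Yd_mul_Xd_mul_frShift_mul, Yd_mul_Xd_mul_B₁_zero haj, mul_add,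
    mul_smul_comm]

theorem Yd_mul_Xd_mul_Z_one {a : ℤ} {j : ℚ} (haj : (a, j) ∈ pairs p) (z : U k) :
    Yd k 1 * Xd k 1 * Z p k 1 z a j = ((j ^ 2 - ((a + 1) / 2) ^ 2 : ℚ) : k) • Z p k 1 z a j := by
  simp only [Z_eq_frShift_mul haj, Yd_mul_Xd_mul_frShift_mul, Yd_mul_Xd_mul_B₁_one haj,
    mul_smul_comm]

open Classical in
theorem Yd_mul_Xd_mul_Z {a : ℤ} {j : ℚ} (haj : (a, j) ∈ pairs p) (ε : Fin 2) (q : ℕ) (z : U k) :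
    Yd k (p * q) * Xd k (p * q) * Z p k ε z a j = Z p k ε (Yd k q * Xd k q * z) a j := by
  obtain ⟨b, f, κ, l, h⟩ := exists_representsPair k haj
  obtain rfl := h.eq_natCast
  rw [Z_eq_frShift_mul haj, Z_eq_frShift_mul haj]
  set δ := if IsAC p b j then 1 else 0 with hδ
  have h_mu : (tripleU k).mu p b * B₁ p k ε b j = B₁ p k ε b j := by
    rw [h.B₁_eq, (tripleU k).mu_mul_aevalYX_mul_mu]
  have h_carry : (tripleU k).carry p b * B₁ p k ε b j = δ • B₁ p k ε b j := by
    rw [h.B₁_eq, hδ]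
    split_ifs with hAC
    · rw [one_smul]
      exact (tripleU k).carry_mul_aevalYX_eq_self (h.pos_of_isAC hAC) h.lt (h.dvd_of_isAC hAC ε)
    · rw [zero_smul]
      exact (tripleU k).carry_mul_aevalYX_eq_zero (h.dvd_of_not_isAC hAC ε)
  have hδ_le : δ ≤ 1 := by rw [hδ]; split_ifs <;> omega
  calc Yd k (p * q) * Xd k (p * q) * (frShift k p δ z * B₁ p k ε b j)
      = Yd k (p * q) * (Xd k (p * q) * frShift k p δ z * B₁ p k ε b j) := by simp only [mul_assoc]
    _ = Yd k (p * q) * (frShift k p δ (Xd k q * z) * B₁ p k ε b j) :=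
        congrArg (_ * ·) (X_mul_frShift_mul hδ_le h.lt h_mu h_carry q z)
    _ = Yd k (p * q) * frShift k p δ (Xd k q * z) * B₁ p k ε b j := (mul_assoc _ _ _).symm
    _ = frShift k p δ (Yd k q * (Xd k q * z)) * B₁ p k ε b j :=
        congrArg (· * _) (Y_mul_frShift δ q _)
    _ = frShift k p δ (Yd k q * Xd k q * z) * B₁ p k ε b j := by rw [mul_assoc]

end Recursion

section Tuples

theorem add_single_zero_comp_succ {M : Type*} [AddZeroClass M] {r : ℕ} (ε : Fin (r + 1) → M)
    (x : M) : (fun i : Fin r => (ε + Pi.single 0 x : Fin (r + 1) → M) i.succ) =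
      fun i => ε i.succ := by
  funext i
  rw [Pi.add_apply, Pi.single_eq_of_ne (Fin.succ_ne_zero i), add_zero]

theorem add_single_succ_comp_succ {M : Type*} [AddZeroClass M] {r : ℕ} (ε : Fin (r + 1) → M)
    (s : Fin r) (x : M) : (fun i : Fin r => (ε + Pi.single s.succ x : Fin (r + 1) → M) i.succ) =
      (fun i => ε i.succ) + Pi.single s x := by
  funext i
  simp only [Pi.add_apply, Pi.single_apply, Fin.succ_inj]

variable {p : ℕ} [hp : Fact p.Prime] {k : Type*} [Field k] [CharP k p]

theorem B_add_single_zero {r : ℕ} (ε : Fin (r + 2) → Fin 2) (a : Fin (r + 2) → ℤ)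
    (j : Fin (r + 2) → ℚ) : B p k (r + 2) (ε + Pi.single 0 1) a j =
      Z p k (ε 0 + 1) (B p k (r + 1) (fun i => ε i.succ) (fun i => a i.succ) fun i => j i.succ)
        (a 0) (j 0) := by
  rw [B, add_single_zero_comp_succ, Pi.add_apply, Pi.single_eq_same]

theorem B_add_single_succ {r : ℕ} (ε : Fin (r + 2) → Fin 2) (a : Fin (r + 2) → ℤ)
    (j : Fin (r + 2) → ℚ) (s : Fin (r + 1)) : B p k (r + 2) (ε + Pi.single s.succ 1) a j =
      Z p k (ε 0) (B p k (r + 1) ((fun i => ε i.succ) + Pi.single s 1) (fun i => a i.succ)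
        fun i => j i.succ) (a 0) (j 0) := by
  rw [B, add_single_succ_comp_succ, Pi.add_apply, Pi.single_eq_of_ne (Fin.succ_ne_zero s).symm,
    add_zero]

theorem Yd_mul_Xd_mul_B_zero {r : ℕ} {ε : Fin r → Fin 2} {a : Fin r → ℤ} {j : Fin r → ℚ}
    (haj : ∀ i, (a i, j i) ∈ pairs p) {s : Fin r} (hs : ε s = 0) :
    Yd k (p ^ (s : ℕ)) * Xd k (p ^ (s : ℕ)) * B p k r ε a j =
      (((j s) ^ 2 - (((a s : ℚ) + 1) / 2) ^ 2 : ℚ) : k) • B p k r ε a j +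
        ((4 * (j s) ^ 2 : ℚ) : k) • B p k r (ε + Pi.single s 1) a j := by
  induction r with
  | zero => exact s.elim0
  | succ r ih =>
    cases r with
    | zero =>
      obtain rfl : s = 0 := Subsingleton.elim (α := Fin 1) s 0
      simp only [B, Fin.val_zero, pow_zero, Pi.add_apply, Pi.single_eq_same, hs, zero_add]
      exact Yd_mul_Xd_mul_B₁_zero (haj 0)
    | succ r =>
      cases s using Fin.cases with
      | zero =>
        rw [B_add_single_zero, B, Fin.val_zero, pow_zero, hs, zero_add]
        exact Yd_mul_Xd_mul_Z_zero (haj 0) _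
      | succ s =>
        rw [B_add_single_succ, B, Fin.val_succ, pow_succ', Yd_mul_Xd_mul_Z (haj 0),
          ih (fun i => haj i.succ) hs, Z_add (haj 0), Z_smul (haj 0), Z_smul (haj 0)]

theorem Yd_mul_Xd_mul_B_one {r : ℕ} {ε : Fin r → Fin 2} {a : Fin r → ℤ} {j : Fin r → ℚ}
    (haj : ∀ i, (a i, j i) ∈ pairs p) {s : Fin r} (hs : ε s = 1) :
    Yd k (p ^ (s : ℕ)) * Xd k (p ^ (s : ℕ)) * B p k r ε a j =
      (((j s) ^ 2 - (((a s : ℚ) + 1) / 2) ^ 2 : ℚ) : k) • B p k r ε a j := by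
  induction r with
  | zero => exact s.elim0
  | succ r ih =>
    cases r with
    | zero =>
      obtain rfl : s = 0 := Subsingleton.elim (α := Fin 1) s 0
      simp only [B, Fin.val_zero, pow_zero, hs]
      exact Yd_mul_Xd_mul_B₁_one (haj 0)
    | succ r =>
      cases s using Fin.cases with
      | zero =>
        rw [B, Fin.val_zero, pow_zero, hs]
        exact Yd_mul_Xd_mul_Z_one (haj 0) _
      | succ s =>
        rw [B, Fin.val_succ, pow_succ', Yd_mul_Xd_mul_Z (haj 0), ih (fun i => haj i.succ) hs,
          Z_smul (haj 0)]

end Tuples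

end Hyperalgebra

end

theorem proposition3p7_general (p : ℕ) [Fact p.Prime] (k : Type*) [Field k] [CharP k p]
    (r : ℕ) (ε : Fin r → Fin 2) (a : Fin r → ℤ) (j : Fin r → ℚ)
    (haj : ∀ i, (a i, j i) ∈ Hyperalgebra.pairs p) (s : Fin r) :
    (ε s = 0 →
      Hyperalgebra.Yd k (p ^ (s : ℕ)) * Hyperalgebra.Xd k (p ^ (s : ℕ)) *
          Hyperalgebra.B p k r ε a j =
        (((j s) ^ 2 - (((a s : ℚ) + 1) / 2) ^ 2 : ℚ) : k) • Hyperalgebra.B p k r ε a j +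
          ((4 * (j s) ^ 2 : ℚ) : k) • Hyperalgebra.B p k r (ε + Pi.single s 1) a j) ∧
    (ε s = 1 →
      Hyperalgebra.Yd k (p ^ (s : ℕ)) * Hyperalgebra.Xd k (p ^ (s : ℕ)) *
          Hyperalgebra.B p k r ε a j =
        (((j s) ^ 2 - (((a s : ℚ) + 1) / 2) ^ 2 : ℚ) : k) • Hyperalgebra.B p k r ε a j) :=
  ⟨Hyperalgebra.Yd_mul_Xd_mul_B_zero haj, Hyperalgebra.Yd_mul_Xd_mul_B_one haj⟩

theorem proposition3p7 (p : ℕ) [Fact p.Prime] (k : Type*) [Field k] [IsAlgClosed k] [CharP k p]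
    (r : ℕ) (ε : Fin r → Fin 2) (a : Fin r → ℤ) (j : Fin r → ℚ)
    (haj : ∀ i, (a i, j i) ∈ Hyperalgebra.pairs p) (s : Fin r) :
    (ε s = 0 →
      Hyperalgebra.Yd k (p ^ (s : ℕ)) * Hyperalgebra.Xd k (p ^ (s : ℕ)) *
          Hyperalgebra.B p k r ε a j =
        (((j s) ^ 2 - (((a s : ℚ) + 1) / 2) ^ 2 : ℚ) : k) • Hyperalgebra.B p k r ε a j +
          ((4 * (j s) ^ 2 : ℚ) : k) • Hyperalgebra.B p k r (ε + Pi.single s 1) a j) ∧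
    (ε s = 1 →
      Hyperalgebra.Yd k (p ^ (s : ℕ)) * Hyperalgebra.Xd k (p ^ (s : ℕ)) *
          Hyperalgebra.B p k r ε a j =
        (((j s) ^ 2 - (((a s : ℚ) + 1) / 2) ^ 2 : ℚ) : k) • Hyperalgebra.B p k r ε a j) :=
  proposition3p7_general p k r ε a j haj s
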